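/- Let $\varphi(X)$ be a $\Sigma^1_2$-formula of second-order arithmetic, i.e. $\exists Y\,\forall Z\,\theta(X,Y,Z)$ with $\theta$ arithmetical, with no free variable other than the set variable $X$. Then there is a recursive locally well-founded genedendron $(D,\varrho)$ that provably in $\mathsf{ACA}_0$ generates the real defined by $\varphi$. Precisely: there are $\Delta^0_1$-definitions without set parameters of a set coding a linear order $(X,\le_X)$ with $X\subseteq\mathbb N$, of a set $D$, and of a set coding $\varrho=\varrho_\omega$, depending only on $\varphi$, such that $\mathsf{ACA}_0$ proves (that is, the following holds in every, possibly nonstandard, model of $\mathsf{ACA}_0$): for each of the three sets, its $\Sigma^0_1$- and its $\Pi^0_1$-definition agree, and if $R$ is the unique real satisfying $\varphi$, then * $(D,\varrho)$ is a locally well-founded genedendron over $X$, and * there are a well-order $\alpha$ and an infinite branch $B$ of $D_\alpha^*$ with $\varrho_\alpha(B)=R$. This holds for reals as functions $R:\mathbb N\to\mathbb N$ ($\varphi$ is evaluated at graphs of functions and $R$ is the only function whose graph satisfies $\varphi$), and also for reals as subsets $R\subseteq\mathbb N$ ($R$ is the only set satisfying $\varphi$, and $\varrho_\alpha(B)$ is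 the characteristic function of $R$). *Definitions.* All of these are read inside second-order arithmetic: numbers are those of the model, sets, functions, orders and branches are those in the model, and finite sequences are coded by numbers. For a set $D$ of finite sequences, $D^*$ is its closure under initial segments. Let $X,\alpha$ be linear orders. An *$\alpha$-prequasidendroid over $X$* is a set $D$ of finite sequences over the disjoint union $X\sqcup\alpha$ (elements of $X$ are *terms*, elements of $\alpha$ are *parameters*) such that no element of $D$ is a proper initial segment of another element of $D$, and no $\sigma\in D^*$ has both an extension $\sigma^\frown\langle x\rangle\in D^*$ by a term and an extension $\sigma^\frown\langle\xi\rangle\in D^*$ by a parameter. For an increasing map $f$, $f(\sigma)$ denotes the result of replacing each parameter $\xi$ of $\sigma$ by $f(\xi)$. $D$ is *homogeneous* if for every linear order $\gamma$ and all increasing $f,g:\gamma\to\alpha$ and every finite sequence $\sigma$ over $X\sqcup\gamma$ we have $f(\sigma)\in D\iff g(\sigma)\in D$. A *prequasidendroid* is a homogeneous $\omega$-prequasidendroid. Let $D$ be one. For a linear order $\alpha$, its *instantiation* is $D_\alpha=\{f(\sigma):\sigma\in D,\ f:\mathrm{Occ}(\sigma)\to\alpha\text{ increasing}\}$, where $\mathrm{Occ}(\sigma)$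 is the set of parameters occurring in $\sigma$. $D$ is *locally well-founded* if for each $\sigma\in D^*$ the set $\{x\in X:\sigma^\frown\langle x\rangle\in D^*\}$ is well-ordered by $\le_X$. A *semi-genedendron* is a pair $(D,\varrho)$ of a prequasidendroid $D$ and a family of functions $\varrho_\alpha:D_\alpha^*\to\mathbb N^{<\omega}$, for well-orders $\alpha$, such that $\sigma\subseteq\tau$ implies $\varrho_\alpha(\sigma)\subseteq\varrho_\alpha(\tau)$, and $\varrho_\alpha(f(\sigma))=\varrho_\gamma(\sigma)$ for all increasing $f:\gamma\to\alpha$ and all $\sigma\in D_\gamma^*$. Such a family is determined by $\varrho_\omega$, and it is given by $\varrho_\omega$ here: $\varrho_\alpha(f(\sigma))=\varrho_\omega(\sigma)$ for $\sigma\in D^*$, $f:\mathrm{Occ}(\sigma)\to\alpha$ increasing and $f(\sigma)\in D_\alpha^*$. It is a *genedendron* if $\varrho_\alpha(b):=\bigcup_n\varrho_\alpha(b\restriction n)$ has the same value for all well-orders $\alpha$ and all infinite branches $b$ of $D_\alpha^*$. -/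

import Mathlib

universe u

namespace SOA

/-! ### The language of second-order arithmetic -/

/-- Number terms with `n` free number variables (de Bruijn indices). -/
inductive Tm (n : ℕ) : Type
  | var (i : Fin n) : Tm n
  | zero : Tm n
  | one : Tm n
  | add (s t : Tm n) : Tm n
  | mul (s t : Tm n) : Tm n

/-- Weakening of a term by a new number variable with index `0`. -/
def Tm.lift {n : ℕ} : Tm n → Tm (n + 1)
  | .var i => .var i.succ
  | .zero => .zero
  | .one => .one
  | .add s t => .add s.lift t.lift
  | .mul s t => .mul s.lift t.lift

/-- Formulas with `n` free number variables and `k` free set variables. -/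
inductive Fm : ℕ → ℕ → Type
  | eq {n k : ℕ} (s t : Tm n) : Fm n k
  | lt {n k : ℕ} (s t : Tm n) : Fm n k
  | mem {n k : ℕ} (t : Tm n) (X : Fin k) : Fm n k
  | falsum {n k : ℕ} : Fm n k
  | imp {n k : ℕ} (φ ψ : Fm n k) : Fm n k
  | allN {n k : ℕ} (φ : Fm (n + 1) k) : Fm n k
  | allS {n k : ℕ} (φ : Fm n (k + 1)) : Fm n k

namespace Fm

def neg {n k : ℕ} (φ : Fm n k) : Fm n k := .imp φ .falsum

def exN {n k : ℕ} (φ : Fm (n + 1) k) : Fm n k := neg (.allN (neg φ))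

def exS {n k : ℕ} (φ : Fm n (k + 1)) : Fm n k := neg (.allS (neg φ))

/-- The bounded quantification `∀ x < t, φ`; the term `t` does not contain `x`. -/
def ball {n k : ℕ} (t : Tm n) (φ : Fm (n + 1) k) : Fm n k :=
  .allN (.imp (.lt (.var 0) t.lift) φ)

/-- Arithmetical formulas: no set quantifiers (free set variables are allowed). -/
def IsArith : {n k : ℕ} → Fm n k → Prop
  | _, _, .eq _ _ => True
  | _, _, .lt _ _ => True
  | _, _, .mem _ _ => True
  | _, _, .falsum => True
  | _, _, .imp φ ψ => IsArith φ ∧ IsArith ψ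
  | _, _, .allN φ => IsArith φ
  | _, _, .allS _ => False

/-- Bounded formulas: all quantifiers are bounded number quantifiers. -/
inductive IsBounded : {n k : ℕ} → Fm n k → Prop
  | eq {n k : ℕ} (s t : Tm n) : IsBounded (Fm.eq (k := k) s t)
  | lt {n k : ℕ} (s t : Tm n) : IsBounded (Fm.lt (k := k) s t)
  | mem {n k : ℕ} (t : Tm n) (X : Fin k) : IsBounded (Fm.mem t X)
  | falsum {n k : ℕ} : IsBounded (Fm.falsum (n := n) (k := k))
  | imp {n k : ℕ} {φ ψ : Fm n k} : IsBounded φ → IsBounded ψ → IsBounded (Fm.imp φ ψ)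
  | ball {n k : ℕ} (t : Tm n) {φ : Fm (n + 1) k} : IsBounded φ → IsBounded (Fm.ball t φ)

def IsSigma01 {n k : ℕ} (φ : Fm n k) : Prop := ∃ θ, IsBounded θ ∧ φ = exN θ

def IsPi01 {n k : ℕ} (φ : Fm n k) : Prop := ∃ θ, IsBounded θ ∧ φ = .allN θ

/-- `∃ Y ∀ Z θ` with `θ` arithmetical. -/
def IsSigma12 {n k : ℕ} (φ : Fm n k) : Prop := ∃ θ, IsArith θ ∧ φ = exS (.allS θ)

end Fm

/-! ### Structures for second-order arithmetic and the theory ACA₀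

A structure consists of a first-order part `N` and a collection `S` of subsets of `N` over
which the set quantifiers range.  It may be nonstandard. -/

class ArithStr (N : Type u) extends Zero N, One N, Add N, Mul N, LT N

variable {N : Type u} [ArithStr N]

def Tm.val {n : ℕ} (v : Fin n → N) : Tm n → N
  | .var i => v i
  | .zero => 0
  | .one => 1
  | .add s t => s.val v + t.val v
  | .mul s t => s.val v * t.val v

/-- Satisfaction in the structure `(N, S)`. -/
def Fm.Sat (S : Set (Set N)) : {n k : ℕ} → Fm n k → (Fin n → N) → (Fin k → Set N) → Prop
  | _, _, .eq s t, v, _ => s.val v = t.val v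
  | _, _, .lt s t, v, _ => s.val v < t.val v
  | _, _, .mem t X, v, V => t.val v ∈ V X
  | _, _, .falsum, _, _ => False
  | _, _, .imp φ ψ, v, V => φ.Sat S v V → ψ.Sat S v V
  | _, _, .allN φ, v, V => ∀ a : N, φ.Sat S (Matrix.vecCons a v) V
  | _, _, .allS φ, v, V => ∀ A ∈ S, φ.Sat S v (Matrix.vecCons A V)

/-- `(N, S)` is a model of ACA₀: basic axioms, the induction axiom, and comprehension for
arithmetical formulas with number and set parameters. -/
structure ModelsACA0 (S : Set (Set N)) : Prop where
  succ_ne_zero : ∀ m : N, m + 1 ≠ 0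
  succ_inj : ∀ m n : N, m + 1 = n + 1 → m = n
  add_zero : ∀ m : N, m + 0 = m
  add_succ : ∀ m n : N, m + (n + 1) = (m + n) + 1
  mul_zero : ∀ m : N, m * 0 = 0
  mul_succ : ∀ m n : N, m * (n + 1) = m * n + m
  not_lt_zero : ∀ m : N, ¬ m < 0
  lt_succ : ∀ m n : N, m < n + 1 ↔ (m < n ∨ m = n)
  induction : ∀ X ∈ S, (0 : N) ∈ X → (∀ n ∈ X, n + 1 ∈ X) → ∀ n, n ∈ X
  comprehension : ∀ {n k : ℕ} (θ : Fm (n + 1) k), θ.IsArith →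
    ∀ (v : Fin n → N) (V : Fin k → Set N), (∀ i, V i ∈ S) →
      {a : N | θ.Sat S (Matrix.vecCons a v) V} ∈ S

/-- A lightface `Δ⁰₁` definition of a set of natural numbers: a `Σ⁰₁` formula and a `Π⁰₁` formula
in one number variable, without set parameters. -/
structure Delta01 where
  sig : Fm 1 0
  pi : Fm 1 0
  sig_isSigma01 : sig.IsSigma01
  pi_isPi01 : pi.IsPi01

/-- In the structure `(N, S)` the two formulas define the same set. -/
def Delta01.Valid (S : Set (Set N)) (d : Delta01) : Prop :=
  ∀ a : N, d.sig.Sat S ![a] ![] ↔ d.pi.Sat S ![a] ![]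

/-- The set that is defined in the structure `(N, S)`. -/
def Delta01.set (S : Set (Set N)) (d : Delta01) : Set N := {a | d.sig.Sat S ![a] ![]}

/-! ### Notions inside a structure

From here on all number quantifiers range over `N` and all set quantifiers over `S`. -/

/-- The pairing term `(a + b)² + a`. -/
def pair (a b : N) : N := (a + b) * (a + b) + a

/-- `r` is the remainder of `a` modulo `m`. -/
def IsRem (a m r : N) : Prop := r < m ∧ ∃ q, a = q * m + r

/-- A number `((a, b), l)` codes a sequence of length `l` through Gödel's beta function. -/
def IsLen (s l : N) : Prop := ∃ a b, s = pair (pair a b) l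

/-- `x` is the entry with index `i` of the sequence coded by `s`. -/
def Entry (s i x : N) : Prop :=
  ∃ a b l, s = pair (pair a b) l ∧ i < l ∧ IsRem a ((i + 1) * b + 1) x

def SameSeq (s t : N) : Prop :=
  (∀ l, IsLen s l ↔ IsLen t l) ∧ ∀ i x, Entry s i x ↔ Entry t i x

/-- `s` is a finite sequence of numbers: each sequence is identified with its least code. -/
def IsSeq (s : N) : Prop := (∃ l, IsLen s l) ∧ ∀ t, t < s → ¬ SameSeq t s

/-- `s` is a (not necessarily proper) initial segment of `t`. -/
def IsPrefix (s t : N) : Prop := IsSeq s ∧ IsSeq t ∧ ∀ i x, Entry s i x → Entry t i x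

/-- `t` is the sequence `s ⌢ ⟨x⟩`. -/
def IsSnoc (s x t : N) : Prop :=
  IsPrefix s t ∧ ∃ l, IsLen s l ∧ IsLen t (l + 1) ∧ Entry t l x

/-- `f` is (the graph of) a function from numbers to numbers that belongs to the structure. -/
def IsFun (S : Set (Set N)) (f : Set N) : Prop :=
  f ∈ S ∧ (∀ p ∈ f, ∃ i x, p = pair i x) ∧ ∀ i, ∃! x, pair i x ∈ f

/-- `t` is the initial segment of length `n` of the function `b`. -/
def IsInit (b : Set N) (n t : N) : Prop :=
  IsSeq t ∧ IsLen t n ∧ ∀ i x, Entry t i x → pair i x ∈ b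

/-- `b` is an infinite branch of the tree `T`. -/
def IsBranch (S : Set (Set N)) (T b : Set N) : Prop :=
  IsFun S b ∧ ∀ n, ∃ t, IsInit b n t ∧ t ∈ T

/-! #### Linear orders, coded as sets of pairs `(i, j)` with `i ≤ j` -/

def fld (A : Set N) : Set N := {i | pair i i ∈ A}

def OrdLt (A : Set N) (i j : N) : Prop := pair i j ∈ A ∧ i ≠ j

structure IsLO (A : Set N) : Prop where
  pairs : ∀ p ∈ A, ∃ i j, p = pair i j
  field : ∀ i j, pair i j ∈ A → i ∈ fld A ∧ j ∈ fld A
  antisymm : ∀ i j, pair i j ∈ A → pair j i ∈ A → i = j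
  trans : ∀ i j k, pair i j ∈ A → pair j k ∈ A → pair i k ∈ A
  total : ∀ i ∈ fld A, ∀ j ∈ fld A, pair i j ∈ A ∨ pair j i ∈ A

/-- `A` is a well-order: a linear order without infinite descending sequences. -/
def IsWO (S : Set (Set N)) (A : Set N) : Prop :=
  IsLO A ∧ ¬ ∃ f, IsFun S f ∧ ∀ i x y, pair i x ∈ f → pair (i + 1) y ∈ f → OrdLt A y x

/-- The usual order of the natural numbers. -/
def omega : Set N := {p | ∃ i j, p = pair i j ∧ (i < j ∨ i = j)}

/-- The restriction of the order `A` to the subset `P` of its field. -/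
def restr (A P : Set N) : Set N := {p | p ∈ A ∧ ∃ i j, p = pair i j ∧ i ∈ P ∧ j ∈ P}

/-- `f` is an increasing map from the order `A` to the order `B`. -/
structure IsIncMap (S : Set (Set N)) (A B f : Set N) : Prop where
  mem : f ∈ S
  pairs : ∀ p ∈ f, ∃ x y, p = pair x y ∧ x ∈ fld A ∧ y ∈ fld B
  total : ∀ x ∈ fld A, ∃ y, pair x y ∈ f
  single : ∀ x y y', pair x y ∈ f → pair x y' ∈ f → y = y'
  increasing : ∀ x x' y y', OrdLt A x x' → pair x y ∈ f → pair x' y' ∈ f → OrdLt B y y'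

/-! #### Prequasidendroids

Elements of the disjoint union of the term part `X` and the parameter part `α` are coded as
`term x` and `param ξ` (the underlined elements). -/

def term (x : N) : N := pair 0 x

def param (ξ : N) : N := pair 1 ξ

/-- `σ` is a finite sequence over `X ⊔ α`. -/
def IsSeqOver (X α : Set N) (σ : N) : Prop :=
  IsSeq σ ∧ ∀ i z, Entry σ i z → (∃ x ∈ fld X, z = term x) ∨ (∃ ξ ∈ fld α, z = param ξ)

/-- The parameters that occur in `σ`. -/
def Occ (σ : N) : Set N := {ξ | ∃ i, Entry σ i (param ξ)}

/-- `τ` arises from `σ` by replacing each parameter by its value under `f`. -/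
def MapSeq (f : Set N) (σ τ : N) : Prop :=
  IsSeq σ ∧ IsSeq τ ∧ (∀ l, IsLen σ l ↔ IsLen τ l) ∧
    ∀ i z, Entry σ i z →
      (∃ x, z = term x ∧ Entry τ i (term x)) ∨
      (∃ ξ η, z = param ξ ∧ pair ξ η ∈ f ∧ Entry τ i (param η))

/-- `D*`, the closure of `D` under initial segments. -/
def hull (D : Set N) : Set N := {σ | ∃ τ ∈ D, IsPrefix σ τ}

/-- `D` is an `α`-prequasidendroid over `X`. -/
structure IsPreQD (X α D : Set N) : Prop where
  isSeqOver : ∀ σ ∈ D, IsSeqOver X α σ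
  antichain : ∀ σ ∈ D, ∀ τ ∈ D, IsPrefix σ τ → σ = τ
  separated : ∀ σ ∈ hull D, ¬ ∃ x ξ, ∃ τ ∈ hull D, ∃ τ' ∈ hull D,
    IsSnoc σ (term x) τ ∧ IsSnoc σ (param ξ) τ'

/-- The mutilation of `D` along the increasing map `f` with domain `γ`. -/
def mutilation (X γ f D : Set N) : Set N := {σ | IsSeqOver X γ σ ∧ ∃ τ ∈ D, MapSeq f σ τ}

/-- Homogeneity of the `α`-prequasidendroid `D` over `X`. -/
def IsHomogeneous (S : Set (Set N)) (X α D : Set N) : Prop :=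
  ∀ γ ∈ S, IsLO γ → ∀ f g, IsIncMap S γ α f → IsIncMap S γ α g →
    mutilation X γ f D = mutilation X γ g D

/-- A prequasidendroid over `X` is a homogeneous `ω`-prequasidendroid over `X`. -/
structure IsPrequasidendroid (S : Set (Set N)) (X D : Set N) : Prop where
  memX : X ∈ S
  memD : D ∈ S
  linearOrder : IsLO X
  preQD : IsPreQD X omega D
  homogeneous : IsHomogeneous S X omega D

/-- The instantiation `D_α`. -/
def inst (S : Set (Set N)) (D α : Set N) : Set N :=
  {τ | ∃ σ ∈ D, ∃ f, IsIncMap S (restr omega (Occ σ)) α f ∧ MapSeq f σ τ}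

/-- Local well-foundedness: for every `σ ∈ D*` the set of term successors of `σ` is well-ordered
by the order of `X`. -/
def IsLocallyWF (S : Set (Set N)) (X D : Set N) : Prop :=
  ∀ σ ∈ hull D, IsWO S (restr X {x | ∃ τ ∈ hull D, IsSnoc σ (term x) τ})

/-! #### Genedendrons

The extraction scheme is given by its component at `ω`, a set `r` of pairs `(σ, s)`. -/

/-- `ϱ_α(τ) = s`: here `τ ∈ D_α*` and `s = ϱ_ω(σ)` for some `σ ∈ D*` from which `τ` arises
by an increasing change of parameters. -/
def Extr (S : Set (Set N)) (D r α : Set N) (τ s : N) : Prop :=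
  τ ∈ hull (inst S D α) ∧
    ∃ σ ∈ hull D, ∃ f, IsIncMap S (restr omega (Occ σ)) α f ∧ MapSeq f σ τ ∧ pair σ s ∈ r

structure IsSemiGenedendron (S : Set (Set N)) (X D r : Set N) : Prop where
  prequasidendroid : IsPrequasidendroid S X D
  memr : r ∈ S
  /-- `ϱ_α` is a function from `D_α*` to finite sequences. -/
  function : ∀ α ∈ S, IsWO S α → ∀ σ ∈ hull (inst S D α), ∃! s, Extr S D r α σ s
  isSeq : ∀ α ∈ S, IsWO S α → ∀ σ s, Extr S D r α σ s → IsSeq s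
  monotone : ∀ α ∈ S, IsWO S α → ∀ σ τ s t, IsPrefix σ τ →
    Extr S D r α σ s → Extr S D r α τ t → IsPrefix s t
  functorial : ∀ γ ∈ S, IsWO S γ → ∀ α ∈ S, IsWO S α → ∀ f, IsIncMap S γ α f →
    ∀ σ τ s, MapSeq f σ τ → Extr S D r γ σ s → Extr S D r α τ s

/-- `ϱ_α(b)`, the union of the `ϱ_α(b ↾ n)`, as the graph of a partial function. -/
def branchValue (S : Set (Set N)) (D r α b : Set N) : Set N :=
  {p | ∃ i x, p = pair i x ∧ ∃ n t s, IsInit b n t ∧ Extr S D r α t s ∧ Entry s i x}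

/-- `(D, ϱ)` is a genedendron over `X`: the value `ϱ_α(b)` does not depend on the well-order `α`
or on the infinite branch `b`. -/
structure IsGenedendron (S : Set (Set N)) (X D r : Set N) : Prop where
  semi : IsSemiGenedendron S X D r
  constant : ∀ α ∈ S, IsWO S α → ∀ b, IsBranch S (hull (inst S D α)) b →
    ∀ α' ∈ S, IsWO S α' → ∀ b', IsBranch S (hull (inst S D α')) b' →
      branchValue S D r α b = branchValue S D r α' b'

/-! #### Definable reals -/

/-- `R`, a function from numbers to numbers, is the only such function whose graph satisfies `φ`. -/
def DefinesFun (S : Set (Set N)) (φ : Fm 0 1) (R : Set N) : Prop :=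
  IsFun S R ∧ φ.Sat S ![] ![R] ∧ ∀ R', IsFun S R' → φ.Sat S ![] ![R'] → R' = R

/-- `A` is the only set of numbers that satisfies `φ`. -/
def DefinesSet (S : Set (Set N)) (φ : Fm 0 1) (A : Set N) : Prop :=
  A ∈ S ∧ φ.Sat S ![] ![A] ∧ ∀ A' ∈ S, φ.Sat S ![] ![A'] → A' = A

/-- The graph of the characteristic function of `A`. -/
def charGraph (A : Set N) : Set N :=
  {p | ∃ i, (i ∈ A ∧ p = pair i 1) ∨ (i ∉ A ∧ p = pair i 0)}

/-- `(D, ϱ)` is a locally well-founded genedendron over `X`, and `R = ϱ_α(b)` for some well-order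
`α` and some infinite branch `b` of `D_α`. -/
def GeneratesReal (S : Set (Set N)) (X D r R : Set N) : Prop :=
  IsGenedendron S X D r ∧ IsLocallyWF S X D ∧
    ∃ α ∈ S, IsWO S α ∧ ∃ b, IsBranch S (hull (inst S D α)) b ∧ branchValue S D r α b = R

end SOA

/-! Write the formula as `∃ Y ∀ Z θ(Z, Y, R)`. The arithmetical statement `¬ θ` becomes a condition
on finite initial segments once `Z` is accompanied by an evaluation of `θ`: the truth values of all
instances of subformulas, where the value of a false universal statement names a counterexample. The
conditions `Con` on such an evaluation are local, so a violation shows up in finitely many values.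
For data `c` that code `R` and `Y`, the finite attempts at a pair of a counterexample `Z` and an
evaluation form a tree `Tree θ c`, and `∀ Z θ(Z, Y, R)` holds exactly if this tree has no path
(`exists_not_sat_of_path`, `exists_path_of_not_sat`). A tree has no path exactly if its nodes can be
mapped into a well-order so that proper extensions get smaller values: along a path the values would
descend, and conversely the Kleene–Brouwer order of a tree without paths is a well-order
(`isWO_KB`).

The elements of `D` are finite attempts to write down `R`, `Y` and such a map. The term at position
`2i` contains `R(i)` and the truth value of `i ∈ Y`, and the parameter at position `2i + 1` is the
value of the map at the number `i`, which matters only if `i` codes a node of the tree. The indices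
that occur in a node are smaller than its code, so the data on which it is based precede its
parameter. Only comparisons between parameters enter the definition. Hence `D` is homogeneous, and
`D_α` is given by the same condition with the order of `α` in place of `<` (`mem_inst`). The
extraction reads `R` off the terms. Terms are numbers in their usual order, so local
well-foundedness is the least number principle.

If `α` is a well-order, then a branch of `D_α*` yields `R'` and `Y` whose tree maps into `α`. So the
tree has no path, the formula holds of `R'`, and `R' = R` by uniqueness (`IsBranch.value_eq`).
Conversely, for a witness `Y` of the formula at `R`, let `α` be the Kleene–Brouwer order of the tree
and let each node be its own parameter; this is a branch (`exists_branch`).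

All of this takes place in a possibly nonstandard model. Induction on numbers is restricted to
arithmetical predicates (`Ar`), while recursion on formulas is external because `θ` is standard. The
sets are defined by bounded formulas that are the same in all models (`UB`), which gives the
`Δ⁰₁`-definitions. Reals as subsets reduce to reals as functions through characteristic functions.
-/

set_option linter.unusedSectionVars false
set_option synthInstance.maxHeartbeats 400000
set_option synthInstance.maxSize 1000

namespace SOA

/-! ### Substitution of terms for number variables, and renaming of set variables -/

/-- Simultaneous substitution in a term. -/
def Tm.sub {n m : ℕ} (σ : Fin n → Tm m) : Tm n → Tm m
  | .var i => σ i
  | .zero => .zero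
  | .one => .one
  | .add s t => .add (s.sub σ) (t.sub σ)
  | .mul s t => .mul (s.sub σ) (t.sub σ)

/-- The substitution under a number quantifier. -/
def liftSub {n m : ℕ} (σ : Fin n → Tm m) : Fin (n + 1) → Tm (m + 1) :=
  Fin.cases (.var 0) fun i => (σ i).lift

/-- The renaming under a set quantifier. -/
def liftRen {k l : ℕ} (κ : Fin k → Fin l) : Fin (k + 1) → Fin (l + 1) :=
  Fin.cases 0 fun i => (κ i).succ

/-- Substitution of terms for number variables and renaming of set variables. -/
def Fm.sub : {n k : ℕ} → Fm n k → {m l : ℕ} → (Fin n → Tm m) → (Fin k → Fin l) → Fm m l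
  | _, _, .eq s t, _, _, σ, _ => .eq (s.sub σ) (t.sub σ)
  | _, _, .lt s t, _, _, σ, _ => .lt (s.sub σ) (t.sub σ)
  | _, _, .mem t X, _, _, σ, κ => .mem (t.sub σ) (κ X)
  | _, _, .falsum, _, _, _, _ => .falsum
  | _, _, .imp φ ψ, _, _, σ, κ => .imp (φ.sub σ κ) (ψ.sub σ κ)
  | _, _, .allN φ, _, _, σ, κ => .allN (φ.sub (liftSub σ) κ)
  | _, _, .allS φ, _, _, σ, κ => .allS (φ.sub σ (liftRen κ))

theorem Tm.sub_lift {n m : ℕ} (σ : Fin n → Tm m) (t : Tm n) :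
    t.lift.sub (liftSub σ) = (t.sub σ).lift := by
  induction t <;> simp_all [Tm.sub, Tm.lift, liftSub]

theorem Fm.IsArith.sub {n k : ℕ} {φ : Fm n k} (h : φ.IsArith) :
    ∀ {m l : ℕ} (σ : Fin n → Tm m) (κ : Fin k → Fin l), (φ.sub σ κ).IsArith := by
  induction φ <;> simp_all [Fm.sub, Fm.IsArith]

theorem Fm.IsBounded.sub {n k : ℕ} {φ : Fm n k} (h : φ.IsBounded) :
    ∀ {m l : ℕ} (σ : Fin n → Tm m) (κ : Fin k → Fin l), (φ.sub σ κ).IsBounded := by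
  induction h with
  | eq s t => intros; exact .eq _ _
  | lt s t => intros; exact .lt _ _
  | mem t X => intros; exact .mem _ _
  | falsum => intros; exact .falsum
  | imp _ _ h1 h2 => intros; exact .imp (h1 _ _) (h2 _ _)
  | @ball _ _ t φ _ h =>
    intro m l σ κ
    have : (Fm.ball t φ).sub σ κ = Fm.ball (t.sub σ) (φ.sub (liftSub σ) κ) := by
      simp only [Fm.ball, Fm.sub, Tm.sub_lift]; rfl
    rw [this]
    exact .ball _ (h _ _)

theorem Fm.IsBounded.isArith {n k : ℕ} {φ : Fm n k} (h : φ.IsBounded) : φ.IsArith := by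
  induction h <;> simp_all [Fm.IsArith, Fm.ball]

section
variable {N : Type u} [ArithStr N]

theorem Tm.val_lift {n : ℕ} (a : N) (v : Fin n → N) (t : Tm n) :
    t.lift.val (Matrix.vecCons a v) = t.val v := by
  induction t <;> simp_all [Tm.val, Tm.lift]

theorem Tm.val_sub {n m : ℕ} (σ : Fin n → Tm m) (w : Fin m → N) (t : Tm n) :
    (t.sub σ).val w = t.val fun i => (σ i).val w := by
  induction t <;> simp_all [Tm.val, Tm.sub]

theorem val_liftSub {n m : ℕ} (σ : Fin n → Tm m) (a : N) (w : Fin m → N) :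
    (fun i => (liftSub σ i).val (Matrix.vecCons a w)) =
      Matrix.vecCons a fun i => (σ i).val w := by
  funext i
  refine Fin.cases ?_ (fun j => ?_) i
  · simp [liftSub, Tm.val]
  · simp [liftSub, Tm.val_lift]

theorem vecCons_liftRen {k l : ℕ} (κ : Fin k → Fin l) (A : Set N) (W : Fin l → Set N) :
    (fun i => (Matrix.vecCons A W : Fin (l + 1) → Set N) (liftRen κ i)) =
      Matrix.vecCons A fun i => W (κ i) := by
  funext i
  refine Fin.cases ?_ (fun j => ?_) i <;> simp [liftRen]

theorem Fm.sat_sub (S : Set (Set N)) {n k : ℕ} (φ : Fm n k) :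
    ∀ {m l : ℕ} (σ : Fin n → Tm m) (κ : Fin k → Fin l) (w : Fin m → N) (W : Fin l → Set N),
      (φ.sub σ κ).Sat S w W ↔ φ.Sat S (fun i => (σ i).val w) fun i => W (κ i) := by
  induction φ with
  | eq s t => intros; simp [Fm.sub, Fm.Sat, Tm.val_sub]
  | lt s t => intros; simp [Fm.sub, Fm.Sat, Tm.val_sub]
  | mem t X => intros; simp [Fm.sub, Fm.Sat, Tm.val_sub]
  | falsum => intros; simp [Fm.sub, Fm.Sat]
  | imp φ ψ h1 h2 => intros; simp only [Fm.sub, Fm.Sat, h1, h2]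
  | allN φ h => intros; simp only [Fm.sub, Fm.Sat, h, val_liftSub]
  | allS φ h => intros; simp only [Fm.sub, Fm.Sat, h, vecCons_liftRen]

/-! ### Arithmetical predicates with parameters -/

/-- `P` is defined by an arithmetical formula with set parameters from `S`. -/
class Ar (S : Set (Set N)) {n : ℕ} (P : (Fin n → N) → Prop) : Prop where
  out : ∃ (k : ℕ) (θ : Fm n k) (V : Fin k → Set N), θ.IsArith ∧ (∀ i, V i ∈ S) ∧
    ∀ v, θ.Sat S v V ↔ P v

/-- The graph of `f` is arithmetical. -/
class ArF (S : Set (Set N)) {n : ℕ} (f : (Fin n → N) → N) : Prop where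
  out : Ar S fun w : Fin (n + 1) → N => w 0 = f fun i => w i.succ

/-- `A` belongs to `S`. -/
class MemS (S : Set (Set N)) (A : Set N) : Prop where
  out : A ∈ S

variable {S : Set (Set N)} {n : ℕ}

theorem Ar.congr {P Q : (Fin n → N) → Prop} (h : Ar S P) (e : ∀ v, Q v ↔ P v) : Ar S Q := by
  have : Q = P := funext fun v => propext (e v)
  rwa [this]

theorem Ar.subst {m : ℕ} {P : (Fin n → N) → Prop} (h : Ar S P) (σ : Fin n → Tm m) :
    Ar S fun w => P fun i => (σ i).val w := by
  obtain ⟨k, θ, V, h1, h2, h3⟩ := h.out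
  exact ⟨k, θ.sub σ id, V, h1.sub _ _, h2, fun v => by rw [Fm.sat_sub]; exact h3 _⟩

theorem Ar.ren {m : ℕ} {P : (Fin n → N) → Prop} (h : Ar S P) (ρ : Fin n → Fin m) :
    Ar S fun w => P fun i => w (ρ i) := h.subst fun i => .var (ρ i)

instance Ar.instImp {P Q : (Fin n → N) → Prop} [hP : Ar S P] [hQ : Ar S Q] :
    Ar S fun v => P v → Q v := by
  obtain ⟨k, θ, V, h1, h2, h3⟩ := hP.out
  obtain ⟨l, η, W, h1', h2', h3'⟩ := hQ.out
  -- The two formulas may have different set parameters; the lists are concatenated and the set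
  -- variables renamed accordingly.
  refine ⟨k + l, .imp (θ.sub .var (Fin.castAdd l)) (η.sub .var (Fin.natAdd k)),
    Fin.append V W, ⟨h1.sub _ _, h1'.sub _ _⟩, fun i => ?_, fun v => ?_⟩
  · refine Fin.addCases (fun j => ?_) (fun j => ?_) i
    · simpa using h2 j
    · simpa using h2' j
  · simp only [Fm.Sat, Fm.sat_sub, Tm.val, Fin.append_left, Fin.append_right, h3, h3']

instance Ar.instFalse : Ar S fun _ : Fin n → N => False :=
  ⟨0, .falsum, ![], trivial, fun i => i.elim0, fun _ => Iff.rfl⟩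

instance Ar.instAll {P : (Fin n → N) → N → Prop}
    [hP : Ar S fun w : Fin (n + 1) → N => P (fun i => w i.succ) (w 0)] :
    Ar S fun v => ∀ x, P v x := by
  obtain ⟨k, θ, V, h1, h2, h3⟩ := hP.out
  refine ⟨k, .allN θ, V, h1, h2, fun v => ?_⟩
  simp only [Fm.Sat, h3]
  simp

instance Ar.instNot {P : (Fin n → N) → Prop} [Ar S P] : Ar S fun v => ¬ P v :=
  inferInstanceAs (Ar S fun v => P v → False)

instance Ar.instAnd {P Q : (Fin n → N) → Prop} [Ar S P] [Ar S Q] : Ar S fun v => P v ∧ Q v :=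
  (inferInstance : Ar S fun v => ¬ (P v → ¬ Q v)).congr fun _ => by simp

instance Ar.instOr {P Q : (Fin n → N) → Prop} [Ar S P] [Ar S Q] : Ar S fun v => P v ∨ Q v :=
  (inferInstance : Ar S fun v => (¬ P v → Q v)).congr fun _ => by tauto

instance Ar.instIff {P Q : (Fin n → N) → Prop} [Ar S P] [Ar S Q] : Ar S fun v => (P v ↔ Q v) :=
  (inferInstance : Ar S fun v => (P v → Q v) ∧ (Q v → P v)).congr fun _ => by tauto

instance Ar.instEx {P : (Fin n → N) → N → Prop}
    [hP : Ar S fun w : Fin (n + 1) → N => P (fun i => w i.succ) (w 0)] :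
    Ar S fun v => ∃ x, P v x :=
  (inferInstance : Ar S fun v => ¬ ∀ x, ¬ P v x).congr fun _ => by simp

/-- Composition of an arithmetical predicate with a function in its first variable. -/
theorem Ar.comp {P : (Fin (n + 1) → N) → Prop} (hP : Ar S P) {f : (Fin n → N) → N}
    (hf : ArF S f) : Ar S fun v => P (Fin.cons (f v) v) := by
  have h1 := hf.out
  refine Ar.congr (P := fun v => ∃ x, x = f v ∧ P (Fin.cons x v)) ?_ fun v => by simp
  have : Ar S fun w : Fin (n + 1) → N => P (Fin.cons (w 0) fun i => w i.succ) :=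
    hP.congr fun w => iff_of_eq (congrArg P (Fin.cons_self_tail w))
  infer_instance

theorem Ar.comp1 {P : N → Prop} (hP : Ar S fun v : Fin 1 → N => P (v 0)) {f : (Fin n → N) → N}
    (hf : ArF S f) : Ar S fun v => P (f v) :=
  Ar.comp (P := fun w : Fin (n + 1) → N => P (w 0)) (hP.ren fun _ => 0) hf

theorem ArF.ren {m : ℕ} {f : (Fin n → N) → N} (hf : ArF S f) (ρ : Fin n → Fin m) :
    ArF S fun w => f fun i => w (ρ i) :=
  ⟨(hf.out.ren (Fin.cases 0 fun i => (ρ i).succ)).congr fun w => by simp⟩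

theorem Ar.comp2 {P : N → N → Prop} (hP : Ar S fun v : Fin 2 → N => P (v 0) (v 1))
    {f g : (Fin n → N) → N} (hf : ArF S f) (hg : ArF S g) : Ar S fun v => P (f v) (g v) :=
  Ar.comp (P := fun w : Fin (n + 1) → N => P (w 0) (g fun i => w i.succ))
    (Ar.comp (P := fun w : Fin (n + 2) → N => P (w 1) (w 0)) (hP.ren ![1, 0])
      (hg.ren Fin.succ)) hf

theorem Ar.comp3 {P : N → N → N → Prop} (hP : Ar S fun v : Fin 3 → N => P (v 0) (v 1) (v 2))
    {f g h : (Fin n → N) → N} (hf : ArF S f) (hg : ArF S g) (hh : ArF S h) :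
    Ar S fun v => P (f v) (g v) (h v) :=
  Ar.comp (P := fun w : Fin (n + 1) → N => P (w 0) (g fun i => w i.succ) (h fun i => w i.succ))
    (Ar.comp (P := fun w : Fin (n + 2) → N => P (w 1) (w 0) (h fun i => w i.succ.succ))
      (Ar.comp (P := fun w : Fin (n + 3) → N => P (w 2) (w 1) (w 0)) (hP.ren ![2, 1, 0])
      (hh.ren fun i => i.succ.succ)) (hg.ren Fin.succ)) hf

theorem ArF.comp1 {F : N → N} (hF : Ar S fun v : Fin 2 → N => v 0 = F (v 1))
    {f : (Fin n → N) → N} (hf : ArF S f) : ArF S fun v => F (f v) :=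
  ⟨Ar.comp2 (P := fun a b => a = F b) hF (f := fun w : Fin (n + 1) → N => w 0)
    ⟨⟨0, .eq (.var 0) (.var 1), ![], trivial, fun i => i.elim0, fun _ => Iff.rfl⟩⟩
    (hf.ren Fin.succ)⟩

theorem ArF.comp2 {F : N → N → N} (hF : Ar S fun v : Fin 3 → N => v 0 = F (v 1) (v 2))
    {f g : (Fin n → N) → N} (hf : ArF S f) (hg : ArF S g) : ArF S fun v => F (f v) (g v) :=
  ⟨Ar.comp3 (P := fun a b c => a = F b c) hF (f := fun w : Fin (n + 1) → N => w 0)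
    ⟨⟨0, .eq (.var 0) (.var 1), ![], trivial, fun i => i.elim0, fun _ => Iff.rfl⟩⟩
    (hf.ren Fin.succ) (hg.ren Fin.succ)⟩

instance ArF.instVar (i : Fin n) : ArF S fun v : Fin n → N => v i :=
  ⟨⟨0, .eq (.var 0) (.var i.succ), ![], trivial, fun i => i.elim0, fun _ => Iff.rfl⟩⟩

instance ArF.instZero : ArF S fun _ : Fin n → N => 0 :=
  ⟨⟨0, .eq (.var 0) .zero, ![], trivial, fun i => i.elim0, fun _ => Iff.rfl⟩⟩

instance ArF.instOne : ArF S fun _ : Fin n → N => 1 :=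
  ⟨⟨0, .eq (.var 0) .one, ![], trivial, fun i => i.elim0, fun _ => Iff.rfl⟩⟩

instance ArF.instAdd {f g : (Fin n → N) → N} [hf : ArF S f] [hg : ArF S g] :
    ArF S fun v => f v + g v :=
  .comp2 ⟨0, .eq (.var 0) (.add (.var 1) (.var 2)), ![], trivial, fun i => i.elim0,
    fun _ => Iff.rfl⟩ hf hg

instance ArF.instMul {f g : (Fin n → N) → N} [hf : ArF S f] [hg : ArF S g] :
    ArF S fun v => f v * g v :=
  .comp2 ⟨0, .eq (.var 0) (.mul (.var 1) (.var 2)), ![], trivial, fun i => i.elim0,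
    fun _ => Iff.rfl⟩ hf hg

instance ArF.instPair {f g : (Fin n → N) → N} [hf : ArF S f] [hg : ArF S g] :
    ArF S fun v => pair (f v) (g v) := by unfold pair; infer_instance

instance ArF.instTerm {f : (Fin n → N) → N} [hf : ArF S f] :
    ArF S fun v => term (f v) := by unfold term; infer_instance

instance ArF.instParam {f : (Fin n → N) → N} [hf : ArF S f] :
    ArF S fun v => param (f v) := by unfold param; infer_instance

instance Ar.instEq {f g : (Fin n → N) → N} [hf : ArF S f] [hg : ArF S g] :
    Ar S fun v => f v = g v :=
  .comp2 (P := fun a b => a = b)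
    ⟨0, .eq (.var 0) (.var 1), ![], trivial, fun i => i.elim0, fun _ => Iff.rfl⟩ hf hg

instance Ar.instNe {f g : (Fin n → N) → N} [hf : ArF S f] [hg : ArF S g] :
    Ar S fun v => f v ≠ g v := inferInstanceAs (Ar S fun v => ¬ f v = g v)

instance Ar.instLt {f g : (Fin n → N) → N} [hf : ArF S f] [hg : ArF S g] :
    Ar S fun v => f v < g v :=
  .comp2 (P := fun a b => a < b)
    ⟨0, .lt (.var 0) (.var 1), ![], trivial, fun i => i.elim0, fun _ => Iff.rfl⟩ hf hg

instance Ar.instMem {f : (Fin n → N) → N} {A : Set N} [hf : ArF S f] [hA : MemS S A] :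
    Ar S fun v => f v ∈ A :=
  .comp1 (P := fun a => a ∈ A)
    ⟨1, .mem (.var 0) 0, ![A], trivial, fun i => by simpa using hA.out, fun _ => Iff.rfl⟩ hf

/-- Arithmetical comprehension, in the form in which sets of the structure are produced from here
on. -/
theorem ModelsACA0.setOf_mem (h : ModelsACA0 S) (P : N → Prop)
    [hP : Ar S fun v : Fin 1 → N => P (v 0)] : {a | P a} ∈ S := by
  obtain ⟨k, θ, V, h1, h2, h3⟩ := hP.out
  convert h.comprehension θ h1 ![] V h2 using 3
  rw [h3]; rfl

/-- An element of `N` need not be the value of a closed term. Through its singleton a number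
parameter turns into a set parameter, so `Ar` can do with set parameters alone. -/
theorem ModelsACA0.memS_singleton (h : ModelsACA0 S) (c : N) : MemS S ({c} : Set N) := by
  refine ⟨?_⟩
  convert h.comprehension (n := 1) (k := 0) (.eq (.var 0) (.var 1)) trivial ![c] ![]
    (fun i => i.elim0) using 1
  ext; simp [Fm.Sat, Tm.val]

/-- The structure `(N, S)` is a model of ACA₀. -/
class Model (S : Set (Set N)) : Prop where
  out : ModelsACA0 S

instance ArF.instConst [h : Model S] (c : N) : ArF S fun _ : Fin n → N => c := by
  have := h.out.memS_singleton c
  exact ⟨(inferInstance : Ar S fun v : Fin (n + 1) → N => v 0 ∈ ({c} : Set N)).congr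
    fun v => by simp⟩

/-- Since `N` may be nonstandard, induction is legitimate only for predicates whose extension lies
in `S`. Side variables count as constants by `ArF.instConst`. -/
theorem induct [h : Model S] {P : N → Prop} (ar : Ar S fun v : Fin 1 → N => P (v 0))
    (h0 : P 0) (hs : ∀ x, P x → P (x + 1)) : ∀ x, P x :=
  h.out.induction {x | P x} (h.out.setOf_mem P) h0 hs

end

/-! ### First-order arithmetic -/

/-- First-order consequences of `ACA₀`: the structure is a discretely ordered semiring in which
smaller numbers can be subtracted from larger ones. -/
class PA (N : Type u) [ArithStr N] : Prop where
  add_zero : ∀ a : N, a + 0 = a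
  add_comm : ∀ a b : N, a + b = b + a
  add_assoc : ∀ a b c : N, a + b + c = a + (b + c)
  mul_zero : ∀ a : N, a * 0 = 0
  mul_one : ∀ a : N, a * 1 = a
  mul_comm : ∀ a b : N, a * b = b * a
  mul_assoc : ∀ a b c : N, a * b * c = a * (b * c)
  mul_add : ∀ a b c : N, a * (b + c) = a * b + a * c
  add_cancel : ∀ a b c : N, a + c = b + c → a = b
  succ_ne_zero : ∀ a : N, a + 1 ≠ 0
  eq_zero_or : ∀ a : N, a = 0 ∨ ∃ b, a = b + 1
  lt_iff : ∀ a b : N, a < b ↔ ∃ c, b = a + c + 1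
  total : ∀ a b : N, a < b ∨ a = b ∨ b < a

section
variable {N : Type u} [ArithStr N]

/-- The usual inductions from Peano's axioms. The conclusion no longer mentions `S`, so the ordered
semiring built on it depends on the first-order part only. -/
theorem Model.pa (S : Set (Set N)) [hM : Model S] : PA N := by
  have h := hM.out
  have add_assoc : ∀ a b c : N, a + b + c = a + (b + c) := fun a b c => by
    induction c using induct (S := S) with
    | ar => infer_instance
    | h0 => rw [h.add_zero, h.add_zero]
    | hs c ih => rw [h.add_succ, h.add_succ, h.add_succ, ih]
  have zero_add : ∀ a : N, 0 + a = a := fun a => by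
    induction a using induct (S := S) with
    | ar => infer_instance
    | h0 => rw [h.add_zero]
    | hs c ih => rw [h.add_succ, ih]
  have one_add : ∀ a : N, 1 + a = a + 1 := fun a => by
    induction a using induct (S := S) with
    | ar => infer_instance
    | h0 => rw [h.add_zero, zero_add]
    | hs c ih => rw [h.add_succ, ih]
  have add_comm : ∀ a b : N, a + b = b + a := fun a b => by
    induction b using induct (S := S) with
    | ar => infer_instance
    | h0 => rw [h.add_zero, zero_add]
    | hs c ih => rw [h.add_succ, ih, add_assoc c 1 a, one_add, add_assoc]
  have add_cancel : ∀ a b c : N, a + c = b + c → a = b := fun a b c => by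
    induction c using induct (S := S) with
    | ar => infer_instance
    | h0 => simp [h.add_zero]
    | hs c ih => intro e; rw [h.add_succ, h.add_succ] at e; exact ih (h.succ_inj _ _ e)
  have zero_mul : ∀ a : N, 0 * a = 0 := fun a => by
    induction a using induct (S := S) with
    | ar => infer_instance
    | h0 => rw [h.mul_zero]
    | hs c ih => rw [h.mul_succ, ih, h.add_zero]
  have mul_one : ∀ a : N, a * 1 = a := fun a => by
    rw [← zero_add 1, h.mul_succ, h.mul_zero, zero_add]
  have succ_mul : ∀ a b : N, (a + 1) * b = a * b + b := fun a b => by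
    induction b using induct (S := S) with
    | ar => infer_instance
    | h0 => rw [h.mul_zero, h.mul_zero, h.add_zero]
    | hs c ih =>
      rw [h.mul_succ, h.mul_succ, ih, ← add_assoc, ← add_assoc, add_assoc _ c, add_comm c a,
        add_assoc (a * c) a c]
  have mul_comm : ∀ a b : N, a * b = b * a := fun a b => by
    induction b using induct (S := S) with
    | ar => infer_instance
    | h0 => rw [h.mul_zero, zero_mul]
    | hs c ih => rw [h.mul_succ, succ_mul, ih]
  have mul_add : ∀ a b c : N, a * (b + c) = a * b + a * c := fun a b c => by
    induction c using induct (S := S) with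
    | ar => infer_instance
    | h0 => rw [h.mul_zero, h.add_zero, h.add_zero]
    | hs c ih => rw [h.add_succ, h.mul_succ, h.mul_succ, ih, add_assoc]
  have mul_assoc : ∀ a b c : N, a * b * c = a * (b * c) := fun a b c => by
    induction c using induct (S := S) with
    | ar => infer_instance
    | h0 => rw [h.mul_zero, h.mul_zero, h.mul_zero]
    | hs c ih => rw [h.mul_succ, h.mul_succ, mul_add, ih]
  have lt_iff : ∀ a b : N, a < b ↔ ∃ c, b = a + c + 1 := fun a b => by
    induction b using induct (S := S) with
    | ar => infer_instance
    | h0 => simpa [h.not_lt_zero] using fun c e => h.succ_ne_zero _ e.symm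
    | hs b ih =>
      rw [h.lt_succ, ih]
      constructor
      · rintro (⟨c, rfl⟩ | rfl)
        · exact ⟨c + 1, by rw [← add_assoc]⟩
        · exact ⟨0, by rw [h.add_zero]⟩
      · rintro ⟨c, e⟩
        have e := h.succ_inj _ _ e
        have : c = 0 ∨ ∃ d, c = d + 1 := by
          clear e
          induction c using induct (S := S) with
          | ar => infer_instance
          | h0 => exact .inl rfl
          | hs c ih => exact .inr ⟨c, rfl⟩
        rcases this with rfl | ⟨d, rfl⟩
        · right; rw [e, h.add_zero]
        · left; exact ⟨d, by rw [e, add_assoc]⟩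
  exact {
    add_zero := h.add_zero, add_comm, add_assoc, mul_zero := h.mul_zero, mul_one, mul_comm
    mul_assoc, mul_add, add_cancel, succ_ne_zero := h.succ_ne_zero, lt_iff
    eq_zero_or := fun a => by
      induction a using induct (S := S) with
      | ar => infer_instance
      | h0 => exact .inl rfl
      | hs c ih => exact .inr ⟨c, rfl⟩
    total := fun a b => by
      induction a using induct (S := S) with
      | ar => infer_instance
      | h0 =>
        induction b using induct (S := S) with
        | ar => infer_instance
        | h0 => exact .inr (.inl rfl)
        | hs b ih => left; rw [lt_iff]; exact ⟨b, by rw [zero_add]⟩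
      | hs a ih =>
        rcases ih with ih | rfl | ih
        · obtain ⟨c, rfl⟩ := (lt_iff _ _).1 ih
          have : c = 0 ∨ ∃ d, c = d + 1 := by
            induction c using induct (S := S) with
            | ar => infer_instance
            | h0 => exact .inl rfl
            | hs c ih => exact .inr ⟨c, rfl⟩
          rcases this with rfl | ⟨d, rfl⟩
          · right; left; rw [h.add_zero]
          · left; rw [lt_iff]; exact ⟨d, by rw [add_assoc a 1, one_add, ← add_assoc]⟩
        · right; right; rw [h.lt_succ]; exact .inr rfl
        · right; right; rw [h.lt_succ]; exact .inl ih }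

instance [PA N] : CommSemiring N where
  add_assoc := PA.add_assoc
  zero_add a := by rw [PA.add_comm, PA.add_zero]
  add_zero := PA.add_zero
  add_comm := PA.add_comm
  left_distrib := PA.mul_add
  right_distrib a b c := by rw [PA.mul_comm, PA.mul_add, PA.mul_comm c, PA.mul_comm c]
  zero_mul a := by rw [PA.mul_comm, PA.mul_zero]
  mul_zero := PA.mul_zero
  mul_assoc := PA.mul_assoc
  one_mul a := by rw [PA.mul_comm, PA.mul_one]
  mul_one := PA.mul_one
  mul_comm := PA.mul_comm
  nsmul := nsmulRec
  npow := fun n a => npowRec n a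

variable [PA N]

theorem lt_iff_ex {a b : N} : a < b ↔ ∃ c, b = a + c + 1 := PA.lt_iff a b

theorem PA.irrefl (a : N) : ¬ a < a := by
  rw [lt_iff_ex]
  rintro ⟨c, e⟩
  refine PA.succ_ne_zero c (PA.add_cancel _ _ a ?_).symm
  rw [zero_add]; nth_rw 1 [e]; ring

theorem PA.trans {a b c : N} : a < b → b < c → a < c := by
  simp only [lt_iff_ex]
  rintro ⟨d, rfl⟩ ⟨e, rfl⟩
  exact ⟨d + 1 + e, by ring⟩

open Classical in
noncomputable instance : LinearOrder N where
  le a b := a < b ∨ a = b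
  le_refl a := .inr rfl
  le_trans a b c := by
    rintro (h | rfl) (h' | rfl)
    exacts [.inl (PA.trans h h'), .inl h, .inl h', .inr rfl]
  lt_iff_le_not_ge a b := by
    constructor
    · intro h
      refine ⟨.inl h, ?_⟩
      rintro (h' | rfl)
      exacts [PA.irrefl _ (PA.trans h h'), PA.irrefl _ h]
    · rintro ⟨h | rfl, h'⟩
      exacts [h, (h' (.inr rfl)).elim]
  le_antisymm a b := by
    rintro (h | rfl) (h' | h')
    exacts [(PA.irrefl _ (PA.trans h h')).elim, h'.symm, rfl, rfl]
  le_total a b := by rcases PA.total a b with h | rfl | h <;> tauto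
  toDecidableLE := fun _ _ => propDecidable _

theorem lt_add_one_iff' {a b : N} : a < b + 1 ↔ a ≤ b := by
  constructor
  · intro h
    obtain ⟨c, e⟩ := lt_iff_ex.1 h
    rcases PA.eq_zero_or c with rfl | ⟨d, rfl⟩
    · exact .inr (by simpa using (PA.add_cancel _ _ 1 e).symm)
    · exact .inl (lt_iff_ex.2 ⟨d, by rw [PA.add_cancel _ _ 1 e, add_assoc]⟩)
  · rintro (h | rfl)
    · exact PA.trans h (lt_iff_ex.2 ⟨0, by ring⟩)
    · exact lt_iff_ex.2 ⟨0, by ring⟩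

theorem le_iff_ex {a b : N} : a ≤ b ↔ ∃ c, b = a + c := by
  rw [← lt_add_one_iff', lt_iff_ex]
  exact exists_congr fun c => ⟨fun h => PA.add_cancel _ _ 1 h, fun h => by rw [h]⟩

instance : IsStrictOrderedRing N := by
  have hadd : ∀ a b : N, a ≤ b → ∀ c, a + c ≤ b + c := by
    intro a b h c
    obtain ⟨d, rfl⟩ := le_iff_ex.1 h
    exact le_iff_ex.2 ⟨d, by ring⟩
  have hmul : ∀ a b c : N, a < b → 0 < c → a * c < b * c := by
    intro a b c h h'
    obtain ⟨d, rfl⟩ := lt_iff_ex.1 h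
    obtain ⟨e, rfl⟩ := lt_iff_ex.1 h'
    exact lt_iff_ex.2 ⟨d + d * e + e, by ring⟩
  refine { add_le_add_left := hadd, le_of_add_le_add_left := ?_, zero_le_one := ?_, exists_pair_ne := ?_, mul_lt_mul_of_pos_left := ?_, mul_lt_mul_of_pos_right := ?_ }
  · intro a b c h
    obtain ⟨d, e⟩ := le_iff_ex.1 h
    exact le_iff_ex.2 ⟨d, PA.add_cancel _ _ a (by rw [add_comm, e]; ring)⟩
  · exact le_iff_ex.2 ⟨1, by ring⟩
  · exact ⟨0, 1, fun e => PA.succ_ne_zero (0 : N) (by rw [zero_add, e])⟩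
  · intro c hc a b h
    simpa only [mul_comm c] using hmul a b c h hc
  · intro c hc a b h
    exact hmul a b c h hc

instance : CanonicallyOrderedAdd N where
  exists_add_of_le h := le_iff_ex.1 h
  le_self_add a b := le_iff_ex.2 ⟨b, rfl⟩
  le_add_self a b := le_iff_ex.2 ⟨b, by ring⟩

theorem add_one_le_iff' {a b : N} : a + 1 ≤ b ↔ a < b := by
  rw [← lt_add_one_iff', add_lt_add_iff_right]

end

section
variable {N : Type u} [ArithStr N] [PA N] {S : Set (Set N)} [hM : Model S]

instance Ar.instLe {n : ℕ} {f g : (Fin n → N) → N} [hf : ArF S f] [hg : ArF S g] :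
    Ar S fun v => f v ≤ g v := inferInstanceAs (Ar S fun v => f v < g v ∨ f v = g v)

theorem strong_induct {P : N → Prop} (ar : Ar S fun v : Fin 1 → N => P (v 0))
    (h : ∀ x, (∀ y < x, P y) → P x) (x : N) : P x := by
  have _ {n : ℕ} (f : (Fin n → N) → N) [hf : ArF S f] : Ar S fun v => P (f v) := ar.comp1 hf
  refine h x ?_
  induction x using induct (S := S) with
  | ar => infer_instance
  | h0 => exact fun y hy => (not_lt_zero hy).elim
  | hs x ih =>
    intro y hy
    rcases (lt_add_one_iff'.1 hy).lt_or_eq with hy | rfl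
    exacts [ih y hy, h y ih]

theorem exists_least {P : N → Prop} (ar : Ar S fun v : Fin 1 → N => P (v 0))
    (h : ∃ x, P x) : ∃ x, P x ∧ ∀ y < x, ¬ P y := by
  have _ {n : ℕ} (f : (Fin n → N) → N) [hf : ArF S f] : Ar S fun v => P (f v) := ar.comp1 hf
  by_contra hc
  push Not at hc
  obtain ⟨x, hx⟩ := h
  refine strong_induct (S := S) (P := fun x => ¬ P x) inferInstance (fun x ih hx => ?_) x hx
  obtain ⟨y, hy, h'⟩ := hc x hx
  exact ih y hy h'

/-! ### Pairing and division -/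

/-- Since `(a + b)² ≤ pair a b < (a + b + 1)²`, the code determines `a + b`, then `a`, then `b`. -/
theorem pair_inj {a b c d : N} : pair a b = pair c d ↔ a = c ∧ b = d := by
  have key : ∀ a b c d : N, a + b < c + d → pair a b < pair c d := by
    intro a b c d h
    obtain ⟨e, he⟩ := lt_iff_ex.1 h
    rw [pair, pair, he, lt_iff_ex]
    exact ⟨b + (a + b) + 2 * (a + b) * e + e * e + 2 * e + c, by ring⟩
  constructor
  · intro h
    rcases lt_trichotomy (a + b) (c + d) with h' | h' | h'
    · exact ((key _ _ _ _ h').ne h).elim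
    · have : a = c := by rw [pair, pair, h'] at h; exact add_left_cancel h
      exact ⟨this, by rw [this] at h'; exact add_left_cancel h'⟩
    · exact ((key _ _ _ _ h').ne h.symm).elim
  · rintro ⟨rfl, rfl⟩; rfl

theorem le_sq (a : N) : a ≤ a * a := by
  rcases PA.eq_zero_or a with rfl | ⟨b, rfl⟩
  · simp
  · exact le_iff_ex.2 ⟨b * b + b, by ring⟩

theorem left_le_pair (a b : N) : a ≤ pair a b := le_iff_ex.2 ⟨(a + b) * (a + b), by rw [pair]; ring⟩

theorem right_le_pair (a b : N) : b ≤ pair a b :=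
  (le_iff_ex.2 ⟨a, by ring⟩ : b ≤ a + b).trans
    ((le_sq _).trans (le_iff_ex.2 ⟨a, by rw [pair]⟩))

theorem IsRem.eq {a m r r' : N} (h : IsRem a m r) (h' : IsRem a m r') : r = r' := by
  have key : ∀ {q q' r r' : N}, r < m → q * m + r = q' * m + r' → ¬ q < q' := by
    intro q q' r r' hr e hq
    obtain ⟨d, rfl⟩ := lt_iff_ex.1 hq
    have : r = m + (d * m + r') := add_left_cancel (a := q * m) (by rw [e]; ring)
    exact absurd hr (not_lt.2 (this ▸ le_self_add))
  obtain ⟨h1, q, rfl⟩ := h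
  obtain ⟨h1', q', e⟩ := h'
  have := le_antisymm (not_lt.1 (key h1' e.symm)) (not_lt.1 (key h1 e))
  rw [this] at e
  exact add_left_cancel e

theorem exists_isRem (S : Set (Set N)) [Model S] (a m : N) (hm : 0 < m) : ∃ r, IsRem a m r := by
  unfold IsRem
  induction a using induct (S := S) with
  | ar => infer_instance
  | h0 => exact ⟨0, hm, 0, by ring⟩
  | hs a ih =>
    obtain ⟨r, hr, q, e⟩ := ih
    rcases (add_one_le_iff'.2 hr).lt_or_eq with h | h
    · exact ⟨r + 1, h, q, by rw [e]; ring⟩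
    · exact ⟨0, hm, q + 1, by rw [e, ← h]; ring⟩

theorem IsRem.le {a m r : N} (h : IsRem a m r) : r ≤ a := by
  obtain ⟨-, q, rfl⟩ := h
  exact le_add_self

/-! ### Gödel's beta function -/

/-- Replaces the factorial in Gödel's choice of pairwise coprime moduli. -/
theorem exists_common_multiple (S : Set (Set N)) [Model S] (L : N) : ∃ M : N, 0 < M ∧ ∀ d, 0 < d → d ≤ L → ∃ e, M = d * e := by
  induction L using induct (S := S) with
  | ar => infer_instance
  | h0 => exact ⟨1, zero_lt_one, fun d h h' => (not_lt.2 h' h).elim⟩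
  | hs L ih =>
    obtain ⟨M, hM, h⟩ := ih
    refine ⟨M * (L + 1), mul_pos hM (by positivity), fun d h1 h2 => ?_⟩
    rcases h2.lt_or_eq with h2 | rfl
    · obtain ⟨e, rfl⟩ := h d h1 (lt_add_one_iff'.1 h2)
      exact ⟨e * (L + 1), by ring⟩
    · exact ⟨M, by ring⟩

/-- `P` is invertible modulo `m`. -/
def InvMod (P m : N) : Prop := ∃ u w w', P * u + m * w' = m * w + 1

omit hM in
theorem InvMod.mul {P Q m : N} (h : InvMod P m) (h' : InvMod Q m) : InvMod (P * Q) m := by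
  obtain ⟨u, w, w', e⟩ := h
  obtain ⟨x, y, y', e'⟩ := h'
  refine ⟨u * x, m * w * y + w + y, P * u * y' + Q * x * w' + m * w' * y', ?_⟩
  calc _ = (P * u + m * w') * (Q * x + m * y') := by ring
    _ = _ := by rw [e, e']; ring

omit hM in
-- Let `b = d * e`, `j = i + d` and `k = (j + 1) * b`, so that `k ≡ -1` modulo `k + 1`. Then `(j +
-- 1) * ((i + 1) * b + 1) ≡ d`. Multiplication by `e * (j + 1)` gives `k ≡ -1`, and a further factor
-- `k` gives `1`. The numbers `c` and `w'` only serve to avoid subtraction.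
theorem invMod_modulus (i d e : N) (h : 0 < d * e) :
    InvMod ((i + 1) * (d * e) + 1) ((i + d + 1) * (d * e) + 1) := by
  have : 0 < (i + d + 1) * (d * e) := mul_pos (by positivity) h
  obtain ⟨c, hc⟩ := lt_iff_ex.1 this
  rw [zero_add] at hc
  set k := (i + d + 1) * (d * e) with hk
  refine ⟨e * (i + d + 1) * (i + d + 1) * k, e * (i + d + 1) * (i + d + 1) * k, c * c + c + 1, ?_⟩
  have e1 : ((i + 1) * (d * e) + 1) * (e * (i + d + 1) * (i + d + 1) * k) + k * k * k =
      (k + 1) * (e * (i + d + 1) * (i + d + 1) * k) := by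
    rw [hk]; ring
  have e2 : (k + 1) * (c * c + c + 1) = k * k * k + 1 := by rw [hc]; ring
  rw [e2, ← add_assoc, e1]

omit hM in
theorem exists_add_mul_eq {P c t a : N} (h : InvMod P (c + 1)) :
    ∃ v k k', a + P * v + (c + 1) * k = t + (c + 1) * k' := by
  obtain ⟨u, w, w', e⟩ := h
  -- Modulo `c + 1` the number `t + a * c` stands for `t - a`.
  refine ⟨u * (t + a * c), w' * (t + a * c), a + w * (t + a * c), ?_⟩
  calc _ = a + (P * u + (c + 1) * w') * (t + a * c) := by ring
    _ = _ := by rw [e]; ring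

theorem isRem_of_add_mul_eq (S : Set (Set N)) [Model S] {a m k r k' : N} (hr : r < m) (e : a + m * k = r + m * k') :
    IsRem a m r := by
  obtain ⟨r', h, q, rfl⟩ := exists_isRem S a m (zero_le.trans_lt hr)
  have : r' = r := by
    refine IsRem.eq (a := r + m * k') (m := m) ⟨h, q + k, ?_⟩ ⟨hr, k', by ring⟩
    rw [← e]; ring
  rw [← this]
  exact ⟨h, q, rfl⟩

theorem exists_bound {F : N → N} (hF : Ar S fun v : Fin 2 → N => v 0 = F (v 1)) (n : N) :
    ∃ B, ∀ i < n, F i < B := by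
  have _ {n : ℕ} (f : (Fin n → N) → N) [hf : ArF S f] : ArF S fun v => F (f v) := .comp1 hF hf
  induction n using induct (S := S) with
  | ar => infer_instance
  | h0 => exact ⟨0, fun i hi => (not_lt_zero hi).elim⟩
  | hs n ih =>
    obtain ⟨B, hB⟩ := ih
    refine ⟨B + F n + 1, fun i hi => ?_⟩
    rcases (lt_add_one_iff'.1 hi).lt_or_eq with hi | rfl
    · exact (hB i hi).trans_le (by rw [add_assoc]; exact le_self_add)
    · rw [add_comm B]; exact lt_add_one_iff'.2 le_self_add

theorem exists_beta {F : N → N} (hF : Ar S fun v : Fin 2 → N => v 0 = F (v 1)) (n : N) :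
    ∃ a b, ∀ i < n, IsRem a ((i + 1) * b + 1) (F i) := by
  have _ {n : ℕ} (f : (Fin n → N) → N) [hf : ArF S f] : ArF S fun v => F (f v) := .comp1 hF hf
  obtain ⟨B, hB⟩ := exists_bound hF n
  obtain ⟨M, hM0, hM⟩ := exists_common_multiple S n
  -- The factor `M` makes the moduli coprime; the factor `B + 1` makes them larger than all the
  -- values of `F`.
  set b := M * (B + 1) with hb
  have hb0 : 0 < b := mul_pos hM0 (by positivity)
  have hFb : ∀ i < n, F i < (i + 1) * b + 1 := by
    intro i hi
    have h1 : B + 1 ≤ b := le_mul_of_one_le_left zero_le (by simpa using add_one_le_iff'.2 hM0)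
    have h2 : b ≤ (i + 1) * b := le_mul_of_one_le_left zero_le le_add_self
    exact ((hB i hi).trans (lt_add_one_iff'.2 le_rfl)).trans_le
      ((h1.trans h2).trans le_self_add)
  have hinv : ∀ i j, i < j → j ≤ n → InvMod ((i + 1) * b + 1) ((j + 1) * b + 1) := by
    intro i j hij hj
    obtain ⟨d, rfl⟩ := lt_iff_ex.1 hij
    obtain ⟨e, he⟩ := hM (d + 1) (by positivity) ((le_iff_ex.2 ⟨i, by ring⟩).trans hj)
    have e1 : (d + 1) * (e * (B + 1)) = b := by rw [hb, he, mul_assoc]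
    have := invMod_modulus i (d + 1) (e * (B + 1)) (e1 ▸ hb0)
    rwa [e1, ← add_assoc] at this
  -- Chinese remainders, one congruence at a time. `P` is a common multiple of the first `m` moduli,
  -- so adding a multiple of `P` preserves the earlier remainders; it is invertible modulo the later
  -- ones, so a suitable multiple adjusts the next remainder.
  have key : ∀ m, m ≤ n → ∃ a P, (∀ i < m, IsRem a ((i + 1) * b + 1) (F i)) ∧
      (∀ i < m, ∃ c, P = ((i + 1) * b + 1) * c) ∧
      ∀ j, m ≤ j → j ≤ n → InvMod P ((j + 1) * b + 1) := by
    unfold IsRem InvMod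
    intro m
    induction m using induct (S := S) with
    | ar => infer_instance
    | h0 => exact fun _ => ⟨0, 1, fun i hi => (not_lt_zero hi).elim, fun i hi =>
        (not_lt_zero hi).elim, fun j _ _ => ⟨1, 0, 0, by ring⟩⟩
    | hs m ih =>
      intro hm
      have hmn := add_one_le_iff'.1 hm
      obtain ⟨a, P, h1, h2, h3⟩ := ih hmn.le
      obtain ⟨v, k, k', e⟩ := exists_add_mul_eq (t := F m) (a := a) (h3 m le_rfl hmn.le)
      refine ⟨a + P * v, P * ((m + 1) * b + 1), fun i hi => ?_, fun i hi => ?_, fun j hj hjn => ?_⟩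
      · rcases (lt_add_one_iff'.1 hi).lt_or_eq with hi | rfl
        · obtain ⟨hr, q, eq⟩ := h1 i hi
          obtain ⟨c, hc⟩ := h2 i hi
          exact ⟨hr, q + c * v, by nth_rw 1 [eq, hc]; ring⟩
        · exact isRem_of_add_mul_eq S (hFb i hmn) e
      · rcases (lt_add_one_iff'.1 hi).lt_or_eq with hi | rfl
        · obtain ⟨c, hc⟩ := h2 i hi
          exact ⟨c * ((m + 1) * b + 1), by nth_rw 1 [hc]; ring⟩
        · exact ⟨P, by ring⟩
      · have hmj := add_one_le_iff'.1 hj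
        exact (InvMod.mul (h3 j hmj.le hjn) (hinv m j hmj hjn))
  obtain ⟨a, P, h, -⟩ := key n le_rfl
  exact ⟨a, b, h⟩

/-! ### Finite sequences -/

omit hM in
theorem IsLen.eq {s l l' : N} (h : IsLen s l) (h' : IsLen s l') : l = l' := by
  obtain ⟨a, b, rfl⟩ := h
  obtain ⟨a', b', e⟩ := h'
  exact (pair_inj.1 e).2

omit hM in
theorem IsLen.le {s l : N} (h : IsLen s l) : l ≤ s := by
  obtain ⟨a, b, rfl⟩ := h
  exact right_le_pair _ _

omit hM in
theorem Entry.eq {s i x y : N} (h : Entry s i x) (h' : Entry s i y) : x = y := by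
  obtain ⟨a, b, l, rfl, hi, h⟩ := h
  obtain ⟨a', b', l', e, hi', h'⟩ := h'
  obtain ⟨e, -⟩ := pair_inj.1 e
  obtain ⟨rfl, rfl⟩ := pair_inj.1 e
  exact h.eq h'

omit hM in
theorem Entry.lt {s l i x : N} (h : Entry s i x) (hl : IsLen s l) : i < l := by
  obtain ⟨a, b, l', rfl, hi, h⟩ := h
  rwa [hl.eq ⟨_, _, rfl⟩]

omit hM [PA N] in
theorem Entry.isLen {s i x : N} (h : Entry s i x) : ∃ l, IsLen s l := by
  obtain ⟨a, b, l', rfl, hi, h⟩ := h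
  exact ⟨_, _, _, rfl⟩

omit hM in
theorem Entry.lt_code {s i x : N} (h : Entry s i x) : i < s := by
  obtain ⟨l, hl⟩ := h.isLen
  exact (h.lt hl).trans_le hl.le

omit hM in
theorem Entry.le_code {s i x : N} (h : Entry s i x) : x ≤ s := by
  obtain ⟨a, b, l', rfl, hi, h⟩ := h
  exact h.le.trans ((left_le_pair _ _).trans (left_le_pair _ _))

theorem exists_entry (S : Set (Set N)) [Model S] {s l i : N} (hl : IsLen s l) (hi : i < l) :
    ∃ x, Entry s i x := by
  obtain ⟨a, b, rfl⟩ := hl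
  obtain ⟨r, hr⟩ := exists_isRem S a ((i + 1) * b + 1) (by positivity)
  exact ⟨r, a, b, l, rfl, hi, hr⟩

omit hM [PA N] in
theorem SameSeq.symm {s t : N} (h : SameSeq s t) : SameSeq t s :=
  ⟨fun l => (h.1 l).symm, fun i x => (h.2 i x).symm⟩

omit hM in
theorem IsSeq.eq {s t : N} (hs : IsSeq s) (ht : IsSeq t) (h : SameSeq s t) : s = t := by
  rcases lt_trichotomy s t with h' | h' | h'
  exacts [(ht.2 s h' h).elim, h', (hs.2 t h' h.symm).elim]

section
variable {n : ℕ} {f g h : (Fin n → N) → N} [hf : ArF S f] [hg : ArF S g] [hh : ArF S h]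

instance : Ar S fun v => IsRem (f v) (g v) (h v) := by
  refine .comp3 (P := IsRem) ?_ hf hg hh
  unfold IsRem; infer_instance

instance : Ar S fun v => IsLen (f v) (g v) := by
  refine .comp2 (P := IsLen) ?_ hf hg
  unfold IsLen; infer_instance

instance : Ar S fun v => Entry (f v) (g v) (h v) := by
  refine .comp3 (P := Entry) ?_ hf hg hh
  unfold Entry; infer_instance

instance : Ar S fun v => SameSeq (f v) (g v) := by
  refine .comp2 (P := SameSeq) ?_ hf hg
  unfold SameSeq; infer_instance

instance : Ar S fun v => IsSeq (f v) := by
  refine .comp1 (P := IsSeq) ?_ hf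
  unfold IsSeq; infer_instance

instance : Ar S fun v => IsPrefix (f v) (g v) := by
  refine .comp2 (P := IsPrefix) ?_ hf hg
  unfold IsPrefix; infer_instance

instance {b : Set N} [MemS S b] : Ar S fun v => IsInit b (f v) (g v) := by
  refine .comp2 (P := IsInit b) ?_ hf hg
  unfold IsInit; infer_instance

end

/-- Any initial segment of a definable function is coded by a finite sequence. -/
theorem exists_seq {F : N → N} (hF : Ar S fun v : Fin 2 → N => v 0 = F (v 1)) (n : N) :
    ∃ s, IsSeq s ∧ IsLen s n ∧ ∀ i < n, Entry s i (F i) := by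
  obtain ⟨a, b, h⟩ := exists_beta hF n
  set c := pair (pair a b) n with hc
  have hcl : IsLen c n := ⟨a, b, rfl⟩
  -- Passing to the least code of the same sequence makes it a sequence in the sense of `IsSeq`.
  obtain ⟨s, hs, hmin⟩ := exists_least (S := S) (P := fun s => SameSeq s c) inferInstance
    ⟨c, fun _ => Iff.rfl, fun _ _ => Iff.rfl⟩
  refine ⟨s, ⟨⟨n, (hs.1 n).2 hcl⟩, fun t ht h => hmin t ht ⟨fun l => (h.1 l).trans (hs.1 l),
    fun i x => (h.2 i x).trans (hs.2 i x)⟩⟩, (hs.1 n).2 hcl, fun i hi => ?_⟩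
  exact (hs.2 i _).2 ⟨a, b, n, rfl, hi, h i hi⟩

/-- A finite sequence with prescribed entries. -/
theorem exists_seq_of_rel {P : N → N → Prop} (hP : Ar S fun v : Fin 2 → N => P (v 0) (v 1)) (n : N)
    (hex : ∀ i < n, ∃ x, P i x) : ∃ s, IsSeq s ∧ IsLen s n ∧ ∀ i < n, ∃ x, Entry s i x ∧ P i x := by
  have _ {n : ℕ} (f g : (Fin n → N) → N) [hf : ArF S f] [hg : ArF S g] :
    Ar S fun v => P (f v) (g v) := hP.comp2 hf hg
  -- Taking the least witness makes the choice definable; the value `0` is used where there is no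
  -- witness.
  have h1 : ∀ i, ∃ x, (P i x ∧ ∀ y < x, ¬ P i y) ∨ (¬ (∃ x, P i x) ∧ x = 0) := by
    intro i
    by_cases h : ∃ x, P i x
    · obtain ⟨x, hx⟩ := exists_least (S := S) inferInstance h
      exact ⟨x, .inl hx⟩
    · exact ⟨0, .inr ⟨h, rfl⟩⟩
  have h2 : Ar S fun v : Fin 2 → N => (P (v 1) (v 0) ∧ ∀ y < v 0, ¬ P (v 1) y) ∨
      (¬ (∃ x, P (v 1) x) ∧ v 0 = 0) := inferInstance
  choose F hF using h1
  have hF' : Ar S fun v : Fin 2 → N => v 0 = F (v 1) := by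
    refine h2.congr fun v => ?_
    constructor
    · intro e; rw [e]; exact hF _
    · intro h
      rcases hF (v 1) with h' | h' <;> rcases h with h | h
      · exact le_antisymm (not_lt.1 fun hl => h.2 _ hl h'.1) (not_lt.1 fun hl => h'.2 _ hl h.1)
      · exact (h.1 ⟨_, h'.1⟩).elim
      · exact (h'.1 ⟨_, h.1⟩).elim
      · rw [h.2, h'.2]
  obtain ⟨s, h1, h2, h3⟩ := exists_seq hF' n
  refine ⟨s, h1, h2, fun i hi => ⟨F i, h3 i hi, ?_⟩⟩
  rcases hF i with h | h
  exacts [h.1, (h.1 (hex i hi)).elim]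

omit hM in
/-- Extensionality for finite sequences. -/
theorem IsSeq.ext (S : Set (Set N)) [Model S] {s t l : N} (hs : IsSeq s) (ht : IsSeq t)
    (hls : IsLen s l) (hlt : IsLen t l) (h : ∀ i x, Entry s i x → Entry t i x) : s = t := by
  refine hs.eq ht ⟨fun m => ⟨fun h => h.eq hls ▸ hlt, fun h => h.eq hlt ▸ hls⟩, fun i x =>
    ⟨h i x, fun h' => ?_⟩⟩
  obtain ⟨y, hy⟩ := exists_entry S hls (h'.lt hlt)
  rwa [h'.eq (h i y hy)]

omit hM [PA N] in
theorem IsSeq.isPrefix_refl {s : N} (h : IsSeq s) : IsPrefix s s := ⟨h, h, fun _ _ => id⟩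

omit hM [PA N] in
theorem IsPrefix.trans {s t u : N} (h : IsPrefix s t) (h' : IsPrefix t u) : IsPrefix s u :=
  ⟨h.1, h'.2.1, fun i x e => h'.2.2 i x (h.2.2 i x e)⟩

theorem IsPrefix.len_le (S : Set (Set N)) [Model S] {s t l m : N} (h : IsPrefix s t)
    (hl : IsLen s l) (hm : IsLen t m) : l ≤ m := by
  by_contra hc
  obtain ⟨x, hx⟩ := exists_entry S hl (not_le.1 hc)
  exact lt_irrefl _ ((h.2.2 _ _ hx).lt hm)

/-- Every sequence has initial segments of all smaller lengths. -/
theorem exists_prefix (S : Set (Set N)) [Model S] {s l m : N} (h : IsSeq s) (hl : IsLen s l)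
    (hm : m ≤ l) : ∃ t, IsPrefix t s ∧ IsLen t m := by
  obtain ⟨t, h1, h2, h3⟩ := exists_seq_of_rel (S := S) (P := fun i x => Entry s i x) inferInstance m
    fun i hi => exists_entry S hl (hi.trans_le hm)
  refine ⟨t, ⟨h1, h, fun i x e => ?_⟩, h2⟩
  obtain ⟨y, hy, hy'⟩ := h3 i (e.lt h2)
  rwa [e.eq hy]

/-- Every sequence can be extended by one entry. -/
theorem exists_snoc (S : Set (Set N)) [Model S] {s : N} (h : IsSeq s) (x : N) :
    ∃ t, IsSnoc s x t := by
  obtain ⟨l, hl⟩ := h.1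
  obtain ⟨t, h1, h2, h3⟩ := exists_seq_of_rel (S := S)
    (P := fun i y => Entry s i y ∨ (i = l ∧ y = x)) inferInstance (l + 1) fun i hi => by
      rcases (lt_add_one_iff'.1 hi).lt_or_eq with hi | rfl
      · obtain ⟨y, hy⟩ := exists_entry S hl hi
        exact ⟨y, .inl hy⟩
      · exact ⟨x, .inr ⟨rfl, rfl⟩⟩
  refine ⟨t, ⟨h, h1, fun i y e => ?_⟩, l, hl, h2, ?_⟩
  · obtain ⟨z, hz, hz' | hz'⟩ := h3 i ((e.lt hl).trans (lt_add_one_iff'.2 le_rfl))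
    · rwa [e.eq hz']
    · exact ((e.lt hl).ne hz'.1).elim
  · obtain ⟨z, hz, hz' | hz'⟩ := h3 l (lt_add_one_iff'.2 le_rfl)
    · exact ((hz'.lt hl).ne rfl).elim
    · exact hz'.2 ▸ hz

/-- A function in the structure has initial segments of every length. -/
theorem IsFun.exists_isInit {b : Set N} (h : IsFun S b) (n : N) : ∃ t, IsInit b n t := by
  have : MemS S b := ⟨h.1⟩
  obtain ⟨t, h1, h2, h3⟩ := exists_seq_of_rel (S := S) (P := fun i x => pair i x ∈ b)
    inferInstance n fun i _ => (h.2.2 i).exists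
  refine ⟨t, h1, h2, fun i x e => ?_⟩
  obtain ⟨y, hy, hy'⟩ := h3 i (e.lt h2)
  rwa [e.eq hy]

omit hM in
theorem IsFun.eq {b : Set N} (h : IsFun S b) {i x y : N} (hx : pair i x ∈ b) (hy : pair i y ∈ b) :
    x = y := (h.2.2 i).unique hx hy

/-- The entries of an initial segment of a function. -/
theorem IsInit.entry_iff {b : Set N} (h : IsFun S b) {n t i x : N} (ht : IsInit b n t) :
    Entry t i x ↔ i < n ∧ pair i x ∈ b := by
  refine ⟨fun e => ⟨e.lt ht.2.1, ht.2.2 i x e⟩, fun ⟨hi, hx⟩ => ?_⟩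
  obtain ⟨y, hy⟩ := exists_entry S ht.2.1 hi
  rwa [h.eq hx (ht.2.2 i y hy)]

/-- The graph of a definable total function belongs to the structure. -/
theorem exists_isFun {P : N → N → Prop} (hP : Ar S fun v : Fin 2 → N => P (v 0) (v 1))
    (hex : ∀ i, ∃! x, P i x) : ∃ p, IsFun S p ∧ ∀ i x, pair i x ∈ p ↔ P i x := by
  have _ {n : ℕ} (f g : (Fin n → N) → N) [hf : ArF S f] [hg : ArF S g] :
    Ar S fun v => P (f v) (g v) := hP.comp2 hf hg
  have key : ∀ i x, pair i x ∈ {p | ∃ i x, p = pair i x ∧ P i x} ↔ P i x := by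
    intro i x
    constructor
    · rintro ⟨i', x', e, h⟩
      obtain ⟨rfl, rfl⟩ := pair_inj.1 e
      exact h
    · exact fun h => ⟨i, x, rfl, h⟩
  refine ⟨{p | ∃ i x, p = pair i x ∧ P i x}, ⟨hM.out.setOf_mem _, ?_, ?_⟩, key⟩
  · rintro p ⟨i, x, e, -⟩; exact ⟨i, x, e⟩
  · simpa only [key] using hex

end

/-! ### Uniformly bounded-definable predicates -/

/-- `t` is given by a term of the language, the same one in all structures. -/
class UT {n : ℕ} (t : ∀ (N : Type u) [ArithStr N], (Fin n → N) → N) : Prop where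
  out : ∃ τ : Tm n, ∀ (N : Type u) [ArithStr N] (v : Fin n → N), τ.val v = t N v

/-- `P` is defined by a bounded formula, the same one in all models. -/
class UB {n : ℕ} (P : ∀ (N : Type u) [ArithStr N], (Fin n → N) → Prop) : Prop where
  out : ∃ θ : Fm n 0, θ.IsBounded ∧ ∀ (N : Type u) [ArithStr N] [PA N] (S : Set (Set N)) [Model S]
    (v : Fin n → N), θ.Sat S v ![] ↔ P N v

section
variable {n : ℕ}

instance UT.instVar (i : Fin n) : UT fun (N : Type u) [ArithStr N] (v : Fin n → N) => v i :=
  ⟨.var i, fun _ _ _ => rfl⟩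

instance UT.instZero : UT fun (N : Type u) [ArithStr N] (_ : Fin n → N) => 0 :=
  ⟨.zero, fun _ _ _ => rfl⟩

instance UT.instOne : UT fun (N : Type u) [ArithStr N] (_ : Fin n → N) => 1 :=
  ⟨.one, fun _ _ _ => rfl⟩

section
variable {s t : ∀ (N : Type u) [ArithStr N], (Fin n → N) → N} [hs : UT s] [ht : UT t]

instance UT.instAdd : UT fun (N : Type u) [ArithStr N] (v : Fin n → N) => s N v + t N v := by
  obtain ⟨σ, hσ⟩ := hs.out
  obtain ⟨τ, hτ⟩ := ht.out
  exact ⟨.add σ τ, fun N _ v => by rw [Tm.val, hσ, hτ]⟩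

instance UT.instMul : UT fun (N : Type u) [ArithStr N] (v : Fin n → N) => s N v * t N v := by
  obtain ⟨σ, hσ⟩ := hs.out
  obtain ⟨τ, hτ⟩ := ht.out
  exact ⟨.mul σ τ, fun N _ v => by rw [Tm.val, hσ, hτ]⟩

instance UT.instPair : UT fun (N : Type u) [ArithStr N] (v : Fin n → N) => pair (s N v) (t N v) := by
  unfold pair; infer_instance

instance UT.instTerm : UT fun (N : Type u) [ArithStr N] (v : Fin n → N) => term (s N v) := by
  unfold term; infer_instance

instance UT.instParam : UT fun (N : Type u) [ArithStr N] (v : Fin n → N) => param (s N v) := by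
  unfold param; infer_instance

instance UT.instVal {m : ℕ} (t : Tm m) (ρ : Fin m → Fin n) :
    UT fun (N : Type u) [ArithStr N] (v : Fin n → N) => t.val fun i => v (ρ i) :=
  ⟨t.sub fun i => .var (ρ i), fun N _ v => by rw [Tm.val_sub]; rfl⟩

instance UB.instEq : UB fun (N : Type u) [ArithStr N] (v : Fin n → N) => s N v = t N v := by
  obtain ⟨σ, hσ⟩ := hs.out
  obtain ⟨τ, hτ⟩ := ht.out
  exact ⟨.eq σ τ, .eq _ _, fun N _ _ S _ v => by rw [Fm.Sat, hσ, hτ]⟩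

instance UB.instLt : UB fun (N : Type u) [ArithStr N] (v : Fin n → N) => s N v < t N v := by
  obtain ⟨σ, hσ⟩ := hs.out
  obtain ⟨τ, hτ⟩ := ht.out
  exact ⟨.lt σ τ, .lt _ _, fun N _ _ S _ v => by rw [Fm.Sat, hσ, hτ]⟩

end

theorem UB.congr {P : ∀ (N : Type u) [ArithStr N], (Fin n → N) → Prop} (hP : UB P)
    {Q : ∀ (N : Type u) [ArithStr N], (Fin n → N) → Prop}
    (h : ∀ (N : Type u) [ArithStr N] [PA N] (S : Set (Set N)) [Model S] (v : Fin n → N),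
      Q N v ↔ P N v) : UB Q := by
  obtain ⟨θ, h1, h2⟩ := hP.out
  exact ⟨θ, h1, fun N _ _ S _ v => (h2 N S v).trans (h N S v).symm⟩

section
variable {P Q : ∀ (N : Type u) [ArithStr N], (Fin n → N) → Prop} [hP : UB P] [hQ : UB Q]

instance UB.instImp : UB fun (N : Type u) [ArithStr N] (v : Fin n → N) => P N v → Q N v := by
  obtain ⟨θ, h1, h2⟩ := hP.out
  obtain ⟨η, h1', h2'⟩ := hQ.out
  exact ⟨.imp θ η, .imp h1 h1', fun N _ _ S _ v => by rw [Fm.Sat, h2, h2']⟩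

instance UB.instFalse : UB fun (N : Type u) [ArithStr N] (_ : Fin n → N) => False :=
  ⟨.falsum, .falsum, fun _ _ _ _ _ _ => Iff.rfl⟩

instance UB.instNot : UB fun (N : Type u) [ArithStr N] (v : Fin n → N) => ¬ P N v :=
  inferInstanceAs (UB fun (N : Type u) [ArithStr N] (v : Fin n → N) => P N v → False)

instance UB.instTrue : UB fun (N : Type u) [ArithStr N] (_ : Fin n → N) => True :=
  (inferInstance : UB fun (N : Type u) [ArithStr N] (_ : Fin n → N) => ¬ False).congr
    fun _ _ _ _ _ _ => by simp

instance UB.instAnd : UB fun (N : Type u) [ArithStr N] (v : Fin n → N) => P N v ∧ Q N v :=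
  (inferInstance : UB fun (N : Type u) [ArithStr N] (v : Fin n → N) => ¬ (P N v → ¬ Q N v)).congr
    fun _ _ _ _ _ _ => by simp

instance UB.instOr : UB fun (N : Type u) [ArithStr N] (v : Fin n → N) => P N v ∨ Q N v :=
  (inferInstance : UB fun (N : Type u) [ArithStr N] (v : Fin n → N) => (¬ P N v → Q N v)).congr
    fun _ _ _ _ _ _ => by tauto

instance UB.instIff : UB fun (N : Type u) [ArithStr N] (v : Fin n → N) => (P N v ↔ Q N v) :=
  (inferInstance : UB fun (N : Type u) [ArithStr N] (v : Fin n → N) =>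
    (P N v → Q N v) ∧ (Q N v → P N v)).congr fun _ _ _ _ _ _ => by tauto

end

instance UB.instNe {s t : ∀ (N : Type u) [ArithStr N], (Fin n → N) → N} [UT s] [UT t] :
    UB fun (N : Type u) [ArithStr N] (v : Fin n → N) => s N v ≠ t N v :=
  inferInstanceAs (UB fun (N : Type u) [ArithStr N] (v : Fin n → N) => ¬ s N v = t N v)

section
variable {t : ∀ (N : Type u) [ArithStr N], (Fin n → N) → N} [ht : UT t]
  {P : ∀ (N : Type u) [ArithStr N], (Fin n → N) → N → Prop}
  [hP : UB fun (N : Type u) [ArithStr N] (w : Fin (n + 1) → N) => P N (fun i => w i.succ) (w 0)]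

instance UB.instBall : UB fun (N : Type u) [ArithStr N] (v : Fin n → N) =>
    ∀ x, x < t N v → P N v x := by
  obtain ⟨τ, hτ⟩ := ht.out
  obtain ⟨θ, h1, h2⟩ := hP.out
  refine ⟨.ball τ θ, .ball _ h1, fun N _ _ S _ v => ?_⟩
  simp only [Fm.ball, Fm.Sat, Tm.val_lift, h2]
  simp [Tm.val, hτ]

instance UB.instBex : UB fun (N : Type u) [ArithStr N] (v : Fin n → N) =>
    ∃ x, x < t N v ∧ P N v x :=
  (inferInstance : UB fun (N : Type u) [ArithStr N] (v : Fin n → N) =>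
    ¬ ∀ x, x < t N v → ¬ P N v x).congr fun _ _ _ _ _ _ => by simp

end

theorem UB.subst {m : ℕ} {P : ∀ (N : Type u) [ArithStr N], (Fin m → N) → Prop} (hP : UB P)
    (t : Fin m → ∀ (N : Type u) [ArithStr N], (Fin n → N) → N) (ht : ∀ i, UT (t i)) :
    UB fun (N : Type u) [ArithStr N] (v : Fin n → N) => P N fun i => t i N v := by
  choose τ hτ using fun i => (ht i).out
  obtain ⟨θ, h1, h2⟩ := hP.out
  refine ⟨θ.sub τ id, h1.sub _ _, fun N _ _ S _ v => ?_⟩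
  rw [Fm.sat_sub, ← h2 N S]
  simp only [hτ]
  rw [show (fun i => (![] : Fin 0 → Set N) (id i)) = ![] from funext fun i => i.elim0]

section
variable {r s t : ∀ (N : Type u) [ArithStr N], (Fin n → N) → N}

theorem UB.comp1 {P : ∀ (N : Type u) [ArithStr N], N → Prop}
    (hP : UB fun (N : Type u) [ArithStr N] (v : Fin 1 → N) => P N (v 0)) (hr : UT r) :
    UB fun (N : Type u) [ArithStr N] (v : Fin n → N) => P N (r N v) :=
  hP.subst (fun _ => r) fun _ => hr

theorem UB.comp2 {P : ∀ (N : Type u) [ArithStr N], N → N → Prop}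
    (hP : UB fun (N : Type u) [ArithStr N] (v : Fin 2 → N) => P N (v 0) (v 1))
    (hr : UT r) (hs : UT s) :
    UB fun (N : Type u) [ArithStr N] (v : Fin n → N) => P N (r N v) (s N v) :=
  hP.subst (Fin.cons @r fun _ => @s) (Fin.cases hr fun _ => hs)

theorem UB.comp3 {P : ∀ (N : Type u) [ArithStr N], N → N → N → Prop}
    (hP : UB fun (N : Type u) [ArithStr N] (v : Fin 3 → N) => P N (v 0) (v 1) (v 2))
    (hr : UT r) (hs : UT s) (ht : UT t) :
    UB fun (N : Type u) [ArithStr N] (v : Fin n → N) => P N (r N v) (s N v) (t N v) :=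
  hP.subst (Fin.cons @r (Fin.cons @s fun _ => @t)) (Fin.cases hr (Fin.cases hs fun _ => ht))

end

section
variable {r s t : ∀ (N : Type u) [ArithStr N], (Fin n → N) → N} [hr : UT r] [hs : UT s] [ht : UT t]

/-- The general pattern for bounding the arithmetical notions: a quotient is at most the dividend,
because the modulus is positive, and the components and entries of a code are at most the code. -/
instance UB.instIsRem :
    UB fun (N : Type u) [ArithStr N] (v : Fin n → N) => IsRem (r N v) (s N v) (t N v) := by
  refine .comp3 (P := fun N [ArithStr N] a m x => IsRem a m x) ?_ hr hs ht
  refine (inferInstance : UB fun (N : Type u) [ArithStr N] (v : Fin 3 → N) => v 2 < v 1 ∧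
    ∃ q, q < v 0 + 1 ∧ v 0 = q * v 1 + v 2).congr fun N _ _ S _ v => ?_
  refine and_congr_right fun h => exists_congr fun q => ⟨fun e => ⟨lt_add_one_iff'.2 ?_, e⟩, And.right⟩
  rw [e]
  refine le_trans ?_ le_self_add
  exact le_mul_of_one_le_right zero_le (by simpa using add_one_le_iff'.2 ((zero_le).trans_lt h))

instance UB.instIsLen :
    UB fun (N : Type u) [ArithStr N] (v : Fin n → N) => IsLen (r N v) (s N v) := by
  refine .comp2 (P := fun N [ArithStr N] a m => IsLen a m) ?_ hr hs
  refine (inferInstance : UB fun (N : Type u) [ArithStr N] (v : Fin 2 → N) =>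
    ∃ a, a < v 0 + 1 ∧ ∃ b, b < v 0 + 1 ∧ v 0 = pair (pair a b) (v 1)).congr fun N _ _ S _ v => ?_
  constructor
  · rintro ⟨a, b, e⟩
    have := left_le_pair (pair a b) (v 1)
    rw [← e] at this
    exact ⟨a, lt_add_one_iff'.2 ((left_le_pair _ _).trans this),
      b, lt_add_one_iff'.2 ((right_le_pair _ _).trans this), e⟩
  · rintro ⟨a, -, b, -, e⟩; exact ⟨a, b, e⟩

instance UB.instEntry :
    UB fun (N : Type u) [ArithStr N] (v : Fin n → N) => Entry (r N v) (s N v) (t N v) := by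
  refine .comp3 (P := fun N [ArithStr N] a m x => Entry a m x) ?_ hr hs ht
  refine (inferInstance : UB fun (N : Type u) [ArithStr N] (v : Fin 3 → N) =>
    ∃ a, a < v 0 + 1 ∧ ∃ b, b < v 0 + 1 ∧ ∃ l, l < v 0 + 1 ∧ v 0 = pair (pair a b) l ∧ v 1 < l ∧
      IsRem a ((v 1 + 1) * b + 1) (v 2)).congr fun N _ _ S _ v => ?_
  constructor
  · rintro ⟨a, b, l, e, h⟩
    have h1 := left_le_pair (pair a b) l
    have h2 := right_le_pair (pair a b) l
    rw [← e] at h1 h2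
    exact ⟨a, lt_add_one_iff'.2 ((left_le_pair _ _).trans h1),
      b, lt_add_one_iff'.2 ((right_le_pair _ _).trans h1), l, lt_add_one_iff'.2 h2, e, h⟩
  · rintro ⟨a, -, b, -, l, -, h⟩; exact ⟨a, b, l, h⟩

instance UB.instSameSeq :
    UB fun (N : Type u) [ArithStr N] (v : Fin n → N) => SameSeq (r N v) (s N v) := by
  refine .comp2 (P := fun N [ArithStr N] a m => SameSeq a m) ?_ hr hs
  refine (inferInstance : UB fun (N : Type u) [ArithStr N] (v : Fin 2 → N) =>
    (∀ l, l < v 0 + v 1 + 1 → (IsLen (v 0) l ↔ IsLen (v 1) l)) ∧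
    ∀ i, i < v 0 + v 1 + 1 → ∀ x, x < v 0 + v 1 + 1 → (Entry (v 0) i x ↔ Entry (v 1) i x)).congr
    fun N _ _ S _ v => ?_
  refine ⟨fun h => ⟨fun l _ => h.1 l, fun i _ x _ => h.2 i x⟩, fun h => ⟨fun l => ?_, fun i x => ?_⟩⟩
  · exact ⟨fun e => (h.1 l (lt_add_one_iff'.2 (e.le.trans le_self_add))).1 e,
      fun e => (h.1 l (lt_add_one_iff'.2 (e.le.trans le_add_self))).2 e⟩
  · exact ⟨fun e => (h.2 i (lt_add_one_iff'.2 (e.lt_code.le.trans le_self_add)) x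
        (lt_add_one_iff'.2 (e.le_code.trans le_self_add))).1 e,
      fun e => (h.2 i (lt_add_one_iff'.2 (e.lt_code.le.trans le_add_self)) x
        (lt_add_one_iff'.2 (e.le_code.trans le_add_self))).2 e⟩

instance UB.instIsSeq :
    UB fun (N : Type u) [ArithStr N] (v : Fin n → N) => IsSeq (r N v) := by
  refine .comp1 (P := fun N [ArithStr N] a => IsSeq a) ?_ hr
  refine (inferInstance : UB fun (N : Type u) [ArithStr N] (v : Fin 1 → N) =>
    (∃ l, l < v 0 + 1 ∧ IsLen (v 0) l) ∧ ∀ t, t < v 0 → ¬ SameSeq t (v 0)).congr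
    fun N _ _ S _ v => ?_
  exact and_congr_left fun _ => exists_congr fun l => ⟨fun h => ⟨lt_add_one_iff'.2 h.le, h⟩, And.right⟩

instance UB.instIsPrefix :
    UB fun (N : Type u) [ArithStr N] (v : Fin n → N) => IsPrefix (r N v) (s N v) := by
  refine .comp2 (P := fun N [ArithStr N] a m => IsPrefix a m) ?_ hr hs
  refine (inferInstance : UB fun (N : Type u) [ArithStr N] (v : Fin 2 → N) =>
    IsSeq (v 0) ∧ IsSeq (v 1) ∧ ∀ i, i < v 0 → ∀ x, x < v 0 + 1 →
      (Entry (v 0) i x → Entry (v 1) i x)).congr fun N _ _ S _ v => ?_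
  exact and_congr_right fun _ => and_congr_right fun _ =>
    ⟨fun h i _ x _ => h i x, fun h i x e => h i e.lt_code x (lt_add_one_iff'.2 e.le_code) e⟩

end

/-- The code of a tuple of numbers. -/
def code {N : Type u} [ArithStr N] : {n : ℕ} → (Fin n → N) → N
  | 0, _ => 0
  | _ + 1, v => pair (v 0) (code fun i => v i.succ)

instance UT.instCode {m : ℕ} (ρ : Fin m → Fin n) :
    UT fun (N : Type u) [ArithStr N] (v : Fin n → N) => code fun i => v (ρ i) := by
  induction m with
  | zero => unfold code; infer_instance
  | succ m ih =>
    unfold code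
    have := ih fun i => ρ i.succ
    infer_instance

theorem le_code {N : Type u} [ArithStr N] [PA N] {n : ℕ} (v : Fin n → N) (i : Fin n) :
    v i ≤ code v := by
  induction n with
  | zero => exact i.elim0
  | succ n ih =>
    rw [code]
    refine Fin.cases (left_le_pair _ _) (fun j => ?_) i
    exact (ih (fun i => v i.succ) j).trans (right_le_pair _ _)

/-- The length of the tuple is standard, so this is an iteration of single bounded quantifiers. The
bound is the last variable and hence stays in place while the leading variables are quantified. -/
theorem UB.ball_tuple {P : ∀ (N : Type u) [ArithStr N], (Fin (n + 1) → N) → Prop} (hP : UB P) :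
    UB fun (N : Type u) [ArithStr N] (w : Fin 1 → N) =>
      ∀ v : Fin n → N, (∀ i, v i < w 0 + 1) → P N (Fin.snoc v (w 0)) := by
  induction n with
  | zero =>
    refine hP.congr fun N _ _ S _ w => ?_
    have : ∀ v : Fin 0 → N, (Fin.snoc v (w 0) : Fin 1 → N) = w := fun v => by
      funext i; obtain rfl : i = Fin.last 0 := Fin.ext (by omega)
      simp; rfl
    simp only [this]
    exact ⟨fun h => h ![] fun i => i.elim0, fun h _ _ => h⟩
  | succ n ih =>
    have h1 : UB fun (N : Type u) [ArithStr N] (w : Fin (n + 1) → N) =>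
        ∀ a, a < w (Fin.last n) + 1 → P N (Fin.cons a w) := by
      have : UB fun (N : Type u) [ArithStr N] (w : Fin (n + 2) → N) =>
          P N (Fin.cons (w 0) fun i => w i.succ) :=
        hP.congr fun N _ _ S _ w => iff_of_eq (congrArg (P N) (Fin.cons_self_tail w))
      infer_instance
    refine (ih h1).congr fun N _ _ S _ w => ?_
    constructor
    · intro h v hv a ha
      have := h (Fin.cons a v) (Fin.cases (by simpa using ha) (by simpa using hv))
      rwa [← Fin.cons_snoc_eq_snoc_cons] at this
    · intro h v hv
      have := h (fun i => v i.succ) (fun i => hv _) (v 0) (by simpa using hv 0)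
      rw [Fin.cons_snoc_eq_snoc_cons] at this
      convert this
      exact (Fin.cons_self_tail v).symm

end

/-! ### Local truth conditions

A (partial) evaluation of an arithmetical formula `φ` is a relation `E`.  It contains the values of
`φ` itself at the arguments `pair 0 (code v)`: the value `0` stands for truth, other values for
falsity, and if `φ` is `∀ x, ψ` then the value `w + 1` says that `w` is a counterexample.  The values
of the immediate subformulas are stored at the arguments `pair 1 i` and `pair (1 + 1) i`.  The relation
`O X` contains the truth values of `a ∈ X`. -/

/-- The local conditions on evaluations, for those arguments at which the values are available. -/
def Con {N : Type u} [ArithStr N] :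
    {n k : ℕ} → Fm n k → (Fin k → N → N → Prop) → (N → N → Prop) → Prop
  | n, _, .eq s t, _, E => ∀ v : Fin n → N, ∀ y, E (pair 0 (code v)) y → (y = 0 ↔ s.val v = t.val v)
  | n, _, .lt s t, _, E => ∀ v : Fin n → N, ∀ y, E (pair 0 (code v)) y → (y = 0 ↔ s.val v < t.val v)
  | n, _, .mem t X, O, E => ∀ v : Fin n → N, ∀ y z, E (pair 0 (code v)) y → O X (t.val v) z →
      (y = 0 ↔ z = 0)
  | n, _, .falsum, _, E => ∀ v : Fin n → N, ∀ y, E (pair 0 (code v)) y → y ≠ 0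
  | n, _, .imp φ ψ, O, E => Con φ O (fun i => E (pair 1 i)) ∧ Con ψ O (fun i => E (pair (1 + 1) i)) ∧
      ∀ v : Fin n → N, ∀ y y₁ y₂, E (pair 0 (code v)) y → E (pair 1 (pair 0 (code v))) y₁ →
        E (pair (1 + 1) (pair 0 (code v))) y₂ → (y = 0 ↔ (y₁ = 0 → y₂ = 0))
  | n, _, .allN φ, O, E => Con φ O (fun i => E (pair 1 i)) ∧
      ∀ v : Fin n → N, ∀ w y y₁, E (pair 0 (code v)) y → E (pair 1 (pair 0 (pair w (code v)))) y₁ →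
        (y = 0 → y₁ = 0) ∧ (y = w + 1 → y₁ ≠ 0)
  | _, _, .allS _, _, _ => True

section
variable {N : Type u} [ArithStr N]

/-- In every condition the relations `E` and `O` occur only as premises, so the conditions pass to
smaller relations. -/
theorem Con.anti {n k : ℕ} {φ : Fm n k} {O O' : Fin k → N → N → Prop} {E E' : N → N → Prop}
    (h : Con φ O' E') (hO : ∀ X a z, O X a z → O' X a z) (hE : ∀ i y, E i y → E' i y) :
    Con φ O E := by
  induction φ generalizing E E' with
  | eq s t => exact fun v y e => h v y (hE _ _ e)
  | lt s t => exact fun v y e => h v y (hE _ _ e)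
  | mem t X => exact fun v y z e e' => h v y z (hE _ _ e) (hO _ _ _ e')
  | falsum => exact fun v y e => h v y (hE _ _ e)
  | imp φ ψ h1 h2 =>
    exact ⟨h1 h.1 hO fun _ _ => hE _ _, h2 h.2.1 hO fun _ _ => hE _ _, fun v y y₁ y₂ e e₁ e₂ =>
      h.2.2 v y y₁ y₂ (hE _ _ e) (hE _ _ e₁) (hE _ _ e₂)⟩
  | allN φ h1 =>
    exact ⟨h1 h.1 hO fun _ _ => hE _ _, fun v w y y₁ e e₁ =>
      h.2 v w y y₁ (hE _ _ e) (hE _ _ e₁)⟩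
  | allS φ => trivial

/-- The local conditions hold for the union of an increasing family if they hold for its members. -/
theorem Con.directed [PA N] {n k : ℕ} {φ : Fm n k} {O : Fin k → N → N → Prop} {E : N → N → Prop}
    {O' : N → Fin k → N → N → Prop} {E' : N → N → N → Prop} (h : ∀ m, Con φ (O' m) (E' m))
    (hO : ∀ X a z, O X a z → ∃ m, ∀ m' ≥ m, O' m' X a z)
    (hE : ∀ i y, E i y → ∃ m, ∀ m' ≥ m, E' m' i y) : Con φ O E := by
  induction φ generalizing E E' with
  | eq s t =>
    intro v y e
    obtain ⟨m, hm⟩ := hE _ _ e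
    exact h m v y (hm m le_rfl)
  | lt s t =>
    intro v y e
    obtain ⟨m, hm⟩ := hE _ _ e
    exact h m v y (hm m le_rfl)
  | falsum =>
    intro v y e
    obtain ⟨m, hm⟩ := hE _ _ e
    exact h m v y (hm m le_rfl)
  | mem t X =>
    intro v y z e e'
    obtain ⟨m, hm⟩ := hE _ _ e
    obtain ⟨m', hm'⟩ := hO _ _ _ e'
    -- A condition involves only finitely many values; the sum of their stages is a stage at which
    -- all of them are present.
    exact h (m + m') v y z (hm _ le_self_add) (hm' _ le_add_self)
  | imp φ ψ h1 h2 =>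
    refine ⟨h1 (fun m => (h m).1) hO fun _ _ => hE _ _, h2 (fun m => (h m).2.1) hO fun _ _ => hE _ _,
      fun v y y₁ y₂ e e₁ e₂ => ?_⟩
    obtain ⟨m, hm⟩ := hE _ _ e
    obtain ⟨m₁, hm₁⟩ := hE _ _ e₁
    obtain ⟨m₂, hm₂⟩ := hE _ _ e₂
    exact (h (m + m₁ + m₂)).2.2 v y y₁ y₂ (hm _ (le_self_add.trans le_self_add))
      (hm₁ _ (le_add_self.trans le_self_add)) (hm₂ _ le_add_self)
  | allN φ h1 =>
    refine ⟨h1 (fun m => (h m).1) hO fun _ _ => hE _ _, fun v w y y₁ e e₁ => ?_⟩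
    obtain ⟨m, hm⟩ := hE _ _ e
    obtain ⟨m₁, hm₁⟩ := hE _ _ e₁
    exact (h (m + m₁)).2 v w y y₁ (hm _ le_self_add) (hm₁ _ le_add_self)
  | allS φ => trivial

/-- A total evaluation that satisfies the local conditions computes the truth values. -/
theorem Con.truth [PA N] {S : Set (Set N)} {n k : ℕ} {φ : Fm n k} (hφ : φ.IsArith)
    {O : Fin k → N → N → Prop} {E : N → N → Prop} {V : Fin k → Set N} (h : Con φ O E)
    (hO : ∀ X a, ∃ z, O X a z ∧ (z = 0 ↔ a ∈ V X)) (hE : ∀ i, ∃ y, E i y)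
    (v : Fin n → N) {y : N} (hy : E (pair 0 (code v)) y) : y = 0 ↔ φ.Sat S v V := by
  induction φ generalizing E y with
  | eq s t => exact h v y hy
  | lt s t => exact h v y hy
  | falsum => exact ⟨fun e => h v y hy e, False.elim⟩
  | mem t X =>
    obtain ⟨z, hz, hz'⟩ := hO X (t.val v)
    exact (h v y z hy hz).trans hz'
  | imp φ ψ h1 h2 =>
    obtain ⟨y₁, hy₁⟩ := hE (pair 1 (pair 0 (code v)))
    obtain ⟨y₂, hy₂⟩ := hE (pair (1 + 1) (pair 0 (code v)))
    rw [h.2.2 v y y₁ y₂ hy hy₁ hy₂, h1 hφ.1 h.1 hO (fun i => hE _) v hy₁,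
      h2 hφ.2 h.2.1 hO (fun i => hE _) v hy₂]
    rfl
  | allN φ h1 =>
    have key : ∀ w, ∃ y₁, E (pair 1 (pair 0 (pair w (code v)))) y₁ ∧
        (y₁ = 0 ↔ φ.Sat S (Matrix.vecCons w v) V) := by
      intro w
      obtain ⟨y₁, hy₁⟩ := hE (pair 1 (pair 0 (pair w (code v))))
      exact ⟨y₁, hy₁, h1 hφ h.1 hO (fun i => hE _) (Matrix.vecCons w v) (by simpa [code] using hy₁)⟩
    constructor
    · intro e w
      obtain ⟨y₁, hy₁, h'⟩ := key w
      exact h'.1 ((h.2 v w y y₁ hy hy₁).1 e)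
    · intro hs
      rcases PA.eq_zero_or y with e | ⟨w, e⟩
      · exact e
      · obtain ⟨y₁, hy₁, h'⟩ := key w
        -- A nonzero value `w + 1` would claim that `w` is a counterexample, although the instance
        -- at `w` is true.
        exact ((h.2 v w y y₁ hy hy₁).2 e (h'.2 (hs w))).elim
  | allS φ => exact hφ.elim

theorem code_inj [PA N] {n : ℕ} {v w : Fin n → N} (h : code v = code w) : v = w := by
  induction n with
  | zero => exact Subsingleton.elim _ _
  | succ n ih =>
    obtain ⟨h1, h2⟩ := pair_inj.1 h
    have := ih h2
    funext i
    refine Fin.cases h1 (fun j => congrFun this j) i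

variable {S : Set (Set N)} [hM : Model S]

theorem Ar.instExTuple {m n : ℕ} {P : (Fin m → N) → (Fin n → N) → Prop}
    (hP : Ar S fun w : Fin (m + n) → N =>
      P (fun i => w (Fin.castAdd n i)) fun i => w (Fin.natAdd m i)) :
    Ar S fun w => ∃ v, P w v := by
  induction n with
  | zero =>
    refine hP.congr fun w => ⟨fun ⟨v, hv⟩ => ?_, fun h => ⟨_, h⟩⟩
    obtain rfl : v = fun i => w (Fin.natAdd m i) := Subsingleton.elim _ _
    exact hv
  | succ n ih =>
    have : Ar S fun w => ∃ v : Fin n → N, ∃ a, P w (Fin.snoc v a) := by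
      refine ih (P := fun w v => ∃ a, P w (Fin.snoc v a)) ?_
      have h1 : Ar S fun w : Fin (m + n + 1) → N => P (fun i => w (Fin.castAdd n i).succ)
          (Fin.snoc (fun i => w (Fin.natAdd m i).succ) (w 0)) := by
        refine (hP.ren (Fin.snoc (fun i : Fin (m + n) => i.succ) 0)).congr fun w => iff_of_eq ?_
        congr 1
        · funext i
          rw [show Fin.castAdd (n + 1) i = (Fin.castAdd n i).castSucc from rfl]
          simp only [Fin.snoc_castSucc]
        · funext i
          refine Fin.lastCases ?_ (fun j => ?_) i
          · rw [show Fin.natAdd m (Fin.last n) = Fin.last (m + n) from rfl]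
            simp only [Fin.snoc_last]
            exact congrArg w (Fin.snoc_last (α := fun _ => Fin (m + n + 1)) _ _).symm
          · rw [show Fin.natAdd m j.castSucc = (Fin.natAdd m j).castSucc from rfl]
            simp only [Fin.snoc_castSucc]
      infer_instance
    refine this.congr fun w => ⟨fun ⟨v, hv⟩ => ?_, fun ⟨v, a, h⟩ => ⟨_, h⟩⟩
    exact ⟨Fin.init v, v (Fin.last n), by rwa [Fin.snoc_init_self]⟩

instance ArF.instCode {m n : ℕ} (ρ : Fin m → Fin n) :
    ArF S fun v : Fin n → N => code fun i => v (ρ i) := by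
  induction m with
  | zero => unfold code; infer_instance
  | succ m ih =>
    unfold code
    have := ih fun i => ρ i.succ
    infer_instance

/-- The set of codes of the tuples that satisfy an arithmetical formula. -/
theorem exists_satSet {n k : ℕ} {φ : Fm n k} (hφ : φ.IsArith) {V : Fin k → Set N}
    (hV : ∀ i, V i ∈ S) : {c | ∃ v : Fin n → N, c = code v ∧ φ.Sat S v V} ∈ S := by
  have h1 : Ar S fun w : Fin n → N => φ.Sat S w V := ⟨k, φ, V, hφ, hV, fun v => Iff.rfl⟩
  have h2 : Ar S fun w : Fin 1 → N => ∃ v : Fin n → N, w 0 = code v ∧ φ.Sat S v V := by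
    refine Ar.instExTuple (P := fun w v => w 0 = code v ∧ φ.Sat S v V) ?_
    have := h1.ren (Fin.natAdd 1)
    infer_instance
  exact hM.out.setOf_mem (fun c => ∃ v : Fin n → N, c = code v ∧ φ.Sat S v V)

theorem mem_satSet [PA N] {n k : ℕ} {φ : Fm n k} {V : Fin k → Set N} (v : Fin n → N) :
    code v ∈ {c | ∃ v : Fin n → N, c = code v ∧ φ.Sat S v V} ↔ φ.Sat S v V :=
  ⟨fun ⟨_, h, hw⟩ => code_inj h ▸ hw, fun h => ⟨v, rfl, h⟩⟩

theorem zero_ne_one_add_one [PA N] : (0 : N) ≠ 1 + 1 := (PA.succ_ne_zero 1).symm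

theorem one_ne_one_add_one [PA N] : (1 : N) ≠ 1 + 1 := by
  simp

/-- Composition of an evaluation from its own values and the evaluations of the subformulas. -/
theorem exists_combine [PA N] {Own : N → N → Prop}
    (hOwn : Ar S fun v : Fin 2 → N => Own (v 0) (v 1)) (hex : ∀ c, ∃! y, Own c y) {p q : Set N}
    (hp : IsFun S p) (hq : IsFun S q) : ∃ r, IsFun S r ∧
      (∀ c y, pair (pair 0 c) y ∈ r ↔ Own c y) ∧ (∀ i y, pair (pair 1 i) y ∈ r ↔ pair i y ∈ p) ∧
      ∀ i y, pair (pair (1 + 1) i) y ∈ r ↔ pair i y ∈ q := by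
  have arOwn {n : ℕ} (f g : (Fin n → N) → N) [hf : ArF S f] [hg : ArF S g] :
    Ar S fun v => Own (f v) (g v) := hOwn.comp2 hf hg
  have : MemS S p := ⟨hp.1⟩
  have : MemS S q := ⟨hq.1⟩
  -- Arguments without one of the three tags `0`, `1`, `1 + 1` get the value `0`, which makes the
  -- function total.
  obtain ⟨r, hr, h⟩ := exists_isFun (S := S) (P := fun a y => (∃ c, a = pair 0 c ∧ Own c y) ∨
    (∃ i, a = pair 1 i ∧ pair i y ∈ p) ∨ (∃ i, a = pair (1 + 1) i ∧ pair i y ∈ q) ∨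
    ((¬ ∃ i, a = pair 0 i ∨ a = pair 1 i ∨ a = pair (1 + 1) i) ∧ y = 0)) inferInstance (by
      intro a
      by_cases h0 : ∃ c, a = pair 0 c
      · obtain ⟨c, rfl⟩ := h0
        simpa [pair_inj, zero_ne_one_add_one] using hex c
      by_cases h1 : ∃ c, a = pair 1 c
      · obtain ⟨c, rfl⟩ := h1
        simpa [pair_inj, one_ne_one_add_one] using hp.2.2 c
      by_cases h2 : ∃ c, a = pair (1 + 1) c
      · obtain ⟨c, rfl⟩ := h2
        simpa [pair_inj, zero_ne_one_add_one.symm, one_ne_one_add_one.symm] using hq.2.2 c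
      push Not at h0 h1 h2
      simp [h0, h1, h2])
  refine ⟨r, hr, fun c y => ?_, fun c y => ?_, fun c y => ?_⟩ <;> rw [h]
  · simp [pair_inj, zero_ne_one_add_one]
  · simp [pair_inj]
  · simp [pair_inj, zero_ne_one_add_one.symm, one_ne_one_add_one.symm]

theorem existsUnique_truthValue [PA N] (T : Set N) (c : N) :
    ∃! y : N, (c ∈ T ∧ y = 0) ∨ (c ∉ T ∧ y = 1) := by
  by_cases h : c ∈ T <;> simp [h]

/-- An evaluation of a formula whose own values are `0` and `1`. -/
theorem exists_own [PA N] {n k : ℕ} {φ : Fm n k} (hφ : φ.IsArith) {V : Fin k → Set N}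
    (hV : ∀ X, V X ∈ S) {p q : Set N} (hp : IsFun S p) (hq : IsFun S q) :
    ∃ r, IsFun S r ∧ (∀ v y, pair (pair 0 (code v)) y ∈ r → (y = 0 ↔ φ.Sat S v V)) ∧
      (∀ i y, pair (pair 1 i) y ∈ r ↔ pair i y ∈ p) ∧
      ∀ i y, pair (pair (1 + 1) i) y ∈ r ↔ pair i y ∈ q := by
  have : MemS S _ := ⟨exists_satSet hφ hV⟩
  have hT := fun v => mem_satSet (S := S) (φ := φ) (V := V) v
  set T := {c | ∃ v : Fin n → N, c = code v ∧ φ.Sat S v V}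
  obtain ⟨r, hr, h0, h⟩ := exists_combine (S := S)
    (Own := fun c y => (c ∈ T ∧ y = 0) ∨ (c ∉ T ∧ y = 1)) inferInstance
    (existsUnique_truthValue T) hp hq
  refine ⟨r, hr, fun v y hy => ?_, h⟩
  rcases (h0 _ _).1 hy with ⟨h, rfl⟩ | ⟨h, rfl⟩
  · simpa using (hT v).1 h
  · simpa using fun h' => h ((hT v).2 h')

/-- Every arithmetical formula has an evaluation with its true values. -/
theorem exists_eval [PA N] {n k : ℕ} {φ : Fm n k} (hφ : φ.IsArith) {V : Fin k → Set N}
    (hV : ∀ X, V X ∈ S) {O : Fin k → N → N → Prop} (hO : ∀ X a z, O X a z → (z = 0 ↔ a ∈ V X)) :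
    ∃ p, IsFun S p ∧ Con φ O (fun i y => pair i y ∈ p) ∧
      ∀ v y, pair (pair 0 (code v)) y ∈ p → (y = 0 ↔ φ.Sat S v V) := by
  obtain ⟨z, hz, -⟩ := exists_isFun (S := S) (P := fun _ y => y = 0) inferInstance fun _ => by simp
  -- This induction is external: the formula is standard, and each subformula takes finitely many
  -- applications of arithmetical comprehension.
  induction φ with
  | eq s t =>
    obtain ⟨r, hr, h, -⟩ := exists_own hφ hV hz hz
    exact ⟨r, hr, fun v y e => h v y e, h⟩
  | lt s t =>
    obtain ⟨r, hr, h, -⟩ := exists_own hφ hV hz hz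
    exact ⟨r, hr, fun v y e => h v y e, h⟩
  | falsum =>
    obtain ⟨r, hr, h, -⟩ := exists_own hφ hV hz hz
    exact ⟨r, hr, fun v y e e' => (h v y e).1 e', h⟩
  | mem t X =>
    obtain ⟨r, hr, h, -⟩ := exists_own hφ hV hz hz
    exact ⟨r, hr, fun v y y' e e' => (h v y e).trans (hO X _ _ e').symm, h⟩
  | imp φ ψ ih1 ih2 =>
    obtain ⟨p, hp, hp1, hp2⟩ := ih1 hφ.1 hV hO
    obtain ⟨q, hq, hq1, hq2⟩ := ih2 hφ.2 hV hO
    obtain ⟨r, hr, h, hrp, hrq⟩ := exists_own hφ hV hp hq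
    refine ⟨r, hr, ⟨?_, ?_, fun v y y₁ y₂ e e₁ e₂ => ?_⟩, h⟩
    · simpa only [hrp] using hp1
    · simpa only [hrq] using hq1
    · rw [h v y e, hp2 v y₁ ((hrp _ _).1 e₁), hq2 v y₂ ((hrq _ _).1 e₂)]; rfl
  | allN φ ih =>
    obtain ⟨p, hp, hp1, hp2⟩ := ih hφ hV hO
    have hT' := fun v => mem_satSet (S := S) (φ := φ) (V := V) v
    have : MemS S _ := ⟨exists_satSet (φ := φ) hφ hV⟩
    set T' := {c | ∃ v, c = code v ∧ φ.Sat S v V}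
    -- The value of a false universal formula names the least counterexample, so it is definable and
    -- unique.
    obtain ⟨r, hr, h0, hrp, -⟩ := exists_combine (S := S)
      (Own := fun c y => ((∀ w, pair w c ∈ T') ∧ y = 0) ∨
        ∃ w, pair w c ∉ T' ∧ (∀ w', w' < w → pair w' c ∈ T') ∧ y = w + 1) inferInstance (by
        intro c
        by_cases h : ∀ w, pair w c ∈ T'
        · exact ⟨0, .inl ⟨h, rfl⟩, fun y hy => by
            rcases hy with hy | ⟨w, hw, -⟩
            exacts [hy.2, (hw (h w)).elim]⟩
        · push Not at h
          obtain ⟨w, hw, hmin⟩ := exists_least (S := S) inferInstance h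
          simp only [not_not] at hmin
          refine ⟨w + 1, .inr ⟨w, hw, hmin, rfl⟩, fun y hy => ?_⟩
          rcases hy with hy | ⟨w', hw', hmin', rfl⟩
          · exact (hw (hy.1 w)).elim
          · rw [le_antisymm (not_lt.1 fun hl => hw (hmin' _ hl)) (not_lt.1 fun hl => hw' (hmin _ hl))])
      hp hz
    have hc : ∀ v w, pair w (code v) ∈ T' ↔ φ.Sat S (Matrix.vecCons w v) V := fun v w =>
      hT' (Matrix.vecCons w v)
    refine ⟨r, hr, ⟨by simpa only [hrp] using hp1, fun v w y y₁ e e₁ => ?_⟩, fun v y e => ?_⟩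
    · have h1 := hp2 (Matrix.vecCons w v) y₁ ((hrp _ _).1 e₁)
      rw [Ne, h1, ← hc]
      rcases (h0 _ _).1 e with ⟨h, rfl⟩ | ⟨w', h, -, rfl⟩
      · exact ⟨fun _ => h w, fun h' => (PA.succ_ne_zero _ h'.symm).elim⟩
      · exact ⟨fun h' => (PA.succ_ne_zero _ h').elim, fun h' h'' => h (PA.add_cancel _ _ _ h' ▸ h'')⟩
    · rw [Fm.Sat]
      simp only [← hc]
      rcases (h0 _ _).1 e with ⟨h, rfl⟩ | ⟨w', h, -, rfl⟩
      · simpa using h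
      · exact ⟨fun h' => (PA.succ_ne_zero _ h').elim, fun h' => (h (h' _)).elim⟩
  | allS φ => exact hφ.elim

end

/-! ### Definability of the local conditions -/

theorem UB.comp3' {P : ∀ (N : Type u) [ArithStr N], N → N → N → Prop}
    (hP : UB fun (N : Type u) [ArithStr N] (v : Fin 3 → N) => P N (v 0) (v 1) (v 2)) (n : ℕ)
    (r s t : ∀ (N : Type u) [ArithStr N], (Fin n → N) → N) [hr : UT r] [hs : UT s] [ht : UT t] :
    UB fun (N : Type u) [ArithStr N] (v : Fin n → N) => P N (r N v) (s N v) (t N v) :=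
  UB.comp3 hP hr hs ht

theorem lt_of_tuple {E : ∀ (N : Type u) [ArithStr N], N → N → N → Prop}
    (bE : ∀ (N : Type u) [ArithStr N] [PA N] (j i y : N), E N j i y → i < j + 1 ∧ y < j + 1)
    {N : Type u} [ArithStr N] [PA N] {j : N} {n : ℕ} {v : Fin n → N} {y : N}
    (h : E N j (pair 0 (code v)) y) (i : Fin n) : v i < j + 1 :=
  ((le_code v i).trans (right_le_pair _ _)).trans_lt (bE N j _ _ h).1

/-- A code `j` holds only arguments and values up to `j`, and the entries of a tuple are bounded by
its code, so all quantifiers in `Con` can be bounded in terms of `j`. The oracle gets the larger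
bound `j + 1 + 1` because the truth value `1` may exceed `j`. For subformulas `E` is precomposed
with a tag, which keeps the bounds because `i ≤ pair 1 i`, and likewise for the other tag. -/
theorem UB.con {n k : ℕ} (φ : Fm n k) {O : ∀ (N : Type u) [ArithStr N], N → Fin k → N → N → Prop}
    {E : ∀ (N : Type u) [ArithStr N], N → N → N → Prop}
    (hO : ∀ X, UB fun (N : Type u) [ArithStr N] (v : Fin 3 → N) => O N (v 0) X (v 1) (v 2))
    (hE : UB fun (N : Type u) [ArithStr N] (v : Fin 3 → N) => E N (v 0) (v 1) (v 2))
    (bO : ∀ (N : Type u) [ArithStr N] [PA N] (j : N) X a z, O N j X a z → z < j + 1 + 1)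
    (bE : ∀ (N : Type u) [ArithStr N] [PA N] (j i y : N), E N j i y → i < j + 1 ∧ y < j + 1) :
    UB fun (N : Type u) [ArithStr N] (w : Fin 1 → N) => Con φ (O N (w 0)) (E N (w 0)) := by
  induction φ generalizing E with
  | @eq n k s t =>
    have iE := UB.comp3' (P := @E) hE
    have : UB fun (N : Type u) [ArithStr N] (w : Fin (n + 1) → N) => ∀ y, y < w (Fin.last n) + 1 →
      E N (w (Fin.last n)) (pair 0 (code fun i : Fin n => w i.castSucc)) y → (y = 0 ↔
        (s.val fun i : Fin n => w i.castSucc) = t.val fun i : Fin n => w i.castSucc) := inferInstance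
    refine this.ball_tuple.congr fun N _ _ S _ w => ?_
    simp only [Fin.snoc_castSucc, Fin.snoc_last]
    exact ⟨fun h v _ y _ e => h v y e, fun h v y e => h v (lt_of_tuple bE e) y (bE N _ _ _ e).2 e⟩
  | @lt n k s t =>
    have iE := UB.comp3' (P := @E) hE
    have : UB fun (N : Type u) [ArithStr N] (w : Fin (n + 1) → N) => ∀ y, y < w (Fin.last n) + 1 →
      E N (w (Fin.last n)) (pair 0 (code fun i : Fin n => w i.castSucc)) y → (y = 0 ↔
        (s.val fun i : Fin n => w i.castSucc) < t.val fun i : Fin n => w i.castSucc) := inferInstance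
    refine this.ball_tuple.congr fun N _ _ S _ w => ?_
    simp only [Fin.snoc_castSucc, Fin.snoc_last]
    exact ⟨fun h v _ y _ e => h v y e, fun h v y e => h v (lt_of_tuple bE e) y (bE N _ _ _ e).2 e⟩
  | @falsum n k =>
    have iE := UB.comp3' (P := @E) hE
    have : UB fun (N : Type u) [ArithStr N] (w : Fin (n + 1) → N) => ∀ y, y < w (Fin.last n) + 1 →
      E N (w (Fin.last n)) (pair 0 (code fun i : Fin n => w i.castSucc)) y → y ≠ 0 := inferInstance
    refine this.ball_tuple.congr fun N _ _ S _ w => ?_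
    simp only [Fin.snoc_castSucc, Fin.snoc_last]
    exact ⟨fun h v _ y _ e => h v y e, fun h v y e => h v (lt_of_tuple bE e) y (bE N _ _ _ e).2 e⟩
  | @mem n k t X =>
    have iE := UB.comp3' (P := @E) hE
    have iO := UB.comp3' (P := fun N [ArithStr N] j => O N j X) (hO X)
    have : UB fun (N : Type u) [ArithStr N] (w : Fin (n + 1) → N) => ∀ y, y < w (Fin.last n) + 1 →
      ∀ z, z < w (Fin.last n) + 1 + 1 →
      E N (w (Fin.last n)) (pair 0 (code fun i : Fin n => w i.castSucc)) y →
      O N (w (Fin.last n)) X (t.val fun i : Fin n => w i.castSucc) z → (y = 0 ↔ z = 0) :=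
      inferInstance
    refine this.ball_tuple.congr fun N _ _ S _ w => ?_
    simp only [Fin.snoc_castSucc, Fin.snoc_last]
    exact ⟨fun h v _ y _ z _ e e' => h v y z e e', fun h v y z e e' =>
      h v (lt_of_tuple bE e) y (bE N _ _ _ e).2 z (bO N _ _ _ _ e') e e'⟩
  | @imp n k φ ψ h1 h2 =>
    have iE := UB.comp3' (P := @E) hE
    have : UB fun (N : Type u) [ArithStr N] (w : Fin (n + 1) → N) => ∀ y, y < w (Fin.last n) + 1 →
      ∀ y₁, y₁ < w (Fin.last n) + 1 → ∀ y₂, y₂ < w (Fin.last n) + 1 →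
      E N (w (Fin.last n)) (pair 0 (code fun i : Fin n => w i.castSucc)) y →
      E N (w (Fin.last n)) (pair 1 (pair 0 (code fun i : Fin n => w i.castSucc))) y₁ →
      E N (w (Fin.last n)) (pair (1 + 1) (pair 0 (code fun i : Fin n => w i.castSucc))) y₂ →
      (y = 0 ↔ (y₁ = 0 → y₂ = 0)) := inferInstance
    have h3 := this.ball_tuple
    simp only [Fin.snoc_castSucc, Fin.snoc_last] at h3
    have h1 := h1 hO (E := fun N _ j i => E N j (pair 1 i)) inferInstance bO
      fun N _ _ j i y h => ⟨(right_le_pair _ _).trans_lt (bE N j _ y h).1, (bE N j _ y h).2⟩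
    have h2 := h2 hO (E := fun N _ j i => E N j (pair (1 + 1) i)) inferInstance bO
      fun N _ _ j i y h => ⟨(right_le_pair _ _).trans_lt (bE N j _ y h).1, (bE N j _ y h).2⟩
    refine (UB.instAnd (hP := h1) (hQ := UB.instAnd (hP := h2) (hQ := h3))).congr
      fun N _ _ S _ w => ?_
    refine and_congr_right fun _ => and_congr_right fun _ => ?_
    exact ⟨fun h v _ y _ y₁ _ y₂ _ e e₁ e₂ => h v y y₁ y₂ e e₁ e₂, fun h v y y₁ y₂ e e₁ e₂ =>
      h v (lt_of_tuple bE e) y (bE N _ _ _ e).2 y₁ (bE N _ _ _ e₁).2 y₂ (bE N _ _ _ e₂).2 e e₁ e₂⟩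
  | @allN n k φ h1 =>
    have iE := UB.comp3' (P := @E) hE
    have : UB fun (N : Type u) [ArithStr N] (w : Fin (n + 1) → N) => ∀ x, x < w (Fin.last n) + 1 →
      ∀ y, y < w (Fin.last n) + 1 → ∀ y₁, y₁ < w (Fin.last n) + 1 →
      E N (w (Fin.last n)) (pair 0 (code fun i : Fin n => w i.castSucc)) y →
      E N (w (Fin.last n)) (pair 1 (pair 0 (pair x (code fun i : Fin n => w i.castSucc)))) y₁ →
      (y = 0 → y₁ = 0) ∧ (y = x + 1 → y₁ ≠ 0) := inferInstance
    have h3 := this.ball_tuple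
    simp only [Fin.snoc_castSucc, Fin.snoc_last] at h3
    have h1 := h1 hO (E := fun N _ j i => E N j (pair 1 i)) inferInstance bO
      fun N _ _ j i y h => ⟨(right_le_pair _ _).trans_lt (bE N j _ y h).1, (bE N j _ y h).2⟩
    refine (UB.instAnd (hP := h1) (hQ := h3)).congr fun N _ _ S _ w => ?_
    refine and_congr_right fun _ => ?_
    refine ⟨fun h v _ x _ y _ y₁ _ e e₁ => h v x y y₁ e e₁, fun h v x y y₁ e e₁ =>
      h v (lt_of_tuple bE e) x ?_ y (bE N _ _ _ e).2 y₁ (bE N _ _ _ e₁).2 e e₁⟩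
    exact ((left_le_pair _ _).trans ((right_le_pair _ _).trans (right_le_pair _ _))).trans_lt
      (bE N _ _ _ e₁).1
  | allS φ => exact (inferInstance : UB fun (N : Type u) [ArithStr N] (_ : Fin 1 → N) => True)

/-! ### The tree of attempts to refute a formula

For a formula `θ(Z, Y, R)` a branch of the tree has the entries `pair (pair (R i) (Y i)) (q i)`, where
`q` consists of the truth values of `a ∈ Z` at the arguments `pair 0 a` and of an evaluation of `θ` at the
arguments `pair 1 i`. -/

section
variable {N : Type u} [ArithStr N]

def RVal (B : N → N → Prop) (i r : N) : Prop := ∃ y q, B i (pair (pair r y) q)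

def YVal (B : N → N → Prop) (i y : N) : Prop := ∃ r q, B i (pair (pair r y) q)

def QVal (B : N → N → Prop) (i q : N) : Prop := ∃ x, B i (pair x q)

/-- The truth values of `a ∈ R`, where `R` is the graph of a function. -/
def GraphVal (B : N → N → Prop) (a z : N) : Prop :=
  (∃ i s r, a = pair i s ∧ RVal B i r ∧ ((r = s ∧ z = 0) ∨ (r ≠ s ∧ z = 1))) ∨
    ((¬ ∃ i s, a = pair i s) ∧ z = 1)

/-- The truth values of `a ∈ Z`, `a ∈ Y` and `a ∈ R`. -/
def Orc (B : N → N → Prop) : Fin 3 → N → N → Prop :=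
  ![fun a z => QVal B (pair 0 a) z, YVal B, GraphVal B]

/-- No violation of the local conditions and of the falsity of `θ` is visible in `B`. -/
def Attempt (θ : Fm 0 3) (B : N → N → Prop) : Prop :=
  -- The tag `1` selects the evaluation, and `pair 0 0` is the argument of `θ` itself at the empty
  -- tuple, whose code is `0`.
  Con θ (Orc B) (fun i => QVal B (pair 1 i)) ∧ ∀ y, QVal B (pair 1 (pair 0 0)) y → y ≠ 0

def Node (θ : Fm 0 3) (j : N) : Prop := IsSeq j ∧ Attempt θ (Entry j)

theorem forall_fin_three {P : Fin 3 → Prop} (h0 : P 0) (h1 : P 1) (h2 : P 2) (i : Fin 3) : P i := by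
  fin_cases i <;> assumption

theorem Orc.mono {B B' : N → N → Prop} (h : ∀ i x, B i x → B' i x) (X : Fin 3) (a z : N) :
    Orc B X a z → Orc B' X a z := by
  revert X
  refine forall_fin_three ?_ ?_ ?_
  · rintro ⟨x, hx⟩; exact ⟨x, h _ _ hx⟩
  · rintro ⟨r, q, hx⟩; exact ⟨r, q, h _ _ hx⟩
  · rintro (⟨i, s, r, e, ⟨y, q, hx⟩, h'⟩ | h')
    · exact .inl ⟨i, s, r, e, ⟨y, q, h _ _ hx⟩, h'⟩
    · exact .inr h'

theorem Attempt.anti {θ : Fm 0 3} {B B' : N → N → Prop} (h : Attempt θ B')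
    (hB : ∀ i x, B i x → B' i x) : Attempt θ B :=
  ⟨h.1.anti (fun X a z => Orc.mono hB X a z) fun _ _ ⟨x, hx⟩ => ⟨x, hB _ _ hx⟩,
    fun y ⟨x, hx⟩ => h.2 y ⟨x, hB _ _ hx⟩⟩

/-- The pairs `(i, r)` such that the value of `b` at `i` has the form `pair r y`. -/
def graphPart (b : Set N) : Set N := {p | ∃ i r y, p = pair i r ∧ pair i (pair r y) ∈ b}

/-- The numbers `i` such that the value of `b` at `i` has the form `pair r 0`. -/
def setPart (b : Set N) : Set N := {i | ∃ r, pair i (pair r 0) ∈ b}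

/-- The tree of the attempts that are based on the data `b`. -/
def Tree (θ : Fm 0 3) (b : Set N) : Set N :=
  {j | Node θ j ∧ ∀ i z, Entry j i z → ∃ x q, z = pair x q ∧ pair i x ∈ b}

variable [PA N]

/-- Being an attempt is a closed condition: it holds of an infinite sequence if it holds of all its
finite initial segments. -/
theorem Attempt.directed {θ : Fm 0 3} {B : N → N → Prop} {B' : N → N → N → Prop}
    (h : ∀ m, Attempt θ (B' m)) (hB : ∀ i x, B i x → ∃ m, ∀ m' ≥ m, B' m' i x) : Attempt θ B := by
  refine ⟨Con.directed (fun m => (h m).1) (forall_fin_three ?_ ?_ ?_) ?_, ?_⟩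
  · rintro a z ⟨x, hx⟩
    obtain ⟨m, hm⟩ := hB _ _ hx
    exact ⟨m, fun m' h => ⟨x, hm m' h⟩⟩
  · rintro a z ⟨r, q, hx⟩
    obtain ⟨m, hm⟩ := hB _ _ hx
    exact ⟨m, fun m' h => ⟨r, q, hm m' h⟩⟩
  · rintro a z (⟨i, s, r, e, ⟨y, q, hx⟩, h'⟩ | h')
    · obtain ⟨m, hm⟩ := hB _ _ hx
      exact ⟨m, fun m' h => .inl ⟨i, s, r, e, ⟨y, q, hm m' h⟩, h'⟩⟩
    · exact ⟨0, fun m' h => .inr h'⟩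
  · rintro a z ⟨x, hx⟩
    obtain ⟨m, hm⟩ := hB _ _ hx
    exact ⟨m, fun m' h => ⟨x, hm m' h⟩⟩
  · rintro y ⟨x, hx⟩
    obtain ⟨m, hm⟩ := hB _ _ hx
    exact (h m).2 y ⟨x, hm m le_rfl⟩

variable {S : Set (Set N)} [hM : Model S]

section
variable {b : Set N} [MemS S b]

theorem graphPart_mem : graphPart b ∈ S := hM.out.setOf_mem _

theorem setPart_mem : setPart b ∈ S := hM.out.setOf_mem _

end

/-- A path through the tree yields a counterexample. -/
theorem exists_not_sat_of_path {θ : Fm 0 3} (hθ : θ.IsArith) {b g : Set N} (hb : IsFun S b)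
    (hpair : ∀ i x, pair i x ∈ b → ∃ r y, x = pair r y) (hg : IsFun S g)
    (hT : ∀ n t, IsInit g n t → t ∈ Tree θ b) :
    ∃ Z ∈ S, ¬ θ.Sat S ![] ![Z, setPart b, graphPart b] := by
  have : MemS S g := ⟨hg.1⟩
  have hatt : Attempt θ fun i x => pair i x ∈ g := by
    choose t ht using fun n => hg.exists_isInit n
    refine Attempt.directed (B' := fun m => Entry (t m)) (fun m => (hT m _ (ht m)).1.2) ?_
    intro i x h
    exact ⟨i + 1, fun m hm => ((ht m).entry_iff hg).2 ⟨add_one_le_iff'.1 hm, h⟩⟩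
  have hval : ∀ i z, pair i z ∈ g → ∃ x q, z = pair x q ∧ pair i x ∈ b := by
    intro i z h
    obtain ⟨t, ht⟩ := hg.exists_isInit (i + 1)
    exact (hT _ t ht).2 i z ((ht.entry_iff hg).2 ⟨lt_add_one_iff'.2 le_rfl, h⟩)
  have htot : ∀ i, ∃ r y q, pair i (pair (pair r y) q) ∈ g ∧ pair i (pair r y) ∈ b := by
    intro i
    obtain ⟨z, hz⟩ := (hg.2.2 i).exists
    obtain ⟨x, q, rfl, hx⟩ := hval i z hz
    obtain ⟨r, y, rfl⟩ := hpair i x hx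
    exact ⟨r, y, q, hz, hx⟩
  have arZ : Ar S fun v : Fin 1 → N => QVal (fun i x => pair i x ∈ g) (pair 0 (v 0)) 0 := by
    unfold QVal; infer_instance
  refine ⟨{a | QVal (fun i x => pair i x ∈ g) (pair 0 a) 0}, hM.out.setOf_mem _, fun hs => ?_⟩
  obtain ⟨r, y, q, hq, -⟩ := htot (pair 1 (pair 0 0))
  -- The value of `θ` along the path is nonzero, but if `θ` held it would have to be zero because
  -- the evaluation is total. The remaining goals say that the oracles read off the path are total
  -- and correct.
  refine hatt.2 q ⟨_, hq⟩ ((Con.truth (v := ![]) (S := S) hθ hatt.1 (forall_fin_three ?_ ?_ ?_) ?_ ?_).2 hs)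
  · intro a
    obtain ⟨r, y, q, hq, -⟩ := htot (pair 0 a)
    refine ⟨q, ⟨_, hq⟩, ⟨fun e => ⟨_, e ▸ hq⟩, fun ⟨x, hx⟩ => ?_⟩⟩
    exact (pair_inj.1 (hg.eq hq hx)).2
  · intro a
    obtain ⟨r, y, q, hq, hb'⟩ := htot a
    refine ⟨y, ⟨_, _, hq⟩, ⟨fun e => ⟨_, e ▸ hb'⟩, fun ⟨x, hx⟩ => ?_⟩⟩
    exact (pair_inj.1 (hb.eq hb' hx)).2
  · intro a
    by_cases ha : ∃ i s, a = pair i s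
    · obtain ⟨i, s, rfl⟩ := ha
      obtain ⟨r, y, q, hq, hb'⟩ := htot i
      by_cases hrs : r = s
      · exact ⟨0, .inl ⟨i, s, r, rfl, ⟨_, _, hq⟩, .inl ⟨hrs, rfl⟩⟩,
          fun _ => ⟨i, s, y, rfl, hrs ▸ hb'⟩, fun _ => rfl⟩
      · refine ⟨1, .inl ⟨i, s, r, rfl, ⟨_, _, hq⟩, .inr ⟨hrs, rfl⟩⟩,
          fun e => (one_ne_zero e).elim, ?_⟩
        rintro ⟨i', s', y', e, h⟩
        obtain ⟨rfl, rfl⟩ := pair_inj.1 e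
        exact (hrs (pair_inj.1 (hb.eq hb' h)).1).elim
    · refine ⟨1, .inr ⟨ha, rfl⟩, fun e => (one_ne_zero e).elim, ?_⟩
      rintro ⟨i, s, y, e, -⟩
      exact (ha ⟨i, s, e⟩).elim
  · intro i
    obtain ⟨r, y, q, hq, -⟩ := htot (pair 1 i)
    exact ⟨q, _, hq⟩
  · exact ⟨_, hq⟩

/-- A counterexample yields a path through the tree. -/
theorem exists_path_of_not_sat {θ : Fm 0 3} (hθ : θ.IsArith) {b Z : Set N} (hb : IsFun S b)
    (hZ : Z ∈ S) (h : ¬ θ.Sat S ![] ![Z, setPart b, graphPart b]) :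
    ∃ g, IsFun S g ∧ ∀ n t, IsInit g n t → t ∈ Tree θ b := by
  have : MemS S b := ⟨hb.1⟩
  have : MemS S Z := ⟨hZ⟩
  -- The oracle here is the largest correct relation. Those that are read off `g` below are
  -- contained in it, so `Con.anti` transfers the conditions.
  obtain ⟨p, hp, hp1, hp2⟩ := exists_eval (S := S) hθ (V := ![Z, setPart b, graphPart b])
    (forall_fin_three hZ setPart_mem graphPart_mem)
    (O := fun X a z => z = 0 ↔ a ∈ (![Z, setPart b, graphPart b] : Fin 3 → Set N) X)
    fun _ _ _ => id
  have : MemS S p := ⟨hp.1⟩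
  obtain ⟨z, hz, -⟩ := exists_isFun (S := S) (P := fun _ y => y = 0) inferInstance fun _ => by simp
  obtain ⟨q, hq, hq0, hq1, -⟩ := exists_combine (S := S)
    (Own := fun c y => (c ∈ Z ∧ y = 0) ∨ (c ∉ Z ∧ y = 1)) inferInstance
    (existsUnique_truthValue Z) hp hz
  have : MemS S q := ⟨hq.1⟩
  obtain ⟨g, hg, hg'⟩ := exists_isFun (S := S)
    (P := fun i z => ∃ x y, z = pair x y ∧ pair i x ∈ b ∧ pair i y ∈ q) inferInstance (by
      intro i
      obtain ⟨x, hx⟩ := (hb.2.2 i).exists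
      obtain ⟨y, hy⟩ := (hq.2.2 i).exists
      refine ⟨pair x y, ⟨x, y, rfl, hx, hy⟩, ?_⟩
      rintro z ⟨x', y', rfl, hx', hy'⟩
      rw [hb.eq hx hx', hq.eq hy hy'])
  have hgp : ∀ i x y, pair i (pair x y) ∈ g ↔ pair i x ∈ b ∧ pair i y ∈ q := by
    intro i x y
    rw [hg']
    constructor
    · rintro ⟨x', y', e, h⟩
      obtain ⟨rfl, rfl⟩ := pair_inj.1 e
      exact h
    · exact fun h => ⟨x, y, rfl, h⟩
  have hatt : Attempt θ fun i x => pair i x ∈ g := by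
    refine ⟨hp1.anti (forall_fin_three ?_ ?_ ?_) ?_, ?_⟩
    · rintro a z ⟨x, hx⟩
      rcases (hq0 _ _).1 ((hgp _ _ _).1 hx).2 with ⟨h, rfl⟩ | ⟨h, rfl⟩
      · simpa using h
      · simpa using h
    · rintro a z ⟨r, q', hx⟩
      have h1 := ((hgp _ _ _).1 hx).1
      refine ⟨fun e => ⟨r, e ▸ h1⟩, fun ⟨r', h2⟩ => ?_⟩
      exact (pair_inj.1 (hb.eq h1 h2)).2
    · rintro a z (⟨i, s, r, rfl, ⟨y, q', hx⟩, h'⟩ | h')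
      · have h1 := ((hgp _ _ _).1 hx).1
        rcases h' with ⟨rfl, rfl⟩ | ⟨hrs, rfl⟩
        · exact ⟨fun _ => ⟨i, r, y, rfl, h1⟩, fun _ => rfl⟩
        · refine ⟨fun e => (one_ne_zero e).elim, ?_⟩
          rintro ⟨i', s', y', e, h⟩
          obtain ⟨rfl, rfl⟩ := pair_inj.1 e
          exact (hrs (pair_inj.1 (hb.eq h1 h)).1).elim
      · obtain ⟨h', rfl⟩ := h'
        refine ⟨fun e => (one_ne_zero e).elim, ?_⟩
        rintro ⟨i, s, y, e, -⟩
        exact (h' ⟨i, s, e⟩).elim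
    · rintro i y ⟨x, hx⟩
      exact (hq1 _ _).1 ((hgp _ _ _).1 hx).2
    · rintro y ⟨x, hx⟩ rfl
      exact h ((hp2 ![] 0 ((hq1 _ _).1 ((hgp _ _ _).1 hx).2)).1 rfl)
  refine ⟨g, hg, fun n t ht => ⟨⟨ht.1, hatt.anti fun i x e => ht.2.2 i x e⟩, fun i z e => ?_⟩⟩
  obtain ⟨x, y, e1, e2, -⟩ := (hg' _ _).1 (ht.2.2 i z e)
  exact ⟨x, y, e1, e2⟩

end

/-! ### Bounded definability of the nodes of the tree -/

section
variable {n : ℕ} {r s t : ∀ (N : Type u) [ArithStr N], (Fin n → N) → N} [hr : UT r] [hs : UT s]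
  [ht : UT t]

instance UB.instQVal :
    UB fun (N : Type u) [ArithStr N] (v : Fin n → N) => QVal (Entry (r N v)) (s N v) (t N v) := by
  refine .comp3 (P := fun N [ArithStr N] j => QVal (Entry j)) ?_ hr hs ht
  refine (inferInstance : UB fun (N : Type u) [ArithStr N] (v : Fin 3 → N) =>
    ∃ x, x < v 0 + 1 ∧ Entry (v 0) (v 1) (pair x (v 2))).congr fun N _ _ S _ v => ?_
  exact exists_congr fun x => ⟨fun h =>
    ⟨lt_add_one_iff'.2 ((left_le_pair _ _).trans h.le_code), h⟩, And.right⟩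

instance UB.instYVal :
    UB fun (N : Type u) [ArithStr N] (v : Fin n → N) => YVal (Entry (r N v)) (s N v) (t N v) := by
  refine .comp3 (P := fun N [ArithStr N] j => YVal (Entry j)) ?_ hr hs ht
  refine (inferInstance : UB fun (N : Type u) [ArithStr N] (v : Fin 3 → N) =>
    ∃ x, x < v 0 + 1 ∧ ∃ q, q < v 0 + 1 ∧ Entry (v 0) (v 1) (pair (pair x (v 2)) q)).congr
    fun N _ _ S _ v => ?_
  constructor
  · rintro ⟨x, q, h⟩
    exact ⟨x, lt_add_one_iff'.2 ((left_le_pair _ _).trans ((left_le_pair _ _).trans h.le_code)),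
      q, lt_add_one_iff'.2 ((right_le_pair _ _).trans h.le_code), h⟩
  · rintro ⟨x, -, q, -, h⟩; exact ⟨x, q, h⟩

instance UB.instRVal :
    UB fun (N : Type u) [ArithStr N] (v : Fin n → N) => RVal (Entry (r N v)) (s N v) (t N v) := by
  refine .comp3 (P := fun N [ArithStr N] j => RVal (Entry j)) ?_ hr hs ht
  refine (inferInstance : UB fun (N : Type u) [ArithStr N] (v : Fin 3 → N) =>
    ∃ x, x < v 0 + 1 ∧ ∃ q, q < v 0 + 1 ∧ Entry (v 0) (v 1) (pair (pair (v 2) x) q)).congr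
    fun N _ _ S _ v => ?_
  constructor
  · rintro ⟨x, q, h⟩
    exact ⟨x, lt_add_one_iff'.2 ((right_le_pair _ _).trans ((left_le_pair _ _).trans h.le_code)),
      q, lt_add_one_iff'.2 ((right_le_pair _ _).trans h.le_code), h⟩
  · rintro ⟨x, -, q, -, h⟩; exact ⟨x, q, h⟩

theorem RVal.le_code {N : Type u} [ArithStr N] [PA N] {j i r : N} (h : RVal (Entry j) i r) :
    r ≤ j := by
  obtain ⟨y, q, h⟩ := h
  exact (left_le_pair _ _).trans ((left_le_pair _ _).trans h.le_code)

instance UB.instGraphVal :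
    UB fun (N : Type u) [ArithStr N] (v : Fin n → N) => GraphVal (Entry (r N v)) (s N v) (t N v) := by
  refine .comp3 (P := fun N [ArithStr N] j => GraphVal (Entry j)) ?_ hr hs ht
  refine (inferInstance : UB fun (N : Type u) [ArithStr N] (v : Fin 3 → N) =>
    (∃ i, i < v 1 + 1 ∧ ∃ s, s < v 1 + 1 ∧ ∃ r, r < v 0 + 1 ∧ v 1 = pair i s ∧
      RVal (Entry (v 0)) i r ∧ ((r = s ∧ v 2 = 0) ∨ (r ≠ s ∧ v 2 = 1))) ∨
    ((¬ ∃ i, i < v 1 + 1 ∧ ∃ s, s < v 1 + 1 ∧ v 1 = pair i s) ∧ v 2 = 1)).congr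
    fun N _ _ S _ v => ?_
  refine or_congr ⟨?_, ?_⟩ (and_congr_left fun _ => not_congr ⟨?_, ?_⟩)
  · rintro ⟨i, s, r, e, h1, h2⟩
    exact ⟨i, lt_add_one_iff'.2 (e ▸ left_le_pair _ _), s, lt_add_one_iff'.2 (e ▸ right_le_pair _ _),
      r, lt_add_one_iff'.2 h1.le_code, e, h1, h2⟩
  · rintro ⟨i, -, s, -, r, -, h⟩; exact ⟨i, s, r, h⟩
  · rintro ⟨i, s, e⟩
    exact ⟨i, lt_add_one_iff'.2 (e ▸ left_le_pair _ _), s, lt_add_one_iff'.2 (e ▸ right_le_pair _ _), e⟩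
  · rintro ⟨i, -, s, -, h⟩; exact ⟨i, s, h⟩

theorem QVal.le_code {N : Type u} [ArithStr N] [PA N] {j i q : N} (h : QVal (Entry j) i q) :
    i < j ∧ q ≤ j := by
  obtain ⟨x, h⟩ := h
  exact ⟨h.lt_code, (right_le_pair _ _).trans h.le_code⟩

instance UB.instNode (θ : Fm 0 3) :
    UB fun (N : Type u) [ArithStr N] (v : Fin n → N) => Node θ (r N v) := by
  refine .comp1 (P := fun N [ArithStr N] j => Node θ j) ?_ hr
  have h1 : UB fun (N : Type u) [ArithStr N] (w : Fin 1 → N) =>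
      Con θ (Orc (Entry (w 0))) fun i => QVal (Entry (w 0)) (pair 1 i) := by
    refine UB.con θ (O := fun N _ j => Orc (Entry j)) (E := fun N _ j i => QVal (Entry j) (pair 1 i))
      (forall_fin_three ?_ ?_ ?_) inferInstance ?_ ?_
    · exact (inferInstance : UB fun (N : Type u) [ArithStr N] (v : Fin 3 → N) =>
        QVal (Entry (v 0)) (pair 0 (v 1)) (v 2))
    · exact (inferInstance : UB fun (N : Type u) [ArithStr N] (v : Fin 3 → N) =>
        YVal (Entry (v 0)) (v 1) (v 2))
    · exact (inferInstance : UB fun (N : Type u) [ArithStr N] (v : Fin 3 → N) =>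
        GraphVal (Entry (v 0)) (v 1) (v 2))
    · intro N _ _ j X a z
      revert X
      refine forall_fin_three ?_ ?_ ?_
      · intro h
        exact (lt_add_one_iff'.2 (QVal.le_code h).2).trans_le le_self_add
      · rintro ⟨r, q, h⟩
        exact (lt_add_one_iff'.2 ((right_le_pair _ _).trans ((left_le_pair _ _).trans h.le_code))).trans_le
          le_self_add
      · rintro (⟨_, _, _, _, _, ⟨-, rfl⟩ | ⟨-, rfl⟩⟩ | ⟨_, rfl⟩)
        · positivity
        · exact lt_add_one_iff'.2 le_add_self
        · exact lt_add_one_iff'.2 le_add_self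
    · intro N _ _ j i y h
      have := QVal.le_code h
      exact ⟨((right_le_pair _ _).trans this.1.le).trans_lt (lt_add_one_iff'.2 le_rfl),
        lt_add_one_iff'.2 this.2⟩
  have h2 : UB fun (N : Type u) [ArithStr N] (w : Fin 1 → N) => ∀ y, y < w 0 + 1 →
    QVal (Entry (w 0)) (pair 1 (pair 0 0)) y → y ≠ 0 := inferInstance
  refine (inferInstance : UB fun (N : Type u) [ArithStr N] (w : Fin 1 → N) => IsSeq (w 0) ∧
    (Con θ (Orc (Entry (w 0))) fun i => QVal (Entry (w 0)) (pair 1 i)) ∧ ∀ y, y < w 0 + 1 →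
    QVal (Entry (w 0)) (pair 1 (pair 0 0)) y → y ≠ 0).congr fun N _ _ S _ w => ?_
  exact and_congr_right fun _ => and_congr_right fun _ =>
    ⟨fun h y _ => h y, fun h y e => h y (lt_add_one_iff'.2 (QVal.le_code e).2) e⟩

end

section
variable {N : Type u} [ArithStr N] [PA N] {S : Set (Set N)} [hM : Model S]

theorem UB.ar {n : ℕ} {P : ∀ (N : Type u) [ArithStr N], (Fin n → N) → Prop} (hP : UB P) :
    Ar S (P N) := by
  obtain ⟨θ, h1, h2⟩ := hP.out
  exact ⟨0, θ, ![], h1.isArith, fun i => i.elim0, fun v => h2 N S v⟩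

/-! ### Parity -/

omit hM in
theorem add_self_lt {i j : N} : i + i < j + j ↔ i < j := by
  constructor
  · intro h
    by_contra hc
    exact absurd h (not_lt.2 (add_le_add (not_lt.1 hc) (not_lt.1 hc)))
  · exact fun h => add_lt_add h h

omit hM in
theorem add_self_le {i j : N} : i + i ≤ j + j ↔ i ≤ j := by
  rw [← not_lt, add_self_lt, not_lt]

omit hM in
theorem add_self_inj {i j : N} : i + i = j + j ↔ i = j := by
  simp only [le_antisymm_iff, add_self_le]

omit hM in
theorem add_self_lt_odd {i j : N} : i + i < j + j + 1 ↔ i ≤ j := by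
  rw [lt_add_one_iff', add_self_le]

omit hM in
theorem odd_lt_add_self {i j : N} : i + i + 1 < j + j ↔ i < j := by
  constructor
  · intro h
    exact add_self_lt.1 (lt_of_le_of_lt le_self_add h)
  · intro h
    have := add_one_le_iff'.2 h
    refine lt_of_lt_of_le ?_ (add_le_add this this)
    rw [← add_one_le_iff']
    exact le_of_eq (by ring)

omit hM in
theorem odd_ne_even {i j : N} : i + i + 1 ≠ j + j := by
  intro h
  rcases lt_or_ge i j with h' | h'
  · exact (odd_lt_add_self.2 h').ne h
  · exact (add_self_lt_odd.2 h').ne h.symm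

theorem even_or_odd (S : Set (Set N)) [Model S] (n : N) : ∃ m, n = m + m ∨ n = m + m + 1 := by
  induction n using induct (S := S) with
  | ar => infer_instance
  | h0 => exact ⟨0, by simp⟩
  | hs n ih =>
    obtain ⟨m, rfl | rfl⟩ := ih
    · exact ⟨m, .inr rfl⟩
    · exact ⟨m + 1, .inl (by ring)⟩

/-! ### Terms, parameters, and orders -/

omit hM in
theorem term_inj {x y : N} : term x = term y ↔ x = y := by simp [term, pair_inj]

omit hM in
theorem param_inj {x y : N} : param x = param y ↔ x = y := by simp [param, pair_inj]

omit hM in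
theorem term_ne_param {x y : N} : term x ≠ param y := by simp [term, param, pair_inj]

omit hM in
theorem pair_mem_omega {i j : N} : pair i j ∈ omega ↔ i ≤ j := by
  constructor
  · rintro ⟨i', j', e, h⟩
    obtain ⟨rfl, rfl⟩ := pair_inj.1 e
    exact h
  · exact fun h => ⟨i, j, rfl, h⟩

omit hM in
theorem mem_fld_omega (i : N) : i ∈ fld omega := pair_mem_omega.2 le_rfl

omit hM in
theorem ordLt_omega {i j : N} : OrdLt omega i j ↔ i < j := by
  rw [OrdLt, pair_mem_omega, lt_iff_le_and_ne]

omit hM in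
theorem isLO_omega : IsLO (omega : Set N) where
  pairs := by rintro p ⟨i, j, e, -⟩; exact ⟨i, j, e⟩
  field := fun i j _ => ⟨mem_fld_omega i, mem_fld_omega j⟩
  antisymm := fun i j h h' => le_antisymm (pair_mem_omega.1 h) (pair_mem_omega.1 h')
  trans := fun i j k h h' => pair_mem_omega.2 ((pair_mem_omega.1 h).trans (pair_mem_omega.1 h'))
  total := fun i _ j _ => by simpa only [pair_mem_omega] using le_total i j

theorem omega_mem : (omega : Set N) ∈ S :=
  hM.out.setOf_mem fun p => ∃ i j, p = pair i j ∧ (i < j ∨ i = j)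

omit hM in
theorem pair_mem_restr {A P : Set N} {i j : N} : pair i j ∈ restr A P ↔ pair i j ∈ A ∧ i ∈ P ∧ j ∈ P := by
  constructor
  · rintro ⟨h, i', j', e, h'⟩
    obtain ⟨rfl, rfl⟩ := pair_inj.1 e
    exact ⟨h, h'⟩
  · exact fun ⟨h, h'⟩ => ⟨h, i, j, rfl, h'⟩

omit hM in
theorem mem_fld_restr_omega {P : Set N} {i : N} : i ∈ fld (restr omega P) ↔ i ∈ P := by
  rw [fld, Set.mem_ofPred_eq, pair_mem_restr]
  simp [pair_mem_omega]

omit hM in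
theorem ordLt_restr_omega {P : Set N} {i j : N} :
    OrdLt (restr omega P) i j ↔ i < j ∧ i ∈ P ∧ j ∈ P := by
  rw [OrdLt, pair_mem_restr, ← ordLt_omega, OrdLt]; tauto

omit hM in
theorem IsLO.restr {A : Set N} (h : IsLO A) (P : Set N) : IsLO (restr A P) where
  pairs := fun p hp => h.pairs p hp.1
  field := fun i j hij => by
    rw [pair_mem_restr] at hij
    exact ⟨pair_mem_restr.2 ⟨(h.field i j hij.1).1, hij.2.1, hij.2.1⟩,
      pair_mem_restr.2 ⟨(h.field i j hij.1).2, hij.2.2, hij.2.2⟩⟩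
  antisymm := fun i j h1 h2 => h.antisymm i j h1.1 h2.1
  trans := fun i j k h1 h2 => by
    rw [pair_mem_restr] at *
    exact ⟨h.trans i j k h1.1 h2.1, h1.2.1, h2.2.2⟩
  total := fun i hi j hj => by
    rw [fld, Set.mem_ofPred_eq, pair_mem_restr] at hi hj
    simp only [pair_mem_restr]
    have := h.total i hi.1 j hj.1
    tauto

omit hM [PA N] in
theorem IsLO.trichotomy {A : Set N} (h : IsLO A) {i j : N} (hi : i ∈ fld A) (hj : j ∈ fld A) :
    OrdLt A i j ∨ i = j ∨ OrdLt A j i := by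
  by_cases e : i = j
  · exact .inr (.inl e)
  · rcases h.total i hi j hj with h' | h'
    exacts [.inl ⟨h', e⟩, .inr (.inr ⟨h', Ne.symm e⟩)]

omit hM [PA N] in
theorem IsLO.ordLt_trans {A : Set N} (h : IsLO A) {i j k : N} (h1 : OrdLt A i j) (h2 : OrdLt A j k) :
    OrdLt A i k :=
  ⟨h.trans i j k h1.1 h2.1, fun e => by subst e; exact h1.2 (h.antisymm _ _ h1.1 h2.1)⟩

omit hM [PA N] in
theorem IsLO.not_ordLt {A : Set N} (h : IsLO A) {i j : N} (h1 : OrdLt A i j) : ¬ OrdLt A j i :=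
  fun h2 => h1.2 (h.antisymm _ _ h1.1 h2.1)

omit hM [PA N] in
/-- Increasing maps between linear orders reflect the order. -/
theorem IsIncMap.ordLt_iff {A B f : Set N} (hf : IsIncMap S A B f) (hA : IsLO A) (hB : IsLO B)
    {x x' y y' : N} (hx : x ∈ fld A) (hx' : x' ∈ fld A) (h : pair x y ∈ f) (h' : pair x' y' ∈ f) :
    OrdLt A x x' ↔ OrdLt B y y' := by
  refine ⟨fun hl => hf.increasing x x' y y' hl h h', fun hl => ?_⟩
  rcases hA.trichotomy hx hx' with h1 | rfl | h1
  · exact h1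
  · exact (hl.2 (hf.single _ _ _ h h')).elim
  · exact (hB.not_ordLt hl (hf.increasing _ _ _ _ h1 h' h)).elim

omit hM in
theorem IsIncMap.mem_fld {A B f : Set N} (hf : IsIncMap S A B f) {x y : N} (h : pair x y ∈ f) :
    x ∈ fld A ∧ y ∈ fld B := by
  obtain ⟨x', y', e, h'⟩ := hf.pairs _ h
  obtain ⟨rfl, rfl⟩ := pair_inj.1 e
  exact h'

/-! ### Change of parameters -/

omit hM in
theorem MapSeq.term_iff (S : Set (Set N)) [Model S] {f : Set N} {σ τ : N} (h : MapSeq f σ τ) {i x : N} :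
    Entry σ i (term x) ↔ Entry τ i (term x) := by
  have key : ∀ {x}, Entry σ i (term x) → Entry τ i (term x) := by
    intro x e
    rcases h.2.2.2 _ _ e with ⟨y, e1, e2⟩ | ⟨ξ, η, e1, -⟩
    · exact e1 ▸ e2
    · exact (term_ne_param e1).elim
  refine ⟨key, fun e => ?_⟩
  obtain ⟨l, hl⟩ := e.isLen
  obtain ⟨z, hz⟩ := exists_entry S ((h.2.2.1 l).2 hl) (e.lt hl)
  rcases h.2.2.2 _ _ hz with ⟨y, e1, e2⟩ | ⟨ξ, η, e1, -, e2⟩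
  · rwa [e.eq e2, ← e1]
  · exact (term_ne_param (e.eq e2)).elim

omit hM in
theorem MapSeq.param {f : Set N} {σ τ : N} (h : MapSeq f σ τ) {i ξ : N} (e : Entry σ i (param ξ)) :
    ∃ η, pair ξ η ∈ f ∧ Entry τ i (param η) := by
  rcases h.2.2.2 _ _ e with ⟨y, e1, -⟩ | ⟨ξ', η, e1, e2⟩
  · exact (term_ne_param e1.symm).elim
  · obtain rfl := param_inj.1 e1
    exact ⟨η, e2⟩

omit hM in
theorem MapSeq.param' (S : Set (Set N)) [Model S] {f : Set N} {σ τ : N} (h : MapSeq f σ τ) {i η : N}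
    (e : Entry τ i (SOA.param η)) : ∃ ξ, pair ξ η ∈ f ∧ Entry σ i (SOA.param ξ) := by
  obtain ⟨l, hl⟩ := e.isLen
  obtain ⟨z, hz⟩ := exists_entry S ((h.2.2.1 l).2 hl) (e.lt hl)
  rcases h.2.2.2 _ _ hz with ⟨y, e1, e2⟩ | ⟨ξ, η', e1, e2, e3⟩
  · exact (term_ne_param (e2.eq e)).elim
  · obtain rfl := param_inj.1 (e.eq e3)
    exact ⟨ξ, e2, e1 ▸ hz⟩

/-- All entries of `σ` are terms or parameters. -/
def IsWord (σ : N) : Prop := ∀ i z, Entry σ i z → (∃ x, z = term x) ∨ ∃ ξ, z = param ξ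

theorem exists_mapSeq {f : Set N} (hf : f ∈ S) {σ : N} (hσ : IsSeq σ) (hw : IsWord σ)
    (ht : ∀ ξ ∈ Occ σ, ∃ η, pair ξ η ∈ f) : ∃ τ, MapSeq f σ τ := by
  have : MemS S f := ⟨hf⟩
  obtain ⟨l, hl⟩ := hσ.1
  obtain ⟨τ, h1, h2, h3⟩ := exists_seq_of_rel (S := S) (P := fun i z =>
    (∃ x, Entry σ i (term x) ∧ z = term x) ∨
      ∃ ξ η, Entry σ i (param ξ) ∧ pair ξ η ∈ f ∧ z = param η) inferInstance l (fun i hi => by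
        obtain ⟨z, hz⟩ := exists_entry S hl hi
        rcases hw i z hz with ⟨x, rfl⟩ | ⟨ξ, rfl⟩
        · exact ⟨_, .inl ⟨x, hz, rfl⟩⟩
        · obtain ⟨η, hη⟩ := ht ξ ⟨i, hz⟩
          exact ⟨_, .inr ⟨ξ, η, hz, hη, rfl⟩⟩)
  refine ⟨τ, hσ, h1, fun m => ⟨fun h => h.eq hl ▸ h2, fun h => h.eq h2 ▸ hl⟩, fun i z hz => ?_⟩
  obtain ⟨y, hy, ⟨x, e, rfl⟩ | ⟨ξ, η, e, e1, rfl⟩⟩ := h3 i (hz.lt hl)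
  · exact .inl ⟨x, hz.eq e, hy⟩
  · exact .inr ⟨ξ, η, hz.eq e, e1, hy⟩

/-- The map is cut down to the parameters of `σ` because the instantiation asks for maps whose
domain is exactly the set of occurring parameters. -/
theorem MapSeq.of_isPrefix (S : Set (Set N)) [Model S] {f : Set N} {σ σ' τ τ' l : N} (h : MapSeq f σ' τ') (hσ : IsPrefix σ σ')
    (hτ : IsPrefix τ τ') (hl : IsLen σ l) (hl' : IsLen τ l) :
    MapSeq {p | p ∈ f ∧ ∃ ξ η, p = pair ξ η ∧ ξ ∈ Occ σ} σ τ := by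
  refine ⟨hσ.1, hτ.1, fun m => ⟨fun h => h.eq hl ▸ hl', fun h => h.eq hl' ▸ hl⟩, fun i z e => ?_⟩
  obtain ⟨y, hy⟩ := exists_entry S hl' (e.lt hl)
  rcases h.2.2.2 _ _ (hσ.2.2 _ _ e) with ⟨x, rfl, e2⟩ | ⟨ξ, η, rfl, e2, e3⟩
  · left; exact ⟨x, rfl, by rwa [e2.eq (hτ.2.2 _ _ hy)]⟩
  · right; exact ⟨ξ, η, rfl, ⟨e2, ξ, η, rfl, i, e⟩, by rwa [e3.eq (hτ.2.2 _ _ hy)]⟩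

theorem occ_mem (σ : N) : Occ σ ∈ S := hM.out.setOf_mem fun ξ => ∃ i, Entry σ i (param ξ)

end

section
variable {N : Type u} [ArithStr N] [PA N] {S : Set (Set N)} [hM : Model S]

instance {n : ℕ} {f g : (Fin n → N) → N} [ArF S f] [ArF S g] {A : Set N} [MemS S A] :
    Ar S fun v => OrdLt A (f v) (g v) := by unfold OrdLt; infer_instance

omit hM in
theorem IsSnoc.entry {c x c' n i y : N} (h : IsSnoc c x c') (hl : IsLen c n) (S : Set (Set N))
    [Model S] (e : Entry c' i y) : Entry c i y ∨ (i = n ∧ y = x) := by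
  obtain ⟨h1, l, h2, h3, h4⟩ := h
  obtain rfl := h2.eq hl
  rcases (lt_add_one_iff'.1 (e.lt h3)).lt_or_eq with hi | rfl
  · obtain ⟨z, hz⟩ := exists_entry S h2 hi
    exact .inl (by rwa [e.eq (h1.2.2 _ _ hz)])
  · exact .inr ⟨rfl, e.eq h4⟩

/-- The parameters of a finite sequence can be enumerated in increasing order. -/
theorem exists_rank {α : Set N} (hα : α ∈ S) (hLO : IsLO α) (τ l : N) :
    ∃ c, IsSeq c ∧ IsLen c l ∧
      ∀ i j ξ η x y, Entry τ i (param ξ) → Entry τ j (param η) → Entry c i x → Entry c j y →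
        (ξ = η → x = y) ∧ (OrdLt α ξ η → x < y) := by
  have : MemS S α := ⟨hα⟩
  suffices ∀ n, n ≤ l → ∃ c, IsSeq c ∧ IsLen c n ∧
      ∀ i j ξ η x y, Entry τ i (param ξ) → Entry τ j (param η) → Entry c i x → Entry c j y →
        (ξ = η → x = y) ∧ (OrdLt α ξ η → x < y) from this l le_rfl
  intro n
  induction n using induct (S := S) with
  | ar => infer_instance
  | h0 =>
    intro _
    obtain ⟨c, h1, h2, -⟩ := exists_seq (S := S) (F := fun _ => 0) inferInstance 0
    exact ⟨c, h1, h2, fun i j ξ η x y _ _ e _ => (not_lt_zero (e.lt h2)).elim⟩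
  | hs n ih =>
    intro hn
    have hn := add_one_le_iff'.1 hn
    obtain ⟨c, hc, hcl, h⟩ := ih hn.le
    by_cases hC : ∃ ξ, Entry τ n (param ξ) ∧ ∀ i < n, ¬ Entry τ i (param ξ)
    · obtain ⟨ξ, hξ, hnew⟩ := hC
      -- To make room for a new parameter `ξ`, each old rank `x` becomes `2x + 1`. The rank of `ξ`
      -- is the least `v` above the new ranks of the parameters below `ξ`. A parameter above `ξ` of
      -- old rank `y` has `v ≤ 2y < 2y + 1`, since `2y` already exceeds those ranks.
      obtain ⟨v, hv, hmin⟩ := exists_least (S := S) (P := fun v => ∀ i ξ' x, Entry τ i (param ξ') →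
        OrdLt α ξ' ξ → Entry c i x → x + x + 1 < v) inferInstance ⟨c + c + 1 + 1,
          fun i ξ' x _ _ e => lt_add_one_iff'.2
            (add_le_add (add_le_add e.le_code e.le_code) le_rfl)⟩
      have hv' : ∀ j η y, Entry τ j (param η) → OrdLt α ξ η → Entry c j y → v < y + y + 1 := by
        intro j η y e1 h1 e2
        rw [lt_add_one_iff', ← not_lt]
        intro hlt
        exact hmin _ hlt fun i ξ' x e3 h3 e4 => odd_lt_add_self.2
          ((h i j ξ' η x y e3 e1 e4 e2).2 (hLO.ordLt_trans h3 h1))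
      obtain ⟨c', h1, h2, h3⟩ := exists_seq_of_rel (S := S)
        (P := fun i z => (∃ x, Entry c i x ∧ z = x + x + 1) ∨ (i = n ∧ z = v)) inferInstance (n + 1)
        (fun i hi => by
          rcases (lt_add_one_iff'.1 hi).lt_or_eq with hi | rfl
          · obtain ⟨x, hx⟩ := exists_entry S hcl hi
            exact ⟨_, .inl ⟨x, hx, rfl⟩⟩
          · exact ⟨v, .inr ⟨rfl, rfl⟩⟩)
      have h4 : ∀ i z, Entry c' i z → (∃ x, Entry c i x ∧ z = x + x + 1) ∨ (i = n ∧ z = v) := by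
        intro i z e
        obtain ⟨z', e', h'⟩ := h3 i (e.lt h2)
        rwa [e.eq e']
      refine ⟨c', h1, h2, fun i j ξ₁ ξ₂ x y e₁ e₂ e₃ e₄ => ?_⟩
      rcases h4 _ _ e₃ with ⟨x', ex, rfl⟩ | ⟨rfl, rfl⟩ <;>
        rcases h4 _ _ e₄ with ⟨y', ey, rfl⟩ | ⟨rfl, rfl⟩
      · have := h i j ξ₁ ξ₂ x' y' e₁ e₂ ex ey
        exact ⟨fun e => by rw [this.1 e], fun e => by
          simpa only [add_lt_add_iff_right] using add_self_lt.2 (this.2 e)⟩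
      · obtain rfl := param_inj.1 (hξ.eq e₂)
        exact ⟨fun e => (hnew i (ex.lt hcl) (e ▸ e₁)).elim, fun e => hv _ _ _ e₁ e ex⟩
      · obtain rfl := param_inj.1 (hξ.eq e₁)
        exact ⟨fun e => (hnew j (ey.lt hcl) (e ▸ e₂)).elim, fun e => hv' _ _ _ e₂ e ey⟩
      · obtain rfl := param_inj.1 (e₁.eq e₂)
        exact ⟨fun _ => rfl, fun e => (e.2 rfl).elim⟩
    -- A repeated parameter takes the rank of an earlier occurrence. If the entry is not a
    -- parameter, the rank plays no role and is `0`.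
    · have hx : ∃ x, ∀ ξ, Entry τ n (param ξ) → ∃ i, Entry τ i (param ξ) ∧ Entry c i x := by
        push Not at hC
        by_cases hp : ∃ ξ, Entry τ n (param ξ)
        · obtain ⟨ξ, hξ⟩ := hp
          obtain ⟨i, hi, hi'⟩ := hC ξ hξ
          obtain ⟨x, hx⟩ := exists_entry S hcl hi
          exact ⟨x, fun ξ' hξ' => ⟨i, by rwa [← hξ.eq hξ'], hx⟩⟩
        · exact ⟨0, fun ξ hξ => (hp ⟨ξ, hξ⟩).elim⟩
      obtain ⟨x₀, hx₀⟩ := hx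
      obtain ⟨c', hc'⟩ := exists_snoc S hc x₀
      have key : ∀ i ξ x, Entry τ i (param ξ) → Entry c' i x →
          ∃ i', Entry τ i' (param ξ) ∧ Entry c i' x := by
        intro i ξ x e e'
        rcases hc'.entry hcl S e' with h' | ⟨rfl, rfl⟩
        · exact ⟨i, e, h'⟩
        · exact hx₀ ξ e
      obtain ⟨l', hl', hl'', -⟩ := hc'.2
      obtain rfl := hl'.eq hcl
      refine ⟨c', hc'.1.2.1, hl'', fun i j ξ₁ ξ₂ x y e₁ e₂ e₃ e₄ => ?_⟩
      obtain ⟨i', e₁', e₃'⟩ := key _ _ _ e₁ e₃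
      obtain ⟨j', e₂', e₄'⟩ := key _ _ _ e₂ e₄
      exact h i' j' ξ₁ ξ₂ x y e₁' e₂' e₃' e₄'

/-- Every finite sequence over a linear order arises from one over `ω` by an increasing change of
parameters. -/
theorem exists_collapse {α : Set N} (hα : α ∈ S) (hLO : IsLO α) {τ : N} (hτ : IsSeq τ)
    (hw : IsWord τ) (hw' : ∀ i ξ, Entry τ i (param ξ) → ξ ∈ fld α) :
    ∃ σ f, IsIncMap S (restr omega (Occ σ)) α f ∧ MapSeq f σ τ := by
  obtain ⟨l, hl⟩ := hτ.1
  obtain ⟨c, hc, hcl, h⟩ := exists_rank hα hLO τ l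
  obtain ⟨σ, h1, h2, h3⟩ := exists_seq_of_rel (S := S) (P := fun i z =>
    (∃ x, Entry τ i (term x) ∧ z = term x) ∨
      ∃ ξ y, Entry τ i (param ξ) ∧ Entry c i y ∧ z = param y) inferInstance l (fun i hi => by
        obtain ⟨z, hz⟩ := exists_entry S hl hi
        rcases hw i z hz with ⟨x, rfl⟩ | ⟨ξ, rfl⟩
        · exact ⟨_, .inl ⟨x, hz, rfl⟩⟩
        · obtain ⟨y, hy⟩ := exists_entry S hcl hi
          exact ⟨_, .inr ⟨ξ, y, hz, hy, rfl⟩⟩)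
  have h4 : ∀ i z, Entry σ i z → (∃ x, Entry τ i (term x) ∧ z = term x) ∨
      ∃ ξ y, Entry τ i (param ξ) ∧ Entry c i y ∧ z = param y := by
    intro i z e
    obtain ⟨z', e', h'⟩ := h3 i (e.lt h2)
    rwa [e.eq e']
  have h5 : ∀ i ξ y, Entry τ i (param ξ) → Entry c i y → Entry σ i (param y) := by
    intro i ξ y e e'
    obtain ⟨z, hz, ⟨x, e1, -⟩ | ⟨ξ', y', e1, e2, rfl⟩⟩ := h3 i (e.lt hl)
    · exact (term_ne_param (e1.eq e)).elim
    · rwa [e'.eq e2]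
  have hmem : ∀ y ξ, pair y ξ ∈ {p | ∃ i ξ y, Entry τ i (param ξ) ∧ Entry c i y ∧ p = pair y ξ} ↔
      ∃ i, Entry τ i (param ξ) ∧ Entry c i y := by
    intro y ξ
    constructor
    · rintro ⟨i, ξ', y', e1, e2, e⟩
      obtain ⟨rfl, rfl⟩ := pair_inj.1 e
      exact ⟨i, e1, e2⟩
    · rintro ⟨i, e1, e2⟩; exact ⟨i, ξ, y, e1, e2, rfl⟩
  -- The change of parameters is the inverse of the ranking.
  refine ⟨σ, {p | ∃ i ξ y, Entry τ i (param ξ) ∧ Entry c i y ∧ p = pair y ξ},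
    ⟨hM.out.setOf_mem _, ?_, ?_, ?_, ?_⟩, h1, hτ,
    fun m => ⟨fun h => h.eq h2 ▸ hl, fun h => h.eq hl ▸ h2⟩, fun i z e => ?_⟩
  · rintro p ⟨i, ξ, y, e1, e2, rfl⟩
    exact ⟨y, ξ, rfl, mem_fld_restr_omega.2 ⟨i, h5 i ξ y e1 e2⟩, hw' i ξ e1⟩
  · intro y hy
    obtain ⟨i, hi⟩ := mem_fld_restr_omega.1 hy
    rcases h4 _ _ hi with ⟨x, -, e⟩ | ⟨ξ, y', e1, e2, e⟩
    · exact (term_ne_param e.symm).elim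
    · obtain rfl := param_inj.1 e
      exact ⟨ξ, (hmem _ _).2 ⟨i, e1, e2⟩⟩
  · intro y ξ η h' h''
    obtain ⟨i, e1, e2⟩ := (hmem _ _).1 h'
    obtain ⟨j, e3, e4⟩ := (hmem _ _).1 h''
    rcases hLO.trichotomy (hw' _ _ e1) (hw' _ _ e3) with hl | hl | hl
    · exact (lt_irrefl _ ((h i j ξ η y y e1 e3 e2 e4).2 hl)).elim
    · exact hl
    · exact (lt_irrefl _ ((h j i η ξ y y e3 e1 e4 e2).2 hl)).elim
  · intro x y ξ η hxy h' h''
    have hxy := (ordLt_restr_omega.1 hxy).1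
    obtain ⟨i, e1, e2⟩ := (hmem _ _).1 h'
    obtain ⟨j, e3, e4⟩ := (hmem _ _).1 h''
    rcases hLO.trichotomy (hw' _ _ e1) (hw' _ _ e3) with hl | hl | hl
    · exact hl
    · exact (hxy.ne ((h i j ξ η x y e1 e3 e2 e4).1 hl)).elim
    · exact (hxy.not_gt ((h j i η ξ y x e3 e1 e4 e2).2 hl)).elim
  · rcases h4 i z e with ⟨x, e1, rfl⟩ | ⟨ξ, y, e1, e2, rfl⟩
    · exact .inl ⟨x, rfl, e1⟩
    · exact .inr ⟨y, ξ, rfl, (hmem _ _).2 ⟨i, e1, e2⟩, e1⟩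

/-! ### The prequasidendroid of attempts to build an increasing map -/

/-- The data of the attempt `j` agree with those in `σ`. -/
def Based {N : Type u} [ArithStr N] (j σ : N) : Prop :=
  ∀ i z, Entry j i z → ∃ x q, z = pair x q ∧ Entry σ (i + i) (term (x + 1))

/-- `σ` consists of `m` pairs of a term with data `pair r y` and a parameter, and of a final term `0`.
The assignment of the parameters to the numbers below `m` decreases, in the sense of `L`, along the
tree of the attempts that are based on these data. -/
def InD {N : Type u} [ArithStr N] (θ : Fm 0 3) (L : N → N → Prop) (σ : N) : Prop :=
  -- Every number below `m` gets a parameter, so terms stand at even and parameters at odd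
  -- positions; only parameters of nodes that are based on `σ` are constrained. The term `0` is an
  -- end mark, which is why the data are stored as successors.
  IsSeq σ ∧ ∃ m, IsLen σ (m + m + 1) ∧ Entry σ (m + m) (term 0) ∧
    (∀ i, i < m → (∃ r y, Entry σ (i + i) (term (pair r y + 1))) ∧
      ∃ ξ, Entry σ (i + i + 1) (param ξ)) ∧
    ∀ j, j < m → ∀ k, k < m → Node θ j → Based j σ → IsPrefix k j → k ≠ j →
      ∀ ξ η, Entry σ (j + j + 1) (param ξ) → Entry σ (k + k + 1) (param η) → L ξ η

/-- The relation is left open in `InD` so that one condition describes `D`, its mutilations and its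
instantiations. -/
def DSet (N : Type u) [ArithStr N] (θ : Fm 0 3) : Set N := {σ | InD θ (fun a b => a < b) σ}

/-- The pairs of a sequence `σ` and the sequence of the numbers `r` in its data. -/
def RSet (N : Type u) [ArithStr N] : Set N :=
  -- At odd length the last term is ignored, since it may be the end mark.
  {p | ∃ σ s, p = pair σ s ∧ IsSeq s ∧ ∃ m, IsLen s m ∧ (IsLen σ (m + m) ∨ IsLen σ (m + m + 1)) ∧
    ∀ i, i < m → ∃ x y, Entry s i x ∧ Entry σ (i + i) (term (pair x y + 1))}

omit hM in
theorem pair_mem_RSet {σ s : N} : pair σ s ∈ RSet N ↔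
    IsSeq s ∧ ∃ m, IsLen s m ∧ (IsLen σ (m + m) ∨ IsLen σ (m + m + 1)) ∧
      ∀ i, i < m → ∃ x y, Entry s i x ∧ Entry σ (i + i) (term (pair x y + 1)) := by
  constructor
  · rintro ⟨σ', s', e, h⟩
    obtain ⟨rfl, rfl⟩ := pair_inj.1 e
    exact h
  · exact fun h => ⟨σ, s, rfl, h⟩

omit hM in
theorem InD.isWord {θ : Fm 0 3} {L : N → N → Prop} {σ : N} (h : InD θ L σ) (S : Set (Set N))
    [Model S] : (∀ i z, Entry σ (i + i) z → ∃ x, z = term x) ∧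
      ∀ i z, Entry σ (i + i + 1) z → ∃ ξ, z = param ξ := by
  obtain ⟨hs, m, hl, h0, h1, -⟩ := h
  refine ⟨fun i z e => ?_, fun i z e => ?_⟩
  · rcases (add_self_lt_odd.1 (e.lt hl)).lt_or_eq with hi | rfl
    · obtain ⟨⟨r, y, e'⟩, -⟩ := h1 i hi
      exact ⟨_, e.eq e'⟩
    · exact ⟨_, e.eq h0⟩
  · have hi : i < m := add_self_lt.1 (add_lt_add_iff_right 1 |>.1 (e.lt hl))
    obtain ⟨-, ξ, e'⟩ := h1 i hi
    exact ⟨_, e.eq e'⟩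

omit hM in
theorem InD.word {θ : Fm 0 3} {L : N → N → Prop} {σ : N} (h : InD θ L σ) (S : Set (Set N))
    [Model S] : IsWord σ := by
  intro i z e
  obtain ⟨m, rfl | rfl⟩ := even_or_odd S i
  · exact .inl ((h.isWord S).1 _ _ e)
  · exact .inr ((h.isWord S).2 _ _ e)

omit hM in
theorem Based.map (S : Set (Set N)) [Model S] {f : Set N} {j σ τ : N} (h : MapSeq f σ τ) :
    Based j σ ↔ Based j τ := by
  simp only [Based, h.term_iff S]

omit hM in
/-- Changes of parameters that preserve and reflect the order preserve membership. -/
theorem InD.map (S : Set (Set N)) [Model S] {θ : Fm 0 3} {L L' : N → N → Prop} {f : Set N} {σ τ : N}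
    (h : MapSeq f σ τ) (hL : ∀ ξ ξ' η η', ξ ∈ Occ σ → ξ' ∈ Occ σ → pair ξ η ∈ f → pair ξ' η' ∈ f →
      (L ξ ξ' ↔ L' η η')) : InD θ L σ ↔ InD θ L' τ := by
  have h1 := fun i x => h.term_iff S (i := i) (x := x)
  have h2 : ∀ i, (∃ ξ, Entry σ i (param ξ)) ↔ ∃ η, Entry τ i (param η) := fun i =>
    ⟨fun ⟨ξ, e⟩ => let ⟨η, e'⟩ := h.param e; ⟨η, e'.2⟩,
      fun ⟨ξ, e⟩ => let ⟨η, e'⟩ := h.param' S e; ⟨η, e'.2⟩⟩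
  unfold InD
  simp only [h1, h2, h.2.2.1, Based.map S h, h.1, h.2.1, true_and]
  refine exists_congr fun m => and_congr_right fun _ => and_congr_right fun _ =>
    and_congr_right fun _ => ?_
  constructor
  · intro H j hj k hk hn hb hp hne η η' e e'
    obtain ⟨ξ, hξ, e1⟩ := h.param' S e
    obtain ⟨ξ', hξ', e1'⟩ := h.param' S e'
    exact (hL _ _ _ _ ⟨_, e1⟩ ⟨_, e1'⟩ hξ hξ').1 (H j hj k hk hn hb hp hne _ _ e1 e1')
  · intro H j hj k hk hn hb hp hne ξ ξ' e e'
    obtain ⟨η, hη, e1⟩ := h.param e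
    obtain ⟨η', hη', e1'⟩ := h.param e'
    exact (hL _ _ _ _ ⟨_, e⟩ ⟨_, e'⟩ hη hη').2 (H j hj k hk hn hb hp hne _ _ e1 e1')

end

/-! ### Bounded definability of the prequasidendroid and of the extraction scheme -/

section
variable {n : ℕ} {r s : ∀ (N : Type u) [ArithStr N], (Fin n → N) → N} [hr : UT r] [hs : UT s]

instance UB.instBased :
    UB fun (N : Type u) [ArithStr N] (v : Fin n → N) => Based (r N v) (s N v) := by
  refine .comp2 (P := fun N [ArithStr N] a b => Based a b) ?_ hr hs
  refine (inferInstance : UB fun (N : Type u) [ArithStr N] (v : Fin 2 → N) =>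
    ∀ i, i < v 0 → ∀ z, z < v 0 + 1 → Entry (v 0) i z → ∃ x, x < z + 1 ∧ ∃ q, q < z + 1 ∧
      z = pair x q ∧ Entry (v 1) (i + i) (term (x + 1))).congr fun N _ _ S _ v => ?_
  have : ∀ i z, (∃ x q, z = pair x q ∧ Entry (v 1) (i + i) (term (x + 1))) ↔
      ∃ x, x < z + 1 ∧ ∃ q, q < z + 1 ∧ z = pair x q ∧ Entry (v 1) (i + i) (term (x + 1)) := by
    intro i z
    constructor
    · rintro ⟨x, q, rfl, h⟩
      exact ⟨x, lt_add_one_iff'.2 (left_le_pair _ _), q, lt_add_one_iff'.2 (right_le_pair _ _), rfl, h⟩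
    · rintro ⟨x, -, q, -, h⟩; exact ⟨x, q, h⟩
  simp only [Based, this]
  exact ⟨fun h i _ z _ => h i z, fun h i z e => h i e.lt_code z (lt_add_one_iff'.2 e.le_code) e⟩

/-- The condition on the parameters in `InD`. -/
def IsDecr {N : Type u} [ArithStr N] (θ : Fm 0 3) (σ m : N) : Prop :=
  ∀ j, j < m → ∀ k, k < m → Node θ j → Based j σ → IsPrefix k j → k ≠ j →
    ∀ ξ η, Entry σ (j + j + 1) (param ξ) → Entry σ (k + k + 1) (param η) → ξ < η

theorem Entry.param_lt {N : Type u} [ArithStr N] [PA N] {σ i ξ : N} (h : Entry σ i (param ξ)) :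
    ξ < σ + 1 := lt_add_one_iff'.2 ((right_le_pair _ _).trans h.le_code)

theorem Entry.term_lt {N : Type u} [ArithStr N] [PA N] {σ i ξ : N} (h : Entry σ i (term ξ)) :
    ξ < σ + 1 := lt_add_one_iff'.2 ((right_le_pair _ _).trans h.le_code)

instance UB.instIsDecr (θ : Fm 0 3) :
    UB fun (N : Type u) [ArithStr N] (v : Fin n → N) => IsDecr θ (r N v) (s N v) := by
  refine .comp2 (P := fun N [ArithStr N] a b => IsDecr θ a b) ?_ hr hs
  refine (inferInstance : UB fun (N : Type u) [ArithStr N] (v : Fin 2 → N) =>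
    ∀ j, j < v 1 → ∀ k, k < v 1 → Node θ j → Based j (v 0) → IsPrefix k j → k ≠ j →
    ∀ ξ, ξ < v 0 + 1 → ∀ η, η < v 0 + 1 → Entry (v 0) (j + j + 1) (param ξ) →
      Entry (v 0) (k + k + 1) (param η) → ξ < η).congr fun N _ _ S _ v => ?_
  exact ⟨fun h j hj k hk h1 h2 h3 h4 ξ _ η _ => h j hj k hk h1 h2 h3 h4 ξ η,
    fun h j hj k hk h1 h2 h3 h4 ξ η e e' => h j hj k hk h1 h2 h3 h4 ξ e.param_lt η e'.param_lt e e'⟩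

instance UB.instMemDSet (θ : Fm 0 3) :
    UB fun (N : Type u) [ArithStr N] (v : Fin n → N) => r N v ∈ DSet N θ := by
  refine .comp1 (P := fun N [ArithStr N] a => a ∈ DSet N θ) ?_ hr
  refine (inferInstance : UB fun (N : Type u) [ArithStr N] (v : Fin 1 → N) => IsSeq (v 0) ∧
    ∃ m, m < v 0 + 1 ∧ IsLen (v 0) (m + m + 1) ∧ Entry (v 0) (m + m) (term 0) ∧
    (∀ i, i < m → (∃ r, r < v 0 + 1 ∧ ∃ y, y < v 0 + 1 ∧ Entry (v 0) (i + i) (term (pair r y + 1))) ∧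
      ∃ ξ, ξ < v 0 + 1 ∧ Entry (v 0) (i + i + 1) (param ξ)) ∧ IsDecr θ (v 0) m).congr
    fun N _ _ S _ v => ?_
  refine and_congr_right fun _ => ?_
  constructor
  · rintro ⟨m, h1, h2, h3, h4⟩
    refine ⟨m, lt_add_one_iff'.2 ((le_self_add.trans le_self_add).trans h1.le), h1, h2,
      fun i hi => ?_, h4⟩
    obtain ⟨⟨r, y, e⟩, ξ, e'⟩ := h3 i hi
    have h := (le_self_add (b := 1)).trans_lt e.term_lt
    exact ⟨⟨r, (left_le_pair _ _).trans_lt h, y, (right_le_pair _ _).trans_lt h, e⟩,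
      ξ, e'.param_lt, e'⟩
  · rintro ⟨m, -, h1, h2, h3, h4⟩
    refine ⟨m, h1, h2, fun i hi => ?_, h4⟩
    obtain ⟨⟨r, -, y, -, e⟩, ξ, -, e'⟩ := h3 i hi
    exact ⟨⟨r, y, e⟩, ξ, e'⟩

instance UB.instMemRSet :
    UB fun (N : Type u) [ArithStr N] (v : Fin n → N) => r N v ∈ RSet N := by
  refine .comp1 (P := fun N [ArithStr N] a => a ∈ RSet N) ?_ hr
  refine (inferInstance : UB fun (N : Type u) [ArithStr N] (v : Fin 1 → N) =>
    ∃ σ, σ < v 0 + 1 ∧ ∃ s, s < v 0 + 1 ∧ v 0 = pair σ s ∧ IsSeq s ∧ ∃ m, m < s + 1 ∧ IsLen s m ∧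
    (IsLen σ (m + m) ∨ IsLen σ (m + m + 1)) ∧ ∀ i, i < m → ∃ x, x < σ + 1 ∧ ∃ y, y < σ + 1 ∧
      Entry s i x ∧ Entry σ (i + i) (term (pair x y + 1))).congr fun N _ _ S _ v => ?_
  constructor
  · rintro ⟨σ, s, e, h1, m, h2, h3, h4⟩
    refine ⟨σ, lt_add_one_iff'.2 (e ▸ left_le_pair _ _), s, lt_add_one_iff'.2 (e ▸ right_le_pair _ _),
      e, h1, m, lt_add_one_iff'.2 h2.le, h2, h3, fun i hi => ?_⟩
    obtain ⟨x, y, e1, e2⟩ := h4 i hi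
    have h := (le_self_add (b := 1)).trans_lt e2.term_lt
    exact ⟨x, (left_le_pair _ _).trans_lt h, y, (right_le_pair _ _).trans_lt h, e1, e2⟩
  · rintro ⟨σ, -, s, -, e, h1, m, -, h2, h3, h4⟩
    refine ⟨σ, s, e, h1, m, h2, h3, fun i hi => ?_⟩
    obtain ⟨x, -, y, -, e1, e2⟩ := h4 i hi
    exact ⟨x, y, e1, e2⟩

instance UB.instMemOmega :
    UB fun (N : Type u) [ArithStr N] (v : Fin n → N) => r N v ∈ (omega : Set N) := by
  refine .comp1 (P := fun N [ArithStr N] a => a ∈ (omega : Set N)) ?_ hr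
  refine (inferInstance : UB fun (N : Type u) [ArithStr N] (v : Fin 1 → N) =>
    ∃ i, i < v 0 + 1 ∧ ∃ j, j < v 0 + 1 ∧ v 0 = pair i j ∧ (i < j ∨ i = j)).congr
    fun N _ _ S _ v => ?_
  constructor
  · rintro ⟨i, j, e, h⟩
    exact ⟨i, lt_add_one_iff'.2 (e ▸ left_le_pair _ _), j, lt_add_one_iff'.2 (e ▸ right_le_pair _ _),
      e, h⟩
  · rintro ⟨i, -, j, -, h⟩; exact ⟨i, j, h⟩

end

/-- A set with a uniform bounded definition is `Δ⁰₁`. -/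
theorem UB.exists_delta {P : ∀ (N : Type u) [ArithStr N], N → Prop}
    (hP : UB fun (N : Type u) [ArithStr N] (v : Fin 1 → N) => P N (v 0)) :
    ∃ d : Delta01, ∀ (N : Type u) [ArithStr N] [PA N] (S : Set (Set N)) [Model S],
      d.Valid S ∧ d.set S = {a | P N a} := by
  obtain ⟨θ, h1, h2⟩ := hP.out
  -- The `Σ⁰₁`- and the `Π⁰₁`-formula arise from the same bounded formula by a vacuous quantifier;
  -- the substitution of `.var 1` skips the quantified variable `b`.
  have h3 : ∀ (N : Type u) [ArithStr N] [PA N] (S : Set (Set N)) [Model S] (a b : N),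
      (θ.sub (fun _ => (.var 1 : Tm 2)) id).Sat S (Matrix.vecCons b ![a]) ![] ↔ P N a := by
    intro N _ _ S _ a b
    rw [Fm.sat_sub]
    refine Iff.trans ?_ (h2 N S ![a])
    simp only [Tm.val]
    rw [show (fun i => (![] : Fin 0 → Set N) (id i)) = ![] from funext fun i => i.elim0,
      show (fun _ : Fin 1 => (Matrix.vecCons b ![a] : Fin 2 → N) 1) = ![a] from
        funext fun i => by rw [Subsingleton.elim i 0]; rfl]
  refine ⟨⟨_, _, ⟨_, h1.sub (fun _ => .var 1) id, rfl⟩, ⟨_, h1.sub (fun _ => .var 1) id, rfl⟩⟩,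
    fun N _ _ S _ => ⟨fun a => ?_, ?_⟩⟩
  · simp only [Fm.exN, Fm.neg, Fm.Sat, h3]
    exact ⟨fun h _ => by_contra fun h' => h fun _ => h', fun h h' => h' 0 (h 0)⟩
  · ext a
    simp only [Delta01.set, Fm.exN, Fm.neg, Fm.Sat, Set.mem_ofPred_eq, h3]
    exact ⟨fun h => by_contra fun h' => h fun _ => h', fun h h' => h' 0 h⟩

section
variable {N : Type u} [ArithStr N] [PA N] {S : Set (Set N)} [hM : Model S]

theorem DSet_mem (θ : Fm 0 3) : DSet N θ ∈ S := by
  have := (inferInstance : UB fun (N : Type u) [ArithStr N] (v : Fin 1 → N) => v 0 ∈ DSet N θ).ar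
    (S := S)
  exact hM.out.setOf_mem fun a => a ∈ DSet N θ

theorem RSet_mem : RSet N ∈ S := by
  have := (inferInstance : UB fun (N : Type u) [ArithStr N] (v : Fin 1 → N) => v 0 ∈ RSet N).ar
    (S := S)
  exact hM.out.setOf_mem fun a => a ∈ RSet N

instance Ar.instNode {n : ℕ} (θ : Fm 0 3) {f : (Fin n → N) → N} [hf : ArF S f] :
    Ar S fun v => Node θ (f v) :=
  .comp1 (P := Node θ) (UB.ar (inferInstance : UB fun (N : Type u) [ArithStr N] (v : Fin 1 → N) =>
    Node θ (v 0))) hf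

theorem tree_mem (θ : Fm 0 3) {b : Set N} (hb : b ∈ S) : Tree θ b ∈ S := by
  have : MemS S b := ⟨hb⟩
  exact hM.out.setOf_mem fun j => Node θ j ∧ ∀ i z, Entry j i z → ∃ x q, z = pair x q ∧ pair i x ∈ b

/-! ### The prequasidendroid -/

/-- No element continues another one because the end mark `0` differs from the successors that occur
as data. Terms and parameters are separated by the parity of their positions. Homogeneity holds
because only the order of the parameters is used. -/
theorem isPrequasidendroid (θ : Fm 0 3) : IsPrequasidendroid S omega (DSet N θ) where
  memX := omega_mem
  memD := DSet_mem θ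
  linearOrder := isLO_omega
  preQD := {
    isSeqOver := fun σ hσ => ⟨hσ.1, fun i z e => by
      rcases InD.word hσ S i z e with ⟨x, rfl⟩ | ⟨x, rfl⟩
      · exact .inl ⟨x, mem_fld_omega x, rfl⟩
      · exact .inr ⟨x, mem_fld_omega x, rfl⟩⟩
    antichain := by
      rintro σ ⟨hσ, m, h1, h2, -⟩ τ ⟨hτ, m', h1', -, h3', -⟩ hp
      have hle : m ≤ m' := add_self_le.1 (add_le_add_iff_right 1 |>.1 (hp.len_le S h1 h1'))
      rcases hle.lt_or_eq with hlt | rfl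
      · obtain ⟨⟨r, y, e⟩, -⟩ := h3' m hlt
        exact (PA.succ_ne_zero _ (term_inj.1 (e.eq (hp.2.2 _ _ h2)))).elim
      · exact hσ.ext S hτ h1 h1' hp.2.2
    separated := by
      rintro σ - ⟨x, ξ, τ, ⟨τ₁, hτ₁, hp⟩, τ', ⟨τ₁', hτ₁', hp'⟩, ⟨-, l, hl, -, e⟩, ⟨-, l', hl', -, e'⟩⟩
      obtain rfl := hl.eq hl'
      obtain ⟨k, rfl | rfl⟩ := even_or_odd S l
      · obtain ⟨z, hz⟩ := (InD.isWord hτ₁' S).1 _ _ (hp'.2.2 _ _ e')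
        exact term_ne_param hz.symm
      · obtain ⟨z, hz⟩ := (InD.isWord hτ₁ S).2 _ _ (hp.2.2 _ _ e)
        exact term_ne_param hz }
  homogeneous := by
    -- The description of the mutilation on the right-hand side does not involve `f`.
    have key : ∀ γ, IsLO γ → ∀ f, IsIncMap S γ omega f → ∀ σ, σ ∈ mutilation omega γ f (DSet N θ) ↔
        IsSeqOver omega γ σ ∧ InD θ (OrdLt γ) σ := by
      intro γ hγ f hf σ
      refine and_congr_right fun hs => ?_
      have hocc : ∀ ξ ∈ Occ σ, ξ ∈ fld γ := by
        rintro ξ ⟨i, e⟩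
        rcases hs.2 _ _ e with ⟨x, -, h⟩ | ⟨ξ', h', h⟩
        · exact (term_ne_param h.symm).elim
        · exact param_inj.1 h ▸ h'
      have hL : ∀ ξ ξ' η η', ξ ∈ Occ σ → ξ' ∈ Occ σ → pair ξ η ∈ f → pair ξ' η' ∈ f →
          (OrdLt γ ξ ξ' ↔ η < η') := fun ξ ξ' η η' h1 h2 h3 h4 => by
        rw [hf.ordLt_iff hγ isLO_omega (hocc _ h1) (hocc _ h2) h3 h4, ordLt_omega]
      constructor
      · rintro ⟨τ, hτ, hm⟩
        exact (InD.map S hm hL).2 hτ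
      · intro hσ
        obtain ⟨τ, hτ⟩ := exists_mapSeq hf.mem hs.1 (hσ.word S) fun ξ h => hf.total ξ (hocc ξ h)
        exact ⟨τ, (InD.map S hτ hL).1 hσ, hτ⟩
    intro γ _ hγ f g hf hg
    ext σ
    rw [key γ hγ f hf, key γ hγ g hg]

/-- The instantiation at a linear order consists of the attempts to build an increasing map into this
order. -/
theorem mem_inst {θ : Fm 0 3} {α : Set N} (hα : α ∈ S) (hLO : IsLO α) {τ : N} :
    τ ∈ inst S (DSet N θ) α ↔ InD θ (OrdLt α) τ ∧ ∀ ξ ∈ Occ τ, ξ ∈ fld α := by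
  have hL : ∀ {f σ}, IsIncMap S (restr omega (Occ σ)) α f → ∀ ξ ξ' η η', ξ ∈ Occ σ → ξ' ∈ Occ σ →
      pair ξ η ∈ f → pair ξ' η' ∈ f → (ξ < ξ' ↔ OrdLt α η η') := by
    intro f σ hf ξ ξ' η η' h1 h2 h3 h4
    rw [← hf.ordLt_iff (isLO_omega.restr _) hLO (mem_fld_restr_omega.2 h1) (mem_fld_restr_omega.2 h2)
      h3 h4, ordLt_restr_omega]
    tauto
  constructor
  · rintro ⟨σ, hσ, f, hf, hm⟩
    refine ⟨(InD.map S hm (hL hf)).1 hσ, ?_⟩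
    rintro η ⟨i, e⟩
    obtain ⟨ξ, h, -⟩ := hm.param' S e
    exact (hf.mem_fld h).2
  · rintro ⟨h, hocc⟩
    obtain ⟨σ, f, hf, hm⟩ := exists_collapse hα hLO h.1 (h.word S) fun i ξ e => hocc ξ ⟨i, e⟩
    exact ⟨σ, (InD.map S hm (hL hf)).2 h, f, hf, hm⟩

omit hM in
theorem Occ.mono {σ τ : N} (h : IsPrefix σ τ) : Occ σ ⊆ Occ τ :=
  fun _ ⟨i, e⟩ => ⟨i, h.2.2 _ _ e⟩

/-- Initial segments of elements of the instantiation come from initial segments of elements. -/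
theorem exists_of_mem_hull_inst {D α : Set N} {τ : N} (h : τ ∈ hull (inst S D α)) :
    ∃ σ ∈ hull D, ∃ f, IsIncMap S (restr omega (Occ σ)) α f ∧ MapSeq f σ τ := by
  obtain ⟨τ₁, ⟨σ₁, hσ₁, f, hf, hm⟩, hp⟩ := h
  obtain ⟨l, hl⟩ := hp.1.1
  obtain ⟨l₁, hl₁⟩ := hp.2.1.1
  obtain ⟨σ, hσ, hσl⟩ := exists_prefix S hm.1 ((hm.2.2.1 _).2 hl₁) (hp.len_le S hl hl₁)
  refine ⟨σ, ⟨σ₁, hσ₁, hσ⟩, _, ?_, hm.of_isPrefix S hσ hp hσl hl⟩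
  have : MemS S f := ⟨hf.mem⟩
  have : MemS S (Occ σ) := ⟨occ_mem σ⟩
  have hmem : ∀ ξ η, pair ξ η ∈ {p | p ∈ f ∧ ∃ ξ η, p = pair ξ η ∧ ξ ∈ Occ σ} ↔
      pair ξ η ∈ f ∧ ξ ∈ Occ σ := by
    intro ξ η
    constructor
    · rintro ⟨h, ξ', η', e, h'⟩
      exact ⟨h, (pair_inj.1 e).1 ▸ h'⟩
    · exact fun ⟨h, h'⟩ => ⟨h, ξ, η, rfl, h'⟩
  refine ⟨hM.out.setOf_mem fun p => p ∈ f ∧ ∃ ξ η, p = pair ξ η ∧ ξ ∈ Occ σ, ?_, ?_, ?_, ?_⟩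
  · rintro p ⟨h, ξ, η, rfl, h'⟩
    exact ⟨ξ, η, rfl, mem_fld_restr_omega.2 h', (hf.mem_fld h).2⟩
  · intro ξ hξ
    have hξ := mem_fld_restr_omega.1 hξ
    obtain ⟨η, hη⟩ := hf.total ξ (mem_fld_restr_omega.2 (Occ.mono hσ hξ))
    exact ⟨η, (hmem _ _).2 ⟨hη, hξ⟩⟩
  · intro ξ η η' h h'
    exact hf.single _ _ _ ((hmem _ _).1 h).1 ((hmem _ _).1 h').1
  · intro ξ ξ' η η' hl h h'
    have hl := ordLt_restr_omega.1 hl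
    exact hf.increasing _ _ _ _ (ordLt_restr_omega.2 ⟨hl.1, Occ.mono hσ hl.2.1, Occ.mono hσ hl.2.2⟩)
      ((hmem _ _).1 h).1 ((hmem _ _).1 h').1

omit hM in
theorem MapSeq.mem_RSet_iff (S : Set (Set N)) [Model S] {f : Set N} {σ τ s : N} (h : MapSeq f σ τ) :
    pair σ s ∈ RSet N ↔ pair τ s ∈ RSet N := by
  simp only [pair_mem_RSet, h.2.2.1, h.term_iff S]

/-- The extraction scheme depends only on the terms. -/
theorem extr_iff {D α : Set N} {τ s : N} :
    Extr S D (RSet N) α τ s ↔ τ ∈ hull (inst S D α) ∧ pair τ s ∈ RSet N := by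
  refine and_congr_right fun hτ => ⟨?_, fun hs => ?_⟩
  · rintro ⟨σ, -, f, -, hm, hs⟩
    exact (hm.mem_RSet_iff S).1 hs
  · obtain ⟨σ, hσ, f, hf, hm⟩ := exists_of_mem_hull_inst hτ
    exact ⟨σ, hσ, f, hf, hm, (hm.mem_RSet_iff S).2 hs⟩

/-- Besides monotonicity this gives, for `σ = τ`, that the extracted sequence is unique. -/
theorem isPrefix_of_mem_RSet (S : Set (Set N)) [Model S] {σ τ s t : N} (h : IsPrefix σ τ)
    (hs : pair σ s ∈ RSet N) (ht : pair τ t ∈ RSet N) : IsPrefix s t := by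
  obtain ⟨h1, m, h2, h3, h4⟩ := pair_mem_RSet.1 hs
  obtain ⟨h1', m', h2', h3', h4'⟩ := pair_mem_RSet.1 ht
  have hle : m ≤ m' := by
    rcases h3 with h3 | h3 <;> rcases h3' with h3' | h3' <;> have := h.len_le S h3 h3'
    · exact add_self_le.1 this
    · exact add_self_lt_odd.1 (this.lt_of_ne odd_ne_even.symm)
    · exact (odd_lt_add_self.1 (this.lt_of_ne odd_ne_even)).le
    · exact add_self_le.1 (add_le_add_iff_right 1 |>.1 this)
  refine ⟨h1, h1', fun i x e => ?_⟩
  have hi := e.lt h2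
  obtain ⟨x₁, y₁, e1, e2⟩ := h4 i hi
  obtain ⟨x₂, y₂, e3, e4⟩ := h4' i (hi.trans_le hle)
  have := (h.2.2 _ _ e2).eq e4
  rw [term_inj, add_left_inj, pair_inj] at this
  rwa [e.eq e1, this.1]

theorem exists_mem_RSet {θ : Fm 0 3} {L : N → N → Prop} {σ τ : N} (h : InD θ L τ) (hp : IsPrefix σ τ)
    (S : Set (Set N)) [Model S] : ∃ s, pair σ s ∈ RSet N := by
  obtain ⟨hτ, m₁, h1, -, h2, -⟩ := h
  obtain ⟨l, hl⟩ := hp.1.1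
  obtain ⟨m, hm⟩ := even_or_odd S l
  have hle := hp.len_le S hl h1
  have hm' : m ≤ m₁ := by
    rcases hm with rfl | rfl
    · exact add_self_lt_odd.1 (hle.lt_of_ne odd_ne_even.symm)
    · exact add_self_le.1 (add_le_add_iff_right 1 |>.1 hle)
  have hex : ∀ i < m, ∃ x y, Entry σ (i + i) (term (pair x y + 1)) := by
    intro i hi
    obtain ⟨⟨r, y, e⟩, -⟩ := h2 i (hi.trans_le hm')
    have : i + i < l := by
      rcases hm with rfl | rfl
      · exact add_self_lt.2 hi
      · exact add_self_lt_odd.2 hi.le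
    obtain ⟨z, hz⟩ := exists_entry S hl this
    obtain rfl := (hp.2.2 _ _ hz).eq e
    exact ⟨r, y, hz⟩
  obtain ⟨s, hs, hsl, h3⟩ := exists_seq_of_rel (S := S)
    (P := fun i x => ∃ y, Entry σ (i + i) (term (pair x y + 1))) inferInstance m hex
  refine ⟨s, pair_mem_RSet.2 ⟨hs, m, hsl, ?_, fun i hi => ?_⟩⟩
  · rcases hm with rfl | rfl
    exacts [.inl hl, .inr hl]
  · obtain ⟨x, e, y, e'⟩ := h3 i hi
    exact ⟨x, y, e, e'⟩

/-- By `extr_iff` the extraction reads only the terms, which a change of parameters leaves alone. -/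
theorem isSemiGenedendron (θ : Fm 0 3) : IsSemiGenedendron S omega (DSet N θ) (RSet N) where
  prequasidendroid := isPrequasidendroid θ
  memr := RSet_mem
  function := by
    intro α hα hWO σ hσ
    obtain ⟨τ, hτ, hp⟩ := hσ
    obtain ⟨s, hs⟩ := exists_mem_RSet ((mem_inst hα hWO.1).1 hτ).1 hp S
    refine ⟨s, extr_iff.2 ⟨⟨τ, hτ, hp⟩, hs⟩, fun s' hs' => ?_⟩
    have hs' := (extr_iff.1 hs').2
    have h1 := isPrefix_of_mem_RSet S hp.1.isPrefix_refl hs hs'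
    have h2 := isPrefix_of_mem_RSet S hp.1.isPrefix_refl hs' hs
    obtain ⟨l, hl⟩ := h1.1.1
    obtain ⟨l', hl'⟩ := h1.2.1.1
    obtain rfl := le_antisymm (h1.len_le S hl hl') (h2.len_le S hl' hl)
    exact h2.1.ext S h1.1 hl' hl h2.2.2
  isSeq := fun α _ _ σ s h => (pair_mem_RSet.1 (extr_iff.1 h).2).1
  monotone := fun α _ _ σ τ s t hp hs ht =>
    isPrefix_of_mem_RSet S hp (extr_iff.1 hs).2 (extr_iff.1 ht).2
  functorial := by
    intro γ hγ hγW α hα hαW f hf σ τ s hm hs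
    obtain ⟨⟨σ₁, hσ₁, hp⟩, hs⟩ := extr_iff.1 hs
    refine extr_iff.2 ⟨?_, (hm.mem_RSet_iff S).1 hs⟩
    obtain ⟨h1, h2⟩ := (mem_inst hγ hγW.1).1 hσ₁
    -- To see that `τ` lies in the closure of the instantiation at `α`, the map `f` is applied to
    -- the whole element `σ₁` that extends `σ`.
    obtain ⟨τ₁, hτ₁⟩ := exists_mapSeq hf.mem h1.1 (h1.word S) fun ξ h => hf.total ξ (h2 ξ h)
    refine ⟨τ₁, (mem_inst hα hαW.1).2 ⟨(InD.map S hτ₁ ?_).1 h1, ?_⟩, hm.2.1, hτ₁.2.1, ?_⟩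
    · intro ξ ξ' η η' h3 h4 h5 h6
      exact hf.ordLt_iff hγW.1 hαW.1 (h2 _ h3) (h2 _ h4) h5 h6
    · rintro η ⟨i, e⟩
      obtain ⟨ξ, h, -⟩ := hτ₁.param' S e
      exact (hf.mem_fld h).2
    · intro i z e
      obtain ⟨l, hl⟩ := hm.1.1
      obtain ⟨z', hz'⟩ := exists_entry S hl (e.lt ((hm.2.2.1 _).1 hl))
      rcases h1.word S i z' (hp.2.2 _ _ hz') with ⟨x, rfl⟩ | ⟨ξ, rfl⟩
      · rw [e.eq ((hm.term_iff S).1 hz')]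
        exact (hτ₁.term_iff S).1 (hp.2.2 _ _ hz')
      · obtain ⟨η, h3, h4⟩ := hm.param hz'
        obtain ⟨η', h3', h4'⟩ := hτ₁.param (hp.2.2 _ _ hz')
        rwa [e.eq h4, hf.single _ _ _ h3 h3']

/-- The terms carry the usual order of the numbers, and the range of a descending function would
have no least element. -/
theorem isLocallyWF_omega {D : Set N} : IsLocallyWF S omega D := by
  intro σ _
  refine ⟨isLO_omega.restr _, ?_⟩
  rintro ⟨f, hf, h⟩
  have : MemS S f := ⟨hf.1⟩
  obtain ⟨z, hz⟩ := (hf.2.2 0).exists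
  obtain ⟨x, ⟨i, hi⟩, hmin⟩ := exists_least (S := S) (P := fun x => ∃ i, pair i x ∈ f) inferInstance
    ⟨z, 0, hz⟩
  obtain ⟨y, hy⟩ := (hf.2.2 (i + 1)).exists
  exact hmin y (ordLt_restr_omega.1 (h i x y hi hy)).1 ⟨_, hy⟩

end

section
variable {N : Type u} [ArithStr N] [PA N] {S : Set (Set N)} [hM : Model S]

/-! ### The Kleene–Brouwer order -/

/-- The first difference of `s` and `t` is a smaller entry of `s`, or an entry of `s` where `t` has
ended. -/
def KBLt {N : Type u} [ArithStr N] (s t : N) : Prop :=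
  ∃ i, (∀ j, j < i → ∀ x, Entry s j x ↔ Entry t j x) ∧
    ∃ x, Entry s i x ∧ ∀ y, Entry t i y → x < y

/-- The Kleene–Brouwer order on `T`. -/
def KB (T : Set N) : Set N := {p | ∃ s t, p = pair s t ∧ s ∈ T ∧ t ∈ T ∧ (KBLt s t ∨ s = t)}

omit hM in
theorem pair_mem_KB {T : Set N} {s t : N} : pair s t ∈ KB T ↔ s ∈ T ∧ t ∈ T ∧ (KBLt s t ∨ s = t) := by
  constructor
  · rintro ⟨s', t', e, h⟩
    obtain ⟨rfl, rfl⟩ := pair_inj.1 e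
    exact h
  · exact fun h => ⟨s, t, rfl, h⟩

instance {n : ℕ} {f g : (Fin n → N) → N} [hf : ArF S f] [hg : ArF S g] :
    Ar S fun v => KBLt (f v) (g v) := by
  refine .comp2 (P := KBLt) ?_ hf hg
  unfold KBLt; infer_instance

theorem KB_mem {T : Set N} (hT : T ∈ S) : KB T ∈ S := by
  have : MemS S T := ⟨hT⟩
  exact hM.out.setOf_mem fun p => ∃ s t, p = pair s t ∧ s ∈ T ∧ t ∈ T ∧ (KBLt s t ∨ s = t)

omit hM in
theorem KBLt.irrefl {s : N} : ¬ KBLt s s := by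
  rintro ⟨i, -, x, hx, h⟩
  exact lt_irrefl _ (h x hx)

omit hM in
theorem KBLt.trans {s t u : N} (h : KBLt s t) (h' : KBLt t u) : KBLt s u := by
  obtain ⟨i, h1, x, hx, h2⟩ := h
  obtain ⟨j, h3, y, hy, h4⟩ := h'
  rcases lt_trichotomy i j with hij | rfl | hij
  · exact ⟨i, fun k hk z => (h1 k hk z).trans (h3 k (hk.trans hij) z), x, hx, fun z hz =>
      h2 z ((h3 i hij z).2 hz)⟩
  · exact ⟨i, fun k hk z => (h1 k hk z).trans (h3 k hk z), x, hx, fun z hz =>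
      (h2 y hy).trans (h4 z hz)⟩
  · exact ⟨j, fun k hk z => (h1 k (hk.trans hij) z).trans (h3 k hk z), y, (h1 j hij y).2 hy, h4⟩

theorem KBLt.total (S : Set (Set N)) [Model S] {s t : N} (hs : IsSeq s) (ht : IsSeq t) :
    KBLt s t ∨ s = t ∨ KBLt t s := by
  by_cases hd : ∃ i, ¬ ∀ x, Entry s i x ↔ Entry t i x
  · obtain ⟨i, hi, hmin⟩ := exists_least (S := S) inferInstance hd
    simp only [not_not] at hmin
    by_cases h1 : ∃ x, Entry s i x <;> by_cases h2 : ∃ y, Entry t i y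
    · obtain ⟨x, hx⟩ := h1
      obtain ⟨y, hy⟩ := h2
      rcases lt_trichotomy x y with hxy | rfl | hxy
      · exact .inl ⟨i, hmin, x, hx, fun z hz => hy.eq hz ▸ hxy⟩
      · exact (hi fun z => ⟨fun h => h.eq hx ▸ hy, fun h => h.eq hy ▸ hx⟩).elim
      · exact .inr (.inr ⟨i, fun j hj z => (hmin j hj z).symm, y, hy, fun z hz => hx.eq hz ▸ hxy⟩)
    · obtain ⟨x, hx⟩ := h1
      exact .inl ⟨i, hmin, x, hx, fun z hz => (h2 ⟨z, hz⟩).elim⟩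
    · obtain ⟨y, hy⟩ := h2
      exact .inr (.inr ⟨i, fun j hj z => (hmin j hj z).symm, y, hy, fun z hz => (h1 ⟨z, hz⟩).elim⟩)
    · exact (hi fun z => ⟨fun h => (h1 ⟨z, h⟩).elim, fun h => (h2 ⟨z, h⟩).elim⟩).elim
  · push Not at hd
    refine .inr (.inl ?_)
    obtain ⟨l, hl⟩ := hs.1
    obtain ⟨m, hm⟩ := ht.1
    have h1 : IsPrefix s t := ⟨hs, ht, fun i x => (hd i x).1⟩
    have h2 : IsPrefix t s := ⟨ht, hs, fun i x => (hd i x).2⟩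
    obtain rfl := le_antisymm (h1.len_le S hl hm) (h2.len_le S hm hl)
    exact hs.ext S ht hl hm h1.2.2

theorem KBLt.of_isPrefix (S : Set (Set N)) [Model S] {s t : N} (h : IsPrefix t s) (hne : t ≠ s) :
    KBLt s t := by
  rcases KBLt.total S h.2.1 h.1 with h' | rfl | h'
  · exact h'
  · exact (hne rfl).elim
  · obtain ⟨i, -, x, hx, hl⟩ := h'
    exact (lt_irrefl _ (hl x (h.2.2 _ _ hx))).elim

theorem mem_fld_KB {T : Set N} {s : N} : s ∈ fld (KB T) ↔ s ∈ T := by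
  rw [fld, Set.mem_ofPred_eq, pair_mem_KB]; simp

theorem isLO_KB (S : Set (Set N)) [Model S] {T : Set N} (hT : ∀ s ∈ T, IsSeq s) : IsLO (KB T) where
  pairs := by rintro p ⟨s, t, e, -⟩; exact ⟨s, t, e⟩
  field := fun s t h => ⟨mem_fld_KB.2 (pair_mem_KB.1 h).1, mem_fld_KB.2 (pair_mem_KB.1 h).2.1⟩
  antisymm := fun s t h h' => by
    rcases (pair_mem_KB.1 h).2.2 with h1 | h1
    · rcases (pair_mem_KB.1 h').2.2 with h2 | h2
      · exact (KBLt.irrefl (h1.trans h2)).elim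
      · exact h2.symm
    · exact h1
  trans := fun s t u h h' => by
    obtain ⟨hs, -, h⟩ := pair_mem_KB.1 h
    obtain ⟨-, hu, h'⟩ := pair_mem_KB.1 h'
    refine pair_mem_KB.2 ⟨hs, hu, ?_⟩
    rcases h with h | rfl
    · rcases h' with h' | rfl
      · exact .inl (h.trans h')
      · exact .inl h
    · exact h'
  total := fun s hs t ht => by
    have hs := mem_fld_KB.1 hs
    have ht := mem_fld_KB.1 ht
    rcases KBLt.total S (hT s hs) (hT t ht) with h | h | h
    · exact .inl (pair_mem_KB.2 ⟨hs, ht, .inl h⟩)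
    · exact .inl (pair_mem_KB.2 ⟨hs, ht, .inr h⟩)
    · exact .inr (pair_mem_KB.2 ⟨ht, hs, .inl h⟩)

/-- A descending sequence in the Kleene–Brouwer order of a tree yields a path through the tree. -/
theorem exists_path_of_descending {T : Set N} (hT : ∀ s ∈ T, IsSeq s)
    (hTp : ∀ s t, IsPrefix s t → t ∈ T → s ∈ T) {d : N → N} (hd : Ar S fun v : Fin 2 → N => v 0 = d (v 1))
    (hdT : ∀ n, d n ∈ T) (hdesc : ∀ n, KBLt (d (n + 1)) (d n)) :
    ∃ g, IsFun S g ∧ ∀ n t, IsInit g n t → t ∈ T := by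
  have ard {n : ℕ} (f : (Fin n → N) → N) [hf : ArF S f] : ArF S fun v => d (f v) := .comp1 hd hf
  have hlt : ∀ k m, KBLt (d (k + m + 1)) (d k) := by
    intro k m
    induction m using induct (S := S) with
    | ar => infer_instance
    | h0 => simpa using hdesc k
    | hs m ih => rw [← add_assoc]; exact (hdesc _).trans ih
  -- For each `n` the first `n` entries of the descending sequence are eventually constant. The
  -- limit of these initial segments is the path.
  have hstab : ∀ n, ∃ s k, IsSeq s ∧ IsLen s n ∧ ∀ k', k ≤ k' → IsPrefix s (d k') := by
    intro n
    induction n using induct (S := S) with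
    | ar => infer_instance
    | h0 =>
      obtain ⟨s, h1, h2, -⟩ := exists_seq (S := S) (F := fun _ => 0) inferInstance 0
      exact ⟨s, 0, h1, h2, fun k _ => ⟨h1, hT _ (hdT k), fun i x e => (not_lt_zero (e.lt h2)).elim⟩⟩
    | hs n ih =>
      obtain ⟨s, k, hs, hsl, h⟩ := ih
      have hagree : ∀ k₁ k₂, k ≤ k₁ → k ≤ k₂ → ∀ j, j < n → ∀ x, Entry (d k₁) j x ↔ Entry (d k₂) j x := by
        intro k₁ k₂ h1 h2 j hj x
        obtain ⟨y, hy⟩ := exists_entry S hsl hj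
        have e1 := (h k₁ h1).2.2 _ _ hy
        have e2 := (h k₂ h2).2.2 _ _ hy
        exact ⟨fun e => e.eq e1 ▸ e2, fun e => e.eq e2 ▸ e1⟩
      -- Once the first `n` entries are fixed, the first difference has index at least `n`. So the
      -- later sequence is longer than `n`, and its entry with index `n` cannot have increased.
      have hstep : ∀ k₁ k₂, k ≤ k₁ → k₁ < k₂ → ∃ x, (∃ i, n ≤ i ∧ Entry (d k₂) i x) ∧
          ∀ y, Entry (d k₁) n y → ∃ z, Entry (d k₂) n z ∧ z ≤ y := by
        intro k₁ k₂ h1 h2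
        obtain ⟨m, rfl⟩ := lt_iff_ex.1 h2
        obtain ⟨i, hi, x, hx, hx'⟩ := hlt k₁ m
        have hn : n ≤ i := by
          rw [← not_lt]
          intro hin
          exact lt_irrefl _ (hx' x ((hagree _ _ (h1.trans h2.le) h1 i hin x).1 hx))
        refine ⟨x, ⟨i, hn, hx⟩, fun y hy => ?_⟩
        rcases hn.lt_or_eq with hn | rfl
        · exact ⟨y, (hi n hn y).2 hy, le_rfl⟩
        · exact ⟨x, hx, (hx' y hy).le⟩
      -- The least entry with index `n` that ever occurs after `k` is kept from then on: it can
      -- neither increase nor be undercut.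
      obtain ⟨x, ⟨k₁, hk₁, hx⟩, hmin⟩ := exists_least (S := S)
        (P := fun x => ∃ k', k ≤ k' ∧ Entry (d k') n x) inferInstance (by
          obtain ⟨x, ⟨i, hi, hx⟩, -⟩ := hstep k (k + 1) le_rfl (lt_add_one_iff'.2 le_rfl)
          obtain ⟨l, hl⟩ := hx.isLen
          obtain ⟨y, hy⟩ := exists_entry S hl (hi.trans_lt (hx.lt hl))
          exact ⟨y, k + 1, le_self_add, hy⟩)
      obtain ⟨s', hs'⟩ := exists_snoc S hs x
      obtain ⟨l', hl', hl'', -⟩ := hs'.2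
      obtain rfl := hl'.eq hsl
      refine ⟨s', k₁, hs'.1.2.1, hl'', fun k' hk' => ⟨hs'.1.2.1, hT _ (hdT k'), fun i z e => ?_⟩⟩
      rcases hs'.entry hsl S e with e | ⟨rfl, rfl⟩
      · exact (h k' (hk₁.trans hk')).2.2 _ _ e
      · rcases hk'.lt_or_eq with hk' | rfl
        · obtain ⟨-, -, h2⟩ := hstep k₁ k' hk₁ hk'
          obtain ⟨w, hw, hwx⟩ := h2 _ hx
          rcases hwx.lt_or_eq with hwx | rfl
          · exact (hmin w hwx ⟨k', hk₁.trans hk'.le, hw⟩).elim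
          · exact hw
        · exact hx
  obtain ⟨g, hg, hg'⟩ := exists_isFun (S := S)
    (P := fun i x => ∃ k, ∀ k', k ≤ k' → Entry (d k') i x) inferInstance (by
      intro i
      obtain ⟨s, k, hs, hsl, h⟩ := hstab (i + 1)
      obtain ⟨x, hx⟩ := exists_entry S hsl (lt_add_one_iff'.2 le_rfl : i < i + 1)
      refine ⟨x, ⟨k, fun k' hk' => (h k' hk').2.2 _ _ hx⟩, ?_⟩
      rintro y ⟨k₂, hk₂⟩
      exact (hk₂ _ le_add_self).eq ((h (k + k₂) le_self_add).2.2 _ _ hx))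
  refine ⟨g, hg, fun n t ht => ?_⟩
  obtain ⟨s, k, hs, hsl, h⟩ := hstab n
  refine hTp t (d k) ⟨ht.1, hT _ (hdT k), fun i x e => ?_⟩ (hdT k)
  obtain ⟨k₂, hk₂⟩ := (hg' _ _).1 (ht.2.2 i x e)
  obtain ⟨y, hy⟩ := exists_entry S hsl (e.lt ht.2.1)
  rw [(hk₂ _ le_add_self).eq ((h (k + k₂) le_self_add).2.2 _ _ hy)]
  exact (h k le_rfl).2.2 _ _ hy

theorem isWO_KB {T : Set N} (hT : ∀ s ∈ T, IsSeq s) (hTp : ∀ s t, IsPrefix s t → t ∈ T → s ∈ T)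
    (hno : ¬ ∃ g, IsFun S g ∧ ∀ n t, IsInit g n t → t ∈ T) : IsWO S (KB T) := by
  refine ⟨isLO_KB S hT, ?_⟩
  rintro ⟨f, hf, h⟩
  have : MemS S f := ⟨hf.1⟩
  choose d hd using fun i => (hf.2.2 i).exists
  have h1 : ∀ n, OrdLt (KB T) (d (n + 1)) (d n) := fun n => h n _ _ (hd n) (hd (n + 1))
  refine hno (exists_path_of_descending hT hTp (d := d) ?_ (fun n => ?_) fun n => ?_)
  · have : Ar S fun v : Fin 2 → N => pair (v 1) (v 0) ∈ f := inferInstance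
    exact this.congr fun v => ⟨fun e => e ▸ hd _, fun e => hf.eq e (hd _)⟩
  · exact (pair_mem_KB.1 (h1 n).1).2.1
  · rcases (pair_mem_KB.1 (h1 n).1).2.2 with h2 | h2
    exacts [h2, ((h1 n).2 h2).elim]

end

section
variable {N : Type u} [ArithStr N] [PA N] {S : Set (Set N)} [hM : Model S]

/-! ### Infinite branches -/

section
variable {θ : Fm 0 3} {α b : Set N}

/-- The initial segments of a branch are initial segments of attempts. -/
theorem IsBranch.exists_inD (hα : α ∈ S) (hWO : IsWO S α)
    (hb : IsBranch S (hull (inst S (DSet N θ) α)) b) (n : N) :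
    ∃ τ, InD θ (OrdLt α) τ ∧ (∀ i x, i < n → (Entry τ i x ↔ pair i x ∈ b)) ∧
      ∀ m, IsLen τ m → n ≤ m := by
  obtain ⟨t, ht, τ, hτ, hp⟩ := hb.2 n
  refine ⟨τ, ((mem_inst hα hWO.1).1 hτ).1, fun i x hi => ⟨fun e => ?_, fun h => ?_⟩,
    fun m hm => hp.len_le S ht.2.1 hm⟩
  · obtain ⟨y, hy⟩ := exists_entry S ht.2.1 hi
    rw [e.eq (hp.2.2 _ _ hy)]
    exact ht.2.2 _ _ hy
  · exact hp.2.2 _ _ ((ht.entry_iff hb.1).2 ⟨hi, h⟩)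

omit hM in
theorem lt_of_odd_lt {i n m : N} (h : i + i + 1 < n) (h' : n ≤ m + m + 1) : i < m :=
  add_self_lt.1 ((add_lt_add_iff_right 1).1 (h.trans_le h'))

theorem IsBranch.exists_pair (hα : α ∈ S) (hWO : IsWO S α)
    (hb : IsBranch S (hull (inst S (DSet N θ) α)) b) (i : N) :
    (∃ r y, pair (i + i) (term (pair r y + 1)) ∈ b) ∧ ∃ ξ, pair (i + i + 1) (param ξ) ∈ b := by
  obtain ⟨τ, ⟨-, m, h1, -, h2, -⟩, h3, h4⟩ := hb.exists_inD hα hWO (i + i + 1 + 1)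
  have hlt : i + i + 1 < i + i + 1 + 1 := lt_add_one_iff'.2 le_rfl
  obtain ⟨⟨r, y, e⟩, ξ, e'⟩ := h2 i (lt_of_odd_lt hlt (h4 _ h1))
  exact ⟨⟨r, y, (h3 _ _ (lt_of_le_of_lt le_self_add hlt)).1 e⟩, ξ, (h3 _ _ hlt).1 e'⟩

/-- The parameters of a branch decrease along the tree of the attempts that are based on its terms. -/
theorem IsBranch.ordLt (hα : α ∈ S) (hWO : IsWO S α)
    (hb : IsBranch S (hull (inst S (DSet N θ) α)) b) {c : Set N}
    (hc : ∀ i x, pair i x ∈ c ↔ pair (i + i) (term (x + 1)) ∈ b) {j k ξ η : N} (hj : j ∈ Tree θ c)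
    (hk : IsPrefix k j) (hne : k ≠ j) (hξ : pair (j + j + 1) (param ξ) ∈ b)
    (hη : pair (k + k + 1) (param η) ∈ b) : OrdLt α ξ η := by
  -- The length is chosen to cover the positions of both parameters.
  obtain ⟨τ, ⟨-, m, h1, -, -, h2⟩, h3, h4⟩ :=
    hb.exists_inD hα hWO (j + j + 1 + 1 + (k + k + 1 + 1))
  have hj1 : j + j + 1 < j + j + 1 + 1 + (k + k + 1 + 1) :=
    (lt_add_one_iff'.2 le_rfl).trans_le le_self_add
  have hk1 : k + k + 1 < j + j + 1 + 1 + (k + k + 1 + 1) :=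
    (lt_add_one_iff'.2 le_rfl).trans_le le_add_self
  refine h2 j (lt_of_odd_lt hj1 (h4 _ h1)) k (lt_of_odd_lt hk1 (h4 _ h1)) hj.1 ?_ hk hne ξ η
    ((h3 _ _ hj1).2 hξ) ((h3 _ _ hk1).2 hη)
  -- An index `i` that occurs in `j` is smaller than `j`, so the data at position `i + i` precede
  -- the parameter of `j`.
  intro i z e
  obtain ⟨x, q, h, hx⟩ := hj.2 i z e
  exact ⟨x, q, h, (h3 _ _ ((add_self_lt_odd.2 e.lt_code.le).trans hj1)).2 ((hc _ _).1 hx)⟩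

/-- The data of a branch. -/
theorem IsBranch.exists_data (hα : α ∈ S) (hWO : IsWO S α)
    (hb : IsBranch S (hull (inst S (DSet N θ) α)) b) :
    ∃ c, IsFun S c ∧ (∀ i x, pair i x ∈ c ↔ pair (i + i) (term (x + 1)) ∈ b) ∧
      (∀ i x, pair i x ∈ c → ∃ r y, x = pair r y) ∧
      ¬ ∃ g, IsFun S g ∧ ∀ n t, IsInit g n t → t ∈ Tree θ c := by
  have : MemS S b := ⟨hb.1.1⟩
  have hinj : ∀ {i x y}, pair (i + i) (term (x + 1)) ∈ b → pair (i + i) (term (y + 1)) ∈ b → x = y :=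
    fun h h' => add_right_cancel (term_inj.1 (hb.1.eq h h'))
  obtain ⟨c, hc, hc'⟩ := exists_isFun (S := S) (P := fun i x => pair (i + i) (term (x + 1)) ∈ b)
    inferInstance fun i => by
      obtain ⟨⟨r, y, h⟩, -⟩ := hb.exists_pair hα hWO i
      exact ⟨_, h, fun x hx => hinj hx h⟩
  refine ⟨c, hc, hc', fun i x hx => ?_, ?_⟩
  · obtain ⟨⟨r, y, h⟩, -⟩ := hb.exists_pair hα hWO i
    exact ⟨r, y, hinj ((hc' _ _).1 hx) h⟩
  · rintro ⟨g, hg, hT⟩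
    have : MemS S g := ⟨hg.1⟩
    -- The parameters of the initial segments of a path would form a descending sequence in `α`.
    obtain ⟨d, hd, hd'⟩ := exists_isFun (S := S)
      (P := fun n ξ => ∃ t, IsInit g n t ∧ pair (t + t + 1) (param ξ) ∈ b) inferInstance fun n => by
        obtain ⟨t, ht⟩ := hg.exists_isInit n
        obtain ⟨-, ξ, hξ⟩ := hb.exists_pair hα hWO t
        refine ⟨ξ, ⟨t, ht, hξ⟩, ?_⟩
        rintro η ⟨t', ht', hη⟩
        obtain rfl := ht.1.ext S ht'.1 ht.2.1 ht'.2.1 fun i x e =>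
          (ht'.entry_iff hg).2 ((ht.entry_iff hg).1 e)
        exact param_inj.1 (hb.1.eq hη hξ)
    refine hWO.2 ⟨d, hd, fun n ξ η h h' => ?_⟩
    obtain ⟨k, hk, hξ⟩ := (hd' _ _).1 h
    obtain ⟨j, hj, hη⟩ := (hd' _ _).1 h'
    refine hb.ordLt hα hWO hc' (hT _ _ hj) ⟨hk.1, hj.1, fun i x e => ?_⟩ ?_ hη hξ
    · obtain ⟨h1, h2⟩ := (hk.entry_iff hg).1 e
      exact (hj.entry_iff hg).2 ⟨h1.trans (lt_add_one_iff'.2 le_rfl), h2⟩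
    · rintro rfl
      exact (lt_add_one_iff'.2 le_rfl : n < n + 1).ne (hk.2.1.eq hj.2.1)

theorem IsBranch.branchValue_eq (hα : α ∈ S) (hWO : IsWO S α)
    (hb : IsBranch S (hull (inst S (DSet N θ) α)) b) {c : Set N}
    (hc : ∀ i x, pair i x ∈ c ↔ pair (i + i) (term (x + 1)) ∈ b) :
    branchValue S (DSet N θ) (RSet N) α b = graphPart c := by
  ext p
  constructor
  · rintro ⟨i, x, rfl, n, t, s, ht, hs, e⟩
    obtain ⟨-, m, hm, -, h⟩ := pair_mem_RSet.1 (extr_iff.1 hs).2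
    obtain ⟨x', y, e1, e2⟩ := h i (e.lt hm)
    obtain rfl := e.eq e1
    exact ⟨i, x, y, rfl, (hc _ _).2 (ht.2.2 _ _ e2)⟩
  · rintro ⟨i, r, y, rfl, h⟩
    have h := (hc _ _).1 h
    -- Length `2i + 2` forces `m > i`, so that the extracted sequence has an entry with index `i`.
    obtain ⟨t, ht, htT⟩ := hb.2 (i + i + 1 + 1)
    obtain ⟨τ, hτ, hp⟩ := id htT
    obtain ⟨s, hs⟩ := exists_mem_RSet ((mem_inst hα hWO.1).1 hτ).1 hp S
    obtain ⟨-, m, hm, hl, h1⟩ := pair_mem_RSet.1 hs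
    have hle : i + i + 1 + 1 ≤ m + m + 1 := by
      rcases hl with hl | hl <;> rw [ht.2.1.eq hl]
      exact le_self_add
    obtain ⟨x, z, e1, e2⟩ := h1 i (lt_of_odd_lt (lt_add_one_iff'.2 le_rfl) hle)
    have h2 := hb.1.eq h (ht.2.2 _ _ e2)
    rw [term_inj, add_left_inj, pair_inj] at h2
    exact ⟨i, r, rfl, _, t, s, ht, extr_iff.2 ⟨htT, hs⟩, h2.1 ▸ e1⟩

theorem graphPart_isFun {c : Set N} (hc : IsFun S c)
    (hpair : ∀ i x, pair i x ∈ c → ∃ r y, x = pair r y) : IsFun S (graphPart c) := by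
  have : MemS S c := ⟨hc.1⟩
  refine ⟨graphPart_mem, ?_, fun i => ?_⟩
  · rintro p ⟨i, r, y, rfl, -⟩
    exact ⟨i, r, rfl⟩
  · obtain ⟨x, hx⟩ := (hc.2.2 i).exists
    obtain ⟨r, y, rfl⟩ := hpair i x hx
    refine ⟨r, ⟨i, r, y, rfl, hx⟩, ?_⟩
    rintro r' ⟨i', r'', y', e, h⟩
    obtain ⟨rfl, rfl⟩ := pair_inj.1 e
    exact (pair_inj.1 (hc.eq h hx)).1

omit [PA N] hM in
theorem sat_exS_allS :
    ∀ {X : Set N}, (Fm.exS (.allS θ)).Sat S ![] ![X] ↔ ∃ Y ∈ S, ∀ Z ∈ S, θ.Sat S ![] ![Z, Y, X] := by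
  intro X
  simp only [Fm.exS, Fm.neg, Fm.Sat]
  constructor
  · intro h
    by_contra hc
    exact h fun Y hY hZ => hc ⟨Y, hY, hZ⟩
  · rintro ⟨Y, hY, hZ⟩ h
    exact h Y hY hZ

/-- All branches have the value of the real that is defined by the formula. -/
theorem IsBranch.value_eq (hθ : θ.IsArith) {R : Set N} (hR : DefinesFun S (.exS (.allS θ)) R)
    (hα : α ∈ S) (hWO : IsWO S α) (hb : IsBranch S (hull (inst S (DSet N θ) α)) b) :
    branchValue S (DSet N θ) (RSet N) α b = R := by
  obtain ⟨c, hc, hcb, hpair, hno⟩ := hb.exists_data hα hWO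
  have : MemS S c := ⟨hc.1⟩
  rw [hb.branchValue_eq hα hWO hcb]
  -- Uniqueness of `R` is applied to the function read off the branch, with the set read off the
  -- branch as witness: a counterexample `Z` would give a path through the tree.
  refine hR.2.2 _ (graphPart_isFun hc hpair) (sat_exS_allS.2 ⟨setPart c, setPart_mem, fun Z hZ => ?_⟩)
  by_contra h
  exact hno (exists_path_of_not_sat hθ hc hZ h)

end

omit [PA N] hM in
-- Needed for the empty sequence, which is a node and serves as the default parameter in
-- `exists_branch`.
theorem Con.of_isEmpty {n k : ℕ} {φ : Fm n k} {O : Fin k → N → N → Prop} {E : N → N → Prop}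
    (hE : ∀ i y, ¬ E i y) : Con φ O E := by
  induction φ generalizing E with
  | eq s t => exact fun v y e => (hE _ _ e).elim
  | lt s t => exact fun v y e => (hE _ _ e).elim
  | mem t X => exact fun v y z e => (hE _ _ e).elim
  | falsum => exact fun v y e => (hE _ _ e).elim
  | imp φ ψ ih ih' =>
    exact ⟨ih fun i => hE _, ih' fun i => hE _, fun v y y₁ y₂ e => (hE _ _ e).elim⟩
  | allN φ ih => exact ⟨ih fun i => hE _, fun v w y y₁ e => (hE _ _ e).elim⟩
  | allS φ => trivial

omit [PA N] hM in
theorem Attempt.of_isEmpty {θ : Fm 0 3} {B : N → N → Prop} (hB : ∀ i z, ¬ B i z) : Attempt θ B :=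
  ⟨.of_isEmpty fun _ _ ⟨_, h⟩ => hB _ _ h, fun _ ⟨_, h⟩ => (hB _ _ h).elim⟩

/-- A branch that belongs to a witness of the formula. -/
theorem exists_branch {θ : Fm 0 3} (hθ : θ.IsArith) {R : Set N} (hR : IsFun S R)
    (h : (Fm.exS (.allS θ)).Sat S ![] ![R]) :
    ∃ α ∈ S, IsWO S α ∧ ∃ b, IsBranch S (hull (inst S (DSet N θ) α)) b := by
  obtain ⟨Y, hY, hZ⟩ := sat_exS_allS.1 h
  have : MemS S R := ⟨hR.1⟩
  have : MemS S Y := ⟨hY⟩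
  obtain ⟨c, hc, hc'⟩ := exists_isFun (S := S) (P := fun i x => ∃ r y, x = pair r y ∧ pair i r ∈ R ∧
      ((i ∈ Y ∧ y = 0) ∨ (i ∉ Y ∧ y = 1))) inferInstance fun i => by
    obtain ⟨r, hr⟩ := (hR.2.2 i).exists
    obtain ⟨y, hy, hu⟩ := existsUnique_truthValue Y i
    refine ⟨pair r y, ⟨r, y, rfl, hr, hy⟩, ?_⟩
    rintro x ⟨r', y', rfl, hr', hy'⟩
    rw [hR.eq hr hr', hu _ hy']
  have : MemS S c := ⟨hc.1⟩
  have hpair : ∀ i x, pair i x ∈ c → ∃ r y, x = pair r y := fun i x hx =>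
    let ⟨r, y, e, _⟩ := (hc' _ _).1 hx
    ⟨r, y, e⟩
  have hcp : ∀ i r y, pair i (pair r y) ∈ c ↔ pair i r ∈ R ∧ ((i ∈ Y ∧ y = 0) ∨ (i ∉ Y ∧ y = 1)) := by
    intro i r y
    rw [hc']
    constructor
    · rintro ⟨r', y', e, h⟩
      obtain ⟨rfl, rfl⟩ := pair_inj.1 e
      exact h
    · exact fun h => ⟨r, y, rfl, h⟩
  have hgr : graphPart c = R := by
    ext p
    constructor
    · rintro ⟨i, r, y, rfl, h⟩
      exact ((hcp _ _ _).1 h).1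
    · intro hp
      obtain ⟨i, r, rfl⟩ := hR.2.1 p hp
      obtain ⟨y, hy, -⟩ := existsUnique_truthValue Y i
      exact ⟨i, r, y, rfl, (hcp _ _ _).2 ⟨hp, hy⟩⟩
  have hset : setPart c = Y := by
    ext i
    constructor
    · rintro ⟨r, h⟩
      rcases ((hcp _ _ _).1 h).2 with h | h
      exacts [h.1, (zero_ne_one h.2).elim]
    · intro hi
      obtain ⟨r, hr⟩ := (hR.2.2 i).exists
      exact ⟨r, (hcp _ _ _).2 ⟨hr, .inl ⟨hi, rfl⟩⟩⟩
  have hseq : ∀ s ∈ Tree θ c, IsSeq s := fun s hs => hs.1.1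
  have hpre : ∀ s t, IsPrefix s t → t ∈ Tree θ c → s ∈ Tree θ c := fun s t hp ht =>
    ⟨⟨hp.1, ht.1.2.anti hp.2.2⟩, fun i z e => ht.2 i z (hp.2.2 i z e)⟩
  have hno : ¬ ∃ g, IsFun S g ∧ ∀ n t, IsInit g n t → t ∈ Tree θ c := by
    rintro ⟨g, hg, hT⟩
    obtain ⟨Z, hZS, hZ'⟩ := exists_not_sat_of_path hθ hc hpair hg hT
    exact hZ' (by rw [hgr, hset]; exact hZ Z hZS)
  have hT : Tree θ c ∈ S := tree_mem θ hc.1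
  have : MemS S (Tree θ c) := ⟨hT⟩
  have hWO := isWO_KB hseq hpre hno
  -- The empty sequence `e` guarantees that the Kleene–Brouwer order has an element that can be
  -- assigned to the numbers outside the tree.
  obtain ⟨e, hes, hel, -⟩ := exists_seq (S := S) (F := fun _ => 0) inferInstance 0
  have hent : ∀ i z, ¬ Entry e i z := fun i z h => not_lt_zero (h.lt hel)
  have he : e ∈ Tree θ c := ⟨⟨hes, .of_isEmpty hent⟩, fun i z h => (hent i z h).elim⟩
  refine ⟨KB (Tree θ c), KB_mem hT, hWO, ?_⟩
  -- The branch lists the data `c` at even positions; at odd positions each node of the tree is its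
  -- own parameter.
  obtain ⟨b, hb, hb'⟩ := exists_isFun (S := S)
    (P := fun n z => (∃ i x, n = i + i ∧ z = term (x + 1) ∧ pair i x ∈ c) ∨
      ∃ i ξ, n = i + i + 1 ∧ z = param ξ ∧ ((i ∈ Tree θ c ∧ ξ = i) ∨ (i ∉ Tree θ c ∧ ξ = e)))
    inferInstance fun n => by
      obtain ⟨i, rfl | rfl⟩ := even_or_odd S n
      · obtain ⟨x, hx⟩ := (hc.2.2 i).exists
        refine ⟨term (x + 1), .inl ⟨i, x, rfl, rfl, hx⟩, ?_⟩
        rintro z (⟨i', x', e1, rfl, h⟩ | ⟨i', x', e1, -⟩)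
        · obtain rfl := add_self_inj.1 e1
          rw [hc.eq h hx]
        · exact (odd_ne_even e1.symm).elim
      · have : ∃ ξ, (i ∈ Tree θ c ∧ ξ = i) ∨ (i ∉ Tree θ c ∧ ξ = e) := by
          by_cases h : i ∈ Tree θ c <;> simp [h]
        obtain ⟨ξ, hξ⟩ := this
        refine ⟨param ξ, .inr ⟨i, ξ, rfl, rfl, hξ⟩, ?_⟩
        rintro z (⟨i', x', e1, -⟩ | ⟨i', η, e1, rfl, h⟩)
        · exact (odd_ne_even e1).elim
        · obtain rfl := add_self_inj.1 (add_right_cancel e1)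
          rcases h with h | h <;> rcases hξ with h' | h' <;> simp_all
  have heven : ∀ i z, pair (i + i) z ∈ b → ∃ x, z = term (x + 1) ∧ pair i x ∈ c := by
    intro i z h
    rcases (hb' _ _).1 h with ⟨i', x, e1, e2, h⟩ | ⟨i', x, e1, -⟩
    · obtain rfl := add_self_inj.1 e1
      exact ⟨x, e2, h⟩
    · exact (odd_ne_even e1.symm).elim
  have hodd : ∀ i z, pair (i + i + 1) z ∈ b → ∃ ξ, z = param ξ ∧
      ((i ∈ Tree θ c ∧ ξ = i) ∨ (i ∉ Tree θ c ∧ ξ = e)) := by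
    intro i z h
    rcases (hb' _ _).1 h with ⟨i', x, e1, -⟩ | ⟨i', ξ, e1, e2, h⟩
    · exact (odd_ne_even e1).elim
    · obtain rfl := add_self_inj.1 (add_right_cancel e1)
      exact ⟨ξ, e2, h⟩
  refine ⟨b, hb, fun n => ?_⟩
  obtain ⟨t, ht⟩ := hb.exists_isInit n
  -- To place the initial segment of length `n` in the closure, it is extended to length `n + n`
  -- along `b` and then closed by the end mark.
  obtain ⟨u, hu⟩ := hb.exists_isInit (n + n)
  obtain ⟨τ, hτ⟩ := exists_snoc S hu.1 (term 0)
  have hpre' : IsPrefix t u := ⟨ht.1, hu.1, fun i x e =>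
    (hu.entry_iff hb).2 ⟨(e.lt ht.2.1).trans_le le_self_add, ht.2.2 _ _ e⟩⟩
  have hent : ∀ {i z}, Entry τ i z → i ≠ n + n → pair i z ∈ b := by
    intro i z e1 hi
    rcases hτ.entry hu.2.1 S e1 with e1 | ⟨h, -⟩
    exacts [hu.2.2 _ _ e1, (hi h).elim]
  have hpar : ∀ {j ξ}, Entry τ (j + j + 1) (param ξ) →
      (j ∈ Tree θ c ∧ ξ = j) ∨ (j ∉ Tree θ c ∧ ξ = e) := by
    intro j ξ e1
    obtain ⟨ξ', h1, h2⟩ := hodd _ _ (hent e1 odd_ne_even)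
    exact param_inj.1 h1 ▸ h2
  have hmem : ∀ {i z}, i < n + n → pair i z ∈ b → Entry τ i z := fun hi h =>
    hτ.1.2.2 _ _ ((hu.entry_iff hb).2 ⟨hi, h⟩)
  obtain ⟨l, hl, hl', hl0⟩ := hτ.2
  obtain rfl := hl.eq hu.2.1
  refine ⟨t, ht, τ, (mem_inst (KB_mem hT) hWO.1).2 ⟨⟨hτ.1.2.1, n, hl', hl0, fun i hi => ⟨?_, ?_⟩, ?_⟩, ?_⟩,
    hpre'.trans hτ.1⟩
  · obtain ⟨z, hz⟩ := (hb.2.2 (i + i)).exists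
    obtain ⟨x, rfl, hx⟩ := heven _ _ hz
    obtain ⟨r, y, rfl⟩ := hpair _ _ hx
    exact ⟨r, y, hmem (add_self_lt.2 hi) hz⟩
  · obtain ⟨z, hz⟩ := (hb.2.2 (i + i + 1)).exists
    obtain ⟨ξ, rfl, -⟩ := hodd _ _ hz
    exact ⟨ξ, hmem (odd_lt_add_self.2 hi) hz⟩
  · intro j hj k hk hn hbased hkj hne' ξ η e1 e2
    -- Since `j < n`, the data on which `j` is based come from `b`, hence from `c`. So the
    -- parameters of `j` and of its initial segment `k` are these nodes themselves, and extensions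
    -- are smaller in the Kleene–Brouwer order.
    have hjT : j ∈ Tree θ c := by
      refine ⟨hn, fun i z e3 => ?_⟩
      obtain ⟨x, q, rfl, e4⟩ := hbased i z e3
      refine ⟨x, q, rfl, ?_⟩
      have hij : i < n := e3.lt_code.trans hj
      obtain ⟨x', h1, h2⟩ := heven _ _ (hent e4 (add_self_lt.2 hij).ne)
      rwa [add_right_cancel (term_inj.1 h1)]
    have hkT := hpre k j hkj hjT
    rcases hpar e1 with ⟨-, rfl⟩ | h
    · rcases hpar e2 with ⟨-, rfl⟩ | h
      · exact ⟨pair_mem_KB.2 ⟨hjT, hkT, .inl (KBLt.of_isPrefix S hkj hne')⟩, hne'.symm⟩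
      · exact (h.1 hkT).elim
    · exact (h.1 hjT).elim
  · rintro ξ ⟨i, e1⟩
    rw [mem_fld_KB]
    obtain ⟨j, rfl | rfl⟩ := even_or_odd S i
    · exfalso
      rcases hτ.entry hu.2.1 S e1 with e2 | ⟨-, h⟩
      · obtain ⟨x, h, -⟩ := heven _ _ (hu.2.2 _ _ e2)
        exact term_ne_param h.symm
      · exact term_ne_param h.symm
    · rcases hpar e1 with ⟨h, rfl⟩ | ⟨-, rfl⟩
      exacts [h, he]

end

/-! ### Sets as characteristic functions -/

/-- Replace the set `X` by the set of all `a` with `pair a 1 ∈ X`. -/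
def Fm.viaChar : {n k : ℕ} → Fin k → Fm n k → Fm n k
  | _, _, _, .eq s t => .eq s t
  | _, _, _, .lt s t => .lt s t
  | _, _, X, .mem t Y =>
    -- The new term is `pair t 1` written out.
    if Y = X then .mem (.add (.mul (.add t .one) (.add t .one)) t) Y else .mem t Y
  | _, _, _, .falsum => .falsum
  | _, _, X, .imp φ ψ => .imp (φ.viaChar X) (ψ.viaChar X)
  | _, _, X, .allN φ => .allN (φ.viaChar X)
  | _, _, _, .allS φ => .allS φ

/-- Every number has the value `0` or `1` under `X`. -/
def Fm.rangeChar {n k : ℕ} (X : Fin k) : Fm n k :=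
  -- The first term is `pair x 0` in simplified form and the second one is `pair x 1`; the
  -- disjunction is written as an implication.
  .allN (.imp (.neg (.mem (.add (.mul (.var 0) (.var 0)) (.var 0)) X))
    (.mem (.add (.mul (.add (.var 0) .one) (.add (.var 0) .one)) (.var 0)) X))

theorem Fm.IsArith.viaChar {n k : ℕ} {X : Fin k} {φ : Fm n k} (h : φ.IsArith) :
    (φ.viaChar X).IsArith := by
  induction φ with
  | mem t Y => unfold Fm.viaChar; split <;> trivial
  | imp φ ψ ih ih' => exact ⟨ih h.1, ih' h.2⟩
  | allN φ ih => exact ih h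
  | _ => exact h

section
variable {N : Type u} [ArithStr N] {S : Set (Set N)}

theorem Fm.sat_viaChar {n k : ℕ} {X : Fin k} {φ : Fm n k} (h : φ.IsArith) (v : Fin n → N)
    (V : Fin k → Set N) :
    (φ.viaChar X).Sat S v V ↔ φ.Sat S v (Function.update V X {a | pair a 1 ∈ V X}) := by
  induction φ with
  | mem t Y =>
    unfold Fm.viaChar
    split
    · subst Y
      simp [Fm.Sat, Tm.val, pair]
    · simp [Fm.Sat, *]
  | imp φ ψ ih ih' => exact imp_congr (ih h.1 v V) (ih' h.2 v V)
  | allN φ ih => exact forall_congr' fun a => ih h _ V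
  | allS φ => exact h.elim
  | _ => rfl

/-- The matrix of the formula that says that a function is the characteristic function of a set. -/
def Fm.charMatrix (θ : Fm 0 3) : Fm 0 3 := .neg (.imp (.rangeChar 2) (.neg (θ.viaChar 2)))

theorem Fm.IsArith.charMatrix {θ : Fm 0 3} (h : θ.IsArith) : θ.charMatrix.IsArith :=
  ⟨⟨⟨⟨trivial, trivial⟩, trivial⟩, h.viaChar, trivial⟩, trivial⟩

variable [PA N] [hM : Model S]

theorem sat_charMatrix {θ : Fm 0 3} (h : θ.IsArith) {Z Y R : Set N} :
    θ.charMatrix.Sat S ![] ![Z, Y, R] ↔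
      (∀ i, pair i 0 ∈ R ∨ pair i 1 ∈ R) ∧ θ.Sat S ![] ![Z, Y, {a | pair a 1 ∈ R}] := by
  have e : Function.update (![Z, Y, R] : Fin 3 → Set N) 2 {a | pair a 1 ∈ R} =
      ![Z, Y, {a | pair a 1 ∈ R}] := funext (forall_fin_three rfl rfl rfl)
  have h1 := Fm.sat_viaChar (S := S) (X := 2) h ![] ![Z, Y, R]
  rw [show (![Z, Y, R] : Fin 3 → Set N) 2 = R from rfl, e] at h1
  have h2 : (Fm.rangeChar (n := 0) (2 : Fin 3)).Sat S ![] ![Z, Y, R] ↔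
      ∀ i, pair i 0 ∈ R ∨ pair i 1 ∈ R := by
    refine forall_congr' fun i => ?_
    rw [or_iff_not_imp_left]
    simp only [Fm.Sat, Fm.neg, Tm.val, pair, add_zero]
    rfl
  rw [← h1, ← h2]
  simp only [Fm.charMatrix, Fm.neg, Fm.Sat]
  tauto

theorem sat_char {θ : Fm 0 3} (h : θ.IsArith) {R : Set N} :
    (Fm.exS (.allS θ.charMatrix)).Sat S ![] ![R] ↔ (∀ i, pair i 0 ∈ R ∨ pair i 1 ∈ R) ∧
      (Fm.exS (.allS θ)).Sat S ![] ![{a | pair a 1 ∈ R}] := by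
  simp only [sat_exS_allS, sat_charMatrix h]
  constructor
  · rintro ⟨Y, hY, hZ⟩
    exact ⟨(hZ Y hY).1, Y, hY, fun Z h => (hZ Z h).2⟩
  · rintro ⟨hR, Y, hY, hZ⟩
    exact ⟨Y, hY, fun Z h => ⟨hR, hZ Z h⟩⟩

omit hM in
theorem pair_mem_charGraph {A : Set N} {i x : N} :
    pair i x ∈ charGraph A ↔ (i ∈ A ∧ x = 1) ∨ (i ∉ A ∧ x = 0) := by
  constructor
  · rintro ⟨i', ⟨h, e⟩ | ⟨h, e⟩⟩ <;> obtain ⟨rfl, rfl⟩ := pair_inj.1 e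
    exacts [.inl ⟨h, rfl⟩, .inr ⟨h, rfl⟩]
  · rintro (⟨h, rfl⟩ | ⟨h, rfl⟩)
    exacts [⟨i, .inl ⟨h, rfl⟩⟩, ⟨i, .inr ⟨h, rfl⟩⟩]

theorem charGraph_isFun {A : Set N} (hA : A ∈ S) : IsFun S (charGraph A) := by
  have : MemS S A := ⟨hA⟩
  refine ⟨hM.out.setOf_mem fun p => ∃ i, (i ∈ A ∧ p = pair i 1) ∨ (i ∉ A ∧ p = pair i 0), ?_, ?_⟩
  · rintro p ⟨i, ⟨-, e⟩ | ⟨-, e⟩⟩ <;> exact ⟨i, _, e⟩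
  · intro i
    simp only [pair_mem_charGraph]
    by_cases h : i ∈ A <;> simp [h]

/-- A function with values `0` and `1` is determined by the set of arguments where it is `1`, so
uniqueness carries over from sets to functions. -/
theorem DefinesSet.definesFun {θ : Fm 0 3} (h : θ.IsArith) {A : Set N}
    (hA : DefinesSet S (.exS (.allS θ)) A) :
    DefinesFun S (.exS (.allS θ.charMatrix)) (charGraph A) := by
  have hAA : {a : N | pair a 1 ∈ charGraph A} = A := by
    ext a
    simp [pair_mem_charGraph]
  refine ⟨charGraph_isFun hA.1, (sat_char h).2 ⟨fun i => ?_, by rw [hAA]; exact hA.2.1⟩, ?_⟩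
  · simp only [pair_mem_charGraph]
    by_cases h : i ∈ A <;> simp [h]
  · intro R hR hs
    have : MemS S R := ⟨hR.1⟩
    obtain ⟨h1, h2⟩ := (sat_char h).1 hs
    have h3 := hA.2.2 _ (hM.out.setOf_mem fun a => pair a 1 ∈ R) h2
    have key : ∀ i x, pair i x ∈ R ↔ pair i x ∈ charGraph A := by
      intro i x
      rw [pair_mem_charGraph, ← h3]
      constructor
      · intro hx
        rcases h1 i with h0 | h0
        · obtain rfl := hR.eq hx h0
          exact .inr ⟨fun h => zero_ne_one (hR.eq h0 h), rfl⟩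
        · exact .inl ⟨h0, hR.eq hx h0⟩
      · rintro (⟨hi, rfl⟩ | ⟨hi, rfl⟩)
        exacts [hi, (h1 i).resolve_right hi]
    ext p
    constructor
    · intro hp
      obtain ⟨i, x, rfl⟩ := hR.2.1 p hp
      exact (key i x).1 hp
    · intro hp
      obtain ⟨i, x, rfl⟩ := (charGraph_isFun hA.1).2.1 p hp
      exact (key i x).2 hp

/-! ### The generated real and its recursive presentation -/

theorem generatesReal {θ : Fm 0 3} (h : θ.IsArith) {R : Set N}
    (hR : DefinesFun S (.exS (.allS θ)) R) : GeneratesReal S omega (DSet N θ) (RSet N) R := by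
  refine ⟨⟨isSemiGenedendron θ, fun α hα hW b hb α' hα' hW' b' hb' => ?_⟩, isLocallyWF_omega, ?_⟩
  · rw [hb.value_eq h hR hα hW, hb'.value_eq h hR hα' hW']
  · obtain ⟨α, hα, hW, b, hb⟩ := exists_branch h hR.1 hR.2.1
    exact ⟨α, hα, hW, b, hb, hb.value_eq h hR hα hW⟩

end

/-- The recursive presentation of the genedendron. -/
theorem exists_delta_generatesReal {θ : Fm 0 3} (h : θ.IsArith) :
    ∃ X D r : Delta01, ∀ (N : Type u) [ArithStr N] (S : Set (Set N)), ModelsACA0 S →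
      (X.Valid S ∧ D.Valid S ∧ r.Valid S) ∧ ∀ R : Set N, DefinesFun S (.exS (.allS θ)) R →
        GeneratesReal S (X.set S) (D.set S) (r.set S) R := by
  obtain ⟨X, hX⟩ := UB.exists_delta.{u} (P := fun N [ArithStr N] a => a ∈ (omega : Set N)) inferInstance
  obtain ⟨D, hD⟩ := UB.exists_delta.{u} (P := fun N [ArithStr N] a => a ∈ DSet N θ) inferInstance
  obtain ⟨r, hr⟩ := UB.exists_delta.{u} (P := fun N [ArithStr N] a => a ∈ RSet N) inferInstance
  refine ⟨X, D, r, fun N _ S hS => ?_⟩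
  have : Model S := ⟨hS⟩
  have := Model.pa S
  refine ⟨⟨(hX N S).1, (hD N S).1, (hr N S).1⟩, fun R hR => ?_⟩
  rw [(hX N S).2, (hD N S).2, (hr N S).2]
  exact generatesReal h hR

end SOA

theorem mainTheorem9 (φ : SOA.Fm 0 1) (hφ : φ.IsSigma12) :
    (∃ X D r : SOA.Delta01, ∀ (N : Type u) [SOA.ArithStr N] (S : Set (Set N)),
      SOA.ModelsACA0 S →
        (X.Valid S ∧ D.Valid S ∧ r.Valid S) ∧
        ∀ R : Set N, SOA.DefinesFun S φ R →
          SOA.GeneratesReal S (X.set S) (D.set S) (r.set S) R) ∧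
    (∃ X D r : SOA.Delta01, ∀ (N : Type u) [SOA.ArithStr N] (S : Set (Set N)),
      SOA.ModelsACA0 S →
        (X.Valid S ∧ D.Valid S ∧ r.Valid S) ∧
        ∀ A : Set N, SOA.DefinesSet S φ A →
          SOA.GeneratesReal S (X.set S) (D.set S) (r.set S) (SOA.charGraph A)) := by
  obtain ⟨θ, hθ, rfl⟩ := hφ
  refine ⟨SOA.exists_delta_generatesReal hθ, ?_⟩
  obtain ⟨X, D, r, h⟩ := SOA.exists_delta_generatesReal.{u} hθ.charMatrix
  refine ⟨X, D, r, fun N _ S hS => ⟨(h N S hS).1, fun A hA => (h N S hS).2 _ ?_⟩⟩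
  have : SOA.Model S := ⟨hS⟩
  have := SOA.Model.pa S
  exact hA.definesFun hθ
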